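/- Let $M$ be a smooth manifold of dimension $D\ge 3$ and $g$ a smooth pseudo-Riemannian metric on $M$ (of any signature), with Levi-Civita connection $\nabla$. Conventions: $\nabla_a\nabla_b\omega_c-\nabla_b\nabla_a\omega_c=R_{abc}{}^d\omega_d$, $R_{ac}=R_{abc}{}^b$, $R=g^{ac}R_{ac}$, the Schouten tensor is $L_{ab}=\frac{R_{ab}}{D-2}-\frac{g_{ab}R}{2(D-1)(D-2)}$, and the Weyl tensor is $C_{abc}{}^d=R_{abc}{}^d-2L_{[b}{}^dg_{a]c}-2\delta_{[b}{}^dL_{a]c}$; indices are raised and lowered with $g$, and round and square brackets denote (anti)symmetrization with total weight one. Assume that at every point the Weyl endomorphism $\psi^{be}\mapsto C^{ac}{}_{be}\psi^{be}$ of the space of bivectors is invertible, and let $W^{ac}{}_{be}$ be its inverse, so that $C^{ac}{}_{be}W^{be}{}_{lh}=\delta^a{}_{[l}\delta^c{}_{h]}$. Put $$\Lambda_q=\frac{4}{1-D}\,\nabla_{[b}L_{e]p}\,W^{bep}{}_q ,$$ let $\mathcal C$ be the torsion-free connection whose coefficients are those of $\nabla$ plus $g^{cd}g_{ab}\Lambda_d-\delta_b{}^c\Lambda_a-\delta_a{}^c\Lambda_b$,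 i.e. $\mathcal C_a v^c=\nabla_a v^c+(g^{cd}g_{ab}\Lambda_d-\delta_b{}^c\Lambda_a-\delta_a{}^c\Lambda_b)v^b$, let $\mathcal R_{ab}$ be its Ricci tensor (same conventions) and $\mathcal R=g^{ab}\mathcal R_{ab}$. Consider the conditions $$\mathcal R_{[ab]}=0,\qquad \mathcal R_{(ab)}-\frac1D\,g_{ab}\,\mathcal R=0\qquad\text{on } M. \tag{$*$}$$ On an open set $U\subseteq M$, say that $g$ is conformal to an Einstein metric if there are a smooth function $\Omega>0$ and a smooth pseudo-Riemannian metric $\tilde g$ on $U$ such that $g=\Omega^2\tilde g$ on $U$ and the Ricci tensor of $\tilde g$ is $\mu\,\tilde g$ for a constant $\mu\in\mathbb R$. Then: 1. $g$ is locally conformal to an Einstein metric (every point of $M$ has an open neighbourhood $U$ on which $g$ is conformal to an Einstein metric) if and only if $(*)$ holds. 2. In particular, if $g$ is conformal to an Einstein metric on all of $M$, then $(*)$ holds. 3. If $(*)$ holds, then the 1-form $\Lambda_a$ is closed. -/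

import Mathlib

open scoped Manifold ContDiff

noncomputable section

namespace ConfEinstein

/-- The model space of a `D`-dimensional manifold. -/
abbrev Coord (D : ℕ) : Type := EuclideanSpace ℝ (Fin D)

/-! ### Tensor calculus in a coordinate domain

Tensor fields are given by their components, which are functions of the coordinates.
Below `G` is the matrix of components `g_ab` of a metric and `K` the coefficients of a connection,
`K y c a b` being the coefficient `K^c_ab` at `y`; the convention is
`∇_a ω_b = ∂_a ω_b - K^c_ab ω_c` and `∇_a v^c = ∂_a v^c + K^c_ab v^b`. -/

/-- The partial derivative `∂_a f` at `y`. -/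
def pd {D : ℕ} (a : Fin D) (f : Coord D → ℝ) (y : Coord D) : ℝ :=
  fderiv ℝ f y (EuclideanSpace.single a 1)

/-- The Kronecker delta. -/
def kron {D : ℕ} (a b : Fin D) : ℝ := if a = b then 1 else 0

/-- The Christoffel symbols `Γ^c_ab` of the Levi-Civita connection. -/
def christoffel {D : ℕ} (G : Coord D → Matrix (Fin D) (Fin D) ℝ) (y : Coord D)
    (c a b : Fin D) : ℝ :=
  (1 / 2) * ∑ d, (G y)⁻¹ c d *
    (pd a (fun z ↦ G z b d) y + pd b (fun z ↦ G z a d) y - pd d (fun z ↦ G z a b) y)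

/-- The curvature `R_abc^d` of a torsion-free connection, in the convention
`∇_a ∇_b ω_c - ∇_b ∇_a ω_c = R_abc^d ω_d`. -/
def curvature {D : ℕ} (K : Coord D → Fin D → Fin D → Fin D → ℝ) (y : Coord D)
    (a b c d : Fin D) : ℝ :=
  pd b (fun z ↦ K z d a c) y - pd a (fun z ↦ K z d b c) y
    + ∑ e, (K y e a c * K y d b e - K y e b c * K y d a e)

/-- The Ricci tensor `R_ac = R_abc^b` of a torsion-free connection. -/
def ricci {D : ℕ} (K : Coord D → Fin D → Fin D → Fin D → ℝ) (y : Coord D) (a c : Fin D) : ℝ :=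
  ∑ b, curvature K y a b c b

/-- The trace `g^ac R_ac` of the Ricci tensor of the connection `K` with respect to the
metric `G`. -/
def scalarCurv {D : ℕ} (G : Coord D → Matrix (Fin D) (Fin D) ℝ)
    (K : Coord D → Fin D → Fin D → Fin D → ℝ) (y : Coord D) : ℝ :=
  ∑ a, ∑ c, (G y)⁻¹ a c * ricci K y a c

/-- The Schouten tensor `L_ab = R_ab / (D - 2) - g_ab R / (2 (D - 1) (D - 2))`. -/
def schouten {D : ℕ} (G : Coord D → Matrix (Fin D) (Fin D) ℝ) (y : Coord D)
    (a b : Fin D) : ℝ :=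
  ricci (christoffel G) y a b / ((D : ℝ) - 2)
    - G y a b * scalarCurv G (christoffel G) y / (2 * ((D : ℝ) - 1) * ((D : ℝ) - 2))

/-- The covariant derivative `∇_c T_ab` of a tensor field with two lower indices. -/
def covDeriv₂ {D : ℕ} (K : Coord D → Fin D → Fin D → Fin D → ℝ)
    (T : Coord D → Fin D → Fin D → ℝ) (y : Coord D) (c a b : Fin D) : ℝ :=
  pd c (fun z ↦ T z a b) y - ∑ d, (K y d c a * T y d b + K y d c b * T y a d)

/-- The antisymmetrized derivative `∇_[b L_e]p` of the Schouten tensor. -/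
def cotton {D : ℕ} (G : Coord D → Matrix (Fin D) (Fin D) ℝ) (y : Coord D)
    (b e p : Fin D) : ℝ :=
  (1 / 2) * (covDeriv₂ (christoffel G) (schouten G) y b e p
    - covDeriv₂ (christoffel G) (schouten G) y e b p)

/-- The Weyl tensor `C_abc^d = R_abc^d - 2 L_[b^d g_a]c - 2 δ_[b^d L_a]c`. -/
def weyl {D : ℕ} (G : Coord D → Matrix (Fin D) (Fin D) ℝ) (y : Coord D)
    (a b c d : Fin D) : ℝ :=
  curvature (christoffel G) y a b c d
    - ((∑ e, (G y)⁻¹ d e * schouten G y b e) * G y a c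
        - (∑ e, (G y)⁻¹ d e * schouten G y a e) * G y b c)
    - (kron b d * schouten G y a c - kron a d * schouten G y b c)

/-- The Weyl tensor `C^ac_be`, in the index positions of the Weyl endomorphism
(`C_pqb^f` with `p`, `q` raised and `f` lowered). -/
def weylUp {D : ℕ} (G : Coord D → Matrix (Fin D) (Fin D) ℝ) (y : Coord D)
    (a c b e : Fin D) : ℝ :=
  ∑ p, ∑ q, ∑ f, (G y)⁻¹ a p * (G y)⁻¹ c q * weyl G y p q b f * G y f e

/-- The space of bivectors `ψ^ab = -ψ^ba`. -/
def bivector (D : ℕ) : Submodule ℝ (Matrix (Fin D) (Fin D) ℝ) where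
  carrier := {ψ | ∀ a b, ψ b a = -ψ a b}
  add_mem' := by
    intro ψ χ hψ hχ a b
    simp only [Matrix.add_apply, hψ a b, hχ a b]
    ring
  zero_mem' := by
    intro a b
    simp
  smul_mem' := by
    intro t ψ hψ a b
    simp only [Matrix.smul_apply, hψ a b, smul_eq_mul]
    ring

theorem weyl_swap {D : ℕ} (G : Coord D → Matrix (Fin D) (Fin D) ℝ) (y : Coord D)
    (a b c d : Fin D) : weyl G y b a c d = -weyl G y a b c d := by
  have h : curvature (christoffel G) y b a c d = -curvature (christoffel G) y a b c d := by
    simp only [curvature, Finset.sum_sub_distrib]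
    ring
  simp only [weyl, h]
  ring

theorem weylUp_swap {D : ℕ} (G : Coord D → Matrix (Fin D) (Fin D) ℝ) (y : Coord D)
    (a c b e : Fin D) : weylUp G y c a b e = -weylUp G y a c b e := by
  unfold weylUp
  rw [Finset.sum_comm]
  simp only [← Finset.sum_neg_distrib]
  refine Finset.sum_congr rfl fun p _ ↦ Finset.sum_congr rfl fun q _ ↦
    Finset.sum_congr rfl fun f _ ↦ ?_
  rw [weyl_swap G y p q b f]
  ring

/-- The Weyl endomorphism `ψ^be ↦ C^ac_be ψ^be` of the space of bivectors at `y`. -/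
def weylEnd {D : ℕ} (G : Coord D → Matrix (Fin D) (Fin D) ℝ) (y : Coord D) :
    Module.End ℝ (bivector D) where
  toFun ψ := ⟨Matrix.of fun a c ↦ ∑ b, ∑ e, weylUp G y a c b e * ψ.1 b e, by
    intro a c
    simp only [Matrix.of_apply, weylUp_swap G y a c, neg_mul, Finset.sum_neg_distrib]⟩
  map_add' := by
    intro ψ χ
    ext a c
    simp [mul_add, Finset.sum_add_distrib]
  map_smul' := by
    intro t ψ
    ext a c
    simp only [Submodule.coe_smul, Matrix.of_apply, Matrix.smul_apply, smul_eq_mul,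
      RingHom.id_apply, Finset.mul_sum]
    refine Finset.sum_congr rfl fun b _ ↦ Finset.sum_congr rfl fun e _ ↦ ?_
    ring

/-- The bivector `δ^a_[l δ^c_h]` (free indices `a`, `c`). -/
def unitBivector {D : ℕ} (l h : Fin D) : bivector D :=
  ⟨Matrix.of fun a c ↦ (1 / 2) * (kron a l * kron c h - kron a h * kron c l), by
    intro a c
    simp only [Matrix.of_apply]
    ring⟩

/-- The components `W^be_lh` of the inverse of the Weyl endomorphism; they satisfy
`C^ac_be W^be_lh = δ^a_[l δ^c_h]` wherever the Weyl endomorphism is invertible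
(`weylUp_mul_weylInv`). -/
def weylInv {D : ℕ} (G : Coord D → Matrix (Fin D) (Fin D) ℝ) (y : Coord D)
    (b e l h : Fin D) : ℝ :=
  (Ring.inverse (weylEnd G y) (unitBivector l h)).1 b e

theorem weylUp_mul_weylInv {D : ℕ} (G : Coord D → Matrix (Fin D) (Fin D) ℝ) (y : Coord D)
    (hC : IsUnit (weylEnd G y)) (a c l h : Fin D) :
    ∑ b, ∑ e, weylUp G y a c b e * weylInv G y b e l h =
      (1 / 2) * (kron a l * kron c h - kron a h * kron c l) := by
  have h1 : (weylEnd G y * Ring.inverse (weylEnd G y)) (unitBivector l h) = unitBivector l h := by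
    rw [Ring.mul_inverse_cancel _ hC]
    rfl
  exact congrFun (congrFun (congrArg Subtype.val h1) a) c

/-- The covector `Λ_q = (4 / (1 - D)) ∇_[b L_e]p W^bep_q`, where `W^bep_q = g^pr W^be_rq`. -/
def lam {D : ℕ} (G : Coord D → Matrix (Fin D) (Fin D) ℝ) (y : Coord D) (q : Fin D) : ℝ :=
  4 / (1 - (D : ℝ)) *
    ∑ b, ∑ e, ∑ p, cotton G y b e p * ∑ r, (G y)⁻¹ p r * weylInv G y b e r q

/-- The coefficients of the `𝒞`-connection,
`Γ^c_ab + g^cd g_ab Λ_d - δ_b^c Λ_a - δ_a^c Λ_b`. -/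
def cConn {D : ℕ} (G : Coord D → Matrix (Fin D) (Fin D) ℝ) (y : Coord D)
    (c a b : Fin D) : ℝ :=
  christoffel G y c a b + (∑ d, (G y)⁻¹ c d * lam G y d) * G y a b
    - kron c b * lam G y a - kron c a * lam G y b

/-! ### Manifolds

An equation between tensor fields on a manifold is an equation between their components in every
chart of the maximal smooth atlas. -/

variable {D : ℕ} {M : Type*} [TopologicalSpace M] [ChartedSpace (Coord D) M]

/-- Fields of bilinear forms on the tangent spaces of `M`. -/
abbrev BilinField (D : ℕ) (M : Type*) [TopologicalSpace M] [ChartedSpace (Coord D) M] : Type _ :=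
  (x : M) → TangentSpace (𝓡 D) x →L[ℝ] TangentSpace (𝓡 D) x →L[ℝ] ℝ

/-- `g` is a smooth pseudo-Riemannian metric (of any signature) on the open set `U`. -/
structure IsPseudoRiemannianOn [IsManifold (𝓡 D) ∞ M] (g : BilinField D M) (U : Set M) :
    Prop where
  symm : ∀ x ∈ U, ∀ v w, g x v w = g x w v
  nondegenerate : ∀ x ∈ U, ∀ v, (∀ w, g x v w = 0) → v = 0
  smooth : ContMDiffOn (𝓡 D) ((𝓡 D).prod 𝓘(ℝ, Coord D →L[ℝ] Coord D →L[ℝ] ℝ)) ∞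
    (fun x ↦ Bundle.TotalSpace.mk' (Coord D →L[ℝ] Coord D →L[ℝ] ℝ)
      (E := fun x : M ↦ TangentSpace (𝓡 D) x →L[ℝ] TangentSpace (𝓡 D) x →L[ℝ] ℝ) x (g x)) U

/-- The coordinate vector field `∂_a` of the chart `e`, at the point with coordinates `y`. -/
def coordVec (e : OpenPartialHomeomorph M (Coord D)) (y : Coord D) (a : Fin D) :
    TangentSpace (𝓡 D) (e.symm y) :=
  mfderiv (𝓡 D) (𝓡 D) e.symm y (EuclideanSpace.single a (1 : ℝ))

/-- The components `g_ab = g(∂_a, ∂_b)` in the chart `e`, as functions of the coordinates. -/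
def comp (g : BilinField D M) (e : OpenPartialHomeomorph M (Coord D)) (y : Coord D) :
    Matrix (Fin D) (Fin D) ℝ :=
  Matrix.of fun a b ↦ g (e.symm y) (coordVec e y a) (coordVec e y b)

/-- The metric `g` is Einstein on the open set `U`: `R_ab = μ g_ab` with a constant `μ`. -/
def IsEinsteinOn (g : BilinField D M) (U : Set M) : Prop :=
  ∃ μ : ℝ, ∀ e ∈ IsManifold.maximalAtlas (𝓡 D) ∞ M, ∀ y ∈ e.target, e.symm y ∈ U →
    ∀ a b, ricci (christoffel (comp g e)) y a b = μ * comp g e y a b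

/-- On the open set `U`, the metric `g` is conformal to an Einstein metric: `g = Ω² g'` with an
Einstein metric `g'` and a smooth positive function `Ω` on `U`. -/
def IsConformallyEinsteinOn [IsManifold (𝓡 D) ∞ M] (g : BilinField D M) (U : Set M) : Prop :=
  ∃ (g' : BilinField D M) (Ω : M → ℝ),
    IsPseudoRiemannianOn g' U ∧ IsEinsteinOn g' U ∧
    ContMDiffOn (𝓡 D) 𝓘(ℝ, ℝ) ∞ Ω U ∧ (∀ x ∈ U, 0 < Ω x) ∧
    ∀ x ∈ U, g x = (Ω x) ^ 2 • g' x

/-- The Weyl endomorphism of `g` is invertible at every point of `M`. -/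
def HasInvertibleWeyl (g : BilinField D M) : Prop :=
  ∀ e ∈ IsManifold.maximalAtlas (𝓡 D) ∞ M, ∀ y ∈ e.target, IsUnit (weylEnd (comp g e) y)

/-- The Ricci tensor `𝓡_ab` of the `𝒞`-connection satisfies
`𝓡_[ab] = 0` and `𝓡_(ab) - (1 / D) g_ab 𝓡 = 0`, where `𝓡 = g^ab 𝓡_ab`. -/
def CRicciCondition (g : BilinField D M) : Prop :=
  ∀ e ∈ IsManifold.maximalAtlas (𝓡 D) ∞ M, ∀ y ∈ e.target, ∀ a b,
    (1 / 2) * (ricci (cConn (comp g e)) y a b - ricci (cConn (comp g e)) y b a) = 0 ∧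
    (1 / 2) * (ricci (cConn (comp g e)) y a b + ricci (cConn (comp g e)) y b a)
      - 1 / (D : ℝ) * comp g e y a b * scalarCurv (comp g e) (cConn (comp g e)) y = 0

/-- The 1-form `Λ` is closed: `∂_a Λ_b - ∂_b Λ_a = 0`. -/
def LamClosed (g : BilinField D M) : Prop :=
  ∀ e ∈ IsManifold.maximalAtlas (𝓡 D) ∞ M, ∀ y ∈ e.target, ∀ a b,
    pd a (fun z ↦ lam (comp g e) z b) y - pd b (fun z ↦ lam (comp g e) z a) y = 0

end ConfEinstein

end

/-!
Write `Υ = df` for a function `f` in a coordinate domain. The Levi-Civita connection of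
`e^(-2f) g` has the coefficients of `𝒞` with `Υ` in place of `Λ`
(`IsMetricOn.christoffel_confMetric`), so everything rests on when `Λ` is such a differential.

*The form of `Λ`.* If `e^(-2f) g` is Einstein, the conformal change of the Ricci tensor
(`IsMetricOn.ricci_weylConn`) says that `L_ab + ∇_a Υ_b + Υ_a Υ_b` is a multiple of `g_ab`.
Antisymmetrizing its derivative and using the Ricci identity, one gets
`∇_[b L_e]p = -½ C_bep^d Υ_d` up to terms containing `g_ep` and `g_bp`. Both sides are trace-free,
the left one by the contracted Bianchi identity (`IsMetricOn.sum_inv_mul_cotton`), so these terms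
vanish (`IsMetricOn.cotton_eq`). By the pair symmetry of the Weyl tensor, contraction with the
inverse of the Weyl endomorphism recovers `Υ`, and the factor `4 / (1 - D)` is the one that makes
`Λ = Υ` (`IsMetricOn.lam_eq_of_cotton`). Hence `𝒞` is the Levi-Civita connection of `e^(-2f) g`,
and its Ricci tensor is pure trace (`IsMetricOn.ricci_cConn_of_confMetric`).

*The converse.* The antisymmetric part of the Ricci tensor of `𝒞` is a multiple of `dΛ`, so its
vanishing makes `Λ` closed (`IsMetricOn.lam_closed`). On a coordinate ball `Λ = df` by the Poincaré
lemma (`exists_pd_eq`), so `𝒞` is the Levi-Civita connection of `e^(-2f) g`, whose Ricci tensor is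
then pure trace; by Schur's lemma (`IsMetricOn.schur`) the factor is constant, so `e^(-2f) g` is
Einstein (`IsMetricOn.exists_einstein_confMetric`).

*Charts.* The Einstein condition is required in every chart of the maximal atlas, whereas `f` is
constructed in one of them. The covariance of the Ricci tensor (`IsCoordChange.ricci_eq`) carries
the condition over. It is derived from the uniqueness of the Levi-Civita connection
(`IsMetricOn.christoffel_unique`), which shows that the Christoffel symbols transform by a gauge
transformation with the Jacobian matrix.

For the calculus, connection coefficients and curvature are arranged in matrices (`connMat`, `curvMat`),
so that most identities are identities between noncommuting matrices.
-/

noncomputable section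

namespace ConfEinstein

open Filter Topology Matrix

variable {D : ℕ}

/-! ### Partial derivatives of functions and of matrices of functions -/

theorem differentiableAt_of_contDiffAt_top {f : Coord D → ℝ} {y : Coord D}
    (hf : ContDiffAt ℝ ∞ f y) : DifferentiableAt ℝ f y :=
  hf.differentiableAt (by simp)

theorem pd_congr {f g : Coord D → ℝ} {y : Coord D} (h : f =ᶠ[𝓝 y] g) (a : Fin D) :
    pd a f y = pd a g y := by
  rw [pd, h.fderiv_eq, ← pd]

@[simp]
theorem pd_const (a : Fin D) (c : ℝ) (y : Coord D) : pd a (fun _ ↦ c) y = 0 := by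
  simp [pd]

theorem pd_add {f g : Coord D → ℝ} {y : Coord D} (hf : DifferentiableAt ℝ f y)
    (hg : DifferentiableAt ℝ g y) (a : Fin D) :
    pd a (fun z ↦ f z + g z) y = pd a f y + pd a g y := by
  simp [pd, fderiv_fun_add hf hg]

theorem pd_sub {f g : Coord D → ℝ} {y : Coord D} (hf : DifferentiableAt ℝ f y)
    (hg : DifferentiableAt ℝ g y) (a : Fin D) :
    pd a (fun z ↦ f z - g z) y = pd a f y - pd a g y := by
  simp [pd, fderiv_fun_sub hf hg]

theorem pd_neg (f : Coord D → ℝ) (y : Coord D) (a : Fin D) :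
    pd a (fun z ↦ -f z) y = -pd a f y := by
  simp [pd, fderiv_fun_neg]

theorem pd_mul {f g : Coord D → ℝ} {y : Coord D} (hf : DifferentiableAt ℝ f y)
    (hg : DifferentiableAt ℝ g y) (a : Fin D) :
    pd a (fun z ↦ f z * g z) y = pd a f y * g y + f y * pd a g y := by
  simp only [pd, fderiv_fun_mul hf hg, _root_.add_apply,
    _root_.smul_apply, smul_eq_mul]
  ring

theorem pd_const_mul {f : Coord D → ℝ} {y : Coord D} (hf : DifferentiableAt ℝ f y) (c : ℝ)
    (a : Fin D) : pd a (fun z ↦ c * f z) y = c * pd a f y := by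
  rw [pd_mul (by fun_prop) hf]
  simp

theorem pd_sum {ι : Type*} (s : Finset ι) {f : ι → Coord D → ℝ} {y : Coord D}
    (hf : ∀ i ∈ s, DifferentiableAt ℝ (f i) y) (a : Fin D) :
    pd a (fun z ↦ ∑ i ∈ s, f i z) y = ∑ i ∈ s, pd a (f i) y := by
  simp [pd, fderiv_fun_sum hf]

theorem contDiffAt_pd {f : Coord D → ℝ} {y : Coord D} (hf : ContDiffAt ℝ ∞ f y) (a : Fin D) :
    ContDiffAt ℝ ∞ (pd a f) y :=
  (hf.fderiv_right (m := ∞) (by simp)).clm_apply contDiffAt_const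

theorem pd_comm {f : Coord D → ℝ} {y : Coord D} (hf : ContDiffAt ℝ ∞ f y) (a b : Fin D) :
    pd a (pd b f) y = pd b (pd a f) y := by
  have hd : DifferentiableAt ℝ (fderiv ℝ f) y :=
    (hf.fderiv_right (m := ∞) (by simp)).differentiableAt (by simp)
  have key : ∀ a b : Fin D, pd a (pd b f) y =
      fderiv ℝ (fderiv ℝ f) y (EuclideanSpace.single a 1) (EuclideanSpace.single b 1) := by
    intro a b
    have h : pd b f = fun z ↦ fderiv ℝ f z (EuclideanSpace.single b 1) := rfl
    rw [h, pd, fderiv_clm_apply hd (by fun_prop)]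
    simp
  rw [key, key]
  exact hf.isSymmSndFDerivAt (by
    rw [minSmoothness_of_isRCLikeNormedField]
    exact WithTop.coe_le_coe.2 (le_top : (2 : ℕ∞) ≤ ⊤)) _ _

/-- The matrix of the partial derivatives `∂_a F_ij` of the entries of a matrix of functions. -/
def mpd (a : Fin D) (F : Coord D → Matrix (Fin D) (Fin D) ℝ) (y : Coord D) :
    Matrix (Fin D) (Fin D) ℝ :=
  Matrix.of fun i j ↦ pd a (fun z ↦ F z i j) y

/-- All entries of the matrix of functions `F` are smooth at `y`. -/
def MSmooth (F : Coord D → Matrix (Fin D) (Fin D) ℝ) (y : Coord D) : Prop :=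
  ∀ i j, ContDiffAt ℝ ∞ (fun z ↦ F z i j) y

theorem MSmooth.diff {F : Coord D → Matrix (Fin D) (Fin D) ℝ} {y : Coord D} (h : MSmooth F y)
    (i j : Fin D) : DifferentiableAt ℝ (fun z ↦ F z i j) y :=
  differentiableAt_of_contDiffAt_top (h i j)

section
variable {F H : Coord D → Matrix (Fin D) (Fin D) ℝ} {y : Coord D}

theorem MSmooth.add (hF : MSmooth F y) (hH : MSmooth H y) : MSmooth (fun z ↦ F z + H z) y :=
  fun i j ↦ (hF i j).add (hH i j)

theorem MSmooth.sub (hF : MSmooth F y) (hH : MSmooth H y) : MSmooth (fun z ↦ F z - H z) y :=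
  fun i j ↦ (hF i j).sub (hH i j)

theorem MSmooth.mul (hF : MSmooth F y) (hH : MSmooth H y) : MSmooth (fun z ↦ F z * H z) y := by
  intro i j
  simp only [Matrix.mul_apply]
  exact ContDiffAt.sum fun k _ ↦ (hF i k).mul (hH k j)

theorem MSmooth.transpose (hF : MSmooth F y) : MSmooth (fun z ↦ (F z)ᵀ) y :=
  fun i j ↦ hF j i

theorem MSmooth.smul {f : Coord D → ℝ} (hf : ContDiffAt ℝ ∞ f y) (hF : MSmooth F y) :
    MSmooth (fun z ↦ f z • F z) y :=
  fun i j ↦ hf.mul (hF i j)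

theorem MSmooth.sum {ι : Type*} {s : Finset ι} {F : ι → Coord D → Matrix (Fin D) (Fin D) ℝ}
    (hF : ∀ i ∈ s, MSmooth (F i) y) : MSmooth (fun z ↦ ∑ i ∈ s, F i z) y := by
  intro i j
  simp only [Matrix.sum_apply]
  exact ContDiffAt.sum fun k hk ↦ hF k hk i j

theorem MSmooth.mpd (hF : MSmooth F y) (a : Fin D) : MSmooth (mpd a F) y :=
  fun i j ↦ contDiffAt_pd (hF i j) a

theorem mpd_congr (h : F =ᶠ[𝓝 y] H) (a : Fin D) : mpd a F y = mpd a H y := by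
  ext i j
  exact pd_congr (h.mono fun z hz ↦ by simp only [hz]) a

theorem mpd_add (hF : MSmooth F y) (hH : MSmooth H y) (a : Fin D) :
    mpd a (fun z ↦ F z + H z) y = mpd a F y + mpd a H y := by
  ext i j
  exact pd_add (hF.diff i j) (hH.diff i j) a

theorem mpd_sub (hF : MSmooth F y) (hH : MSmooth H y) (a : Fin D) :
    mpd a (fun z ↦ F z - H z) y = mpd a F y - mpd a H y := by
  ext i j
  exact pd_sub (hF.diff i j) (hH.diff i j) a

theorem mpd_mul (hF : MSmooth F y) (hH : MSmooth H y) (a : Fin D) :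
    mpd a (fun z ↦ F z * H z) y = mpd a F y * H y + F y * mpd a H y := by
  ext i j
  simp only [mpd, Matrix.mul_apply, Matrix.of_apply, Matrix.add_apply]
  rw [pd_sum (f := fun k z ↦ F z i k * H z k j) _ fun k _ ↦ (hF.diff i k).mul (hH.diff k j),
    ← Finset.sum_add_distrib]
  exact Finset.sum_congr rfl fun k _ ↦ pd_mul (hF.diff i k) (hH.diff k j) a

theorem mpd_transpose (a : Fin D) : mpd a (fun z ↦ (F z)ᵀ) y = (mpd a F y)ᵀ := rfl

theorem mpd_smul {f : Coord D → ℝ} (hf : ContDiffAt ℝ ∞ f y) (hF : MSmooth F y) (a : Fin D) :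
    mpd a (fun z ↦ f z • F z) y = pd a f y • F y + f y • mpd a F y := by
  ext i j
  exact pd_mul (differentiableAt_of_contDiffAt_top hf) (hF.diff i j) a

theorem mpd_sum {ι : Type*} {s : Finset ι} {F : ι → Coord D → Matrix (Fin D) (Fin D) ℝ}
    (hF : ∀ i ∈ s, MSmooth (F i) y) (a : Fin D) :
    mpd a (fun z ↦ ∑ i ∈ s, F i z) y = ∑ i ∈ s, mpd a (F i) y := by
  ext i j
  simp only [mpd, Matrix.sum_apply, Matrix.of_apply]
  exact pd_sum _ (fun k hk ↦ (hF k hk).diff i j) a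

theorem mpd_comm (hF : MSmooth F y) (a b : Fin D) :
    mpd a (mpd b F) y = mpd b (mpd a F) y := by
  ext i j
  exact pd_comm (hF i j) a b

end

theorem contDiffAt_det {n : Type*} [Fintype n] [DecidableEq n]
    {F : Coord D → Matrix n n ℝ} {y : Coord D}
    (h : ∀ i j, ContDiffAt ℝ ∞ (fun z ↦ F z i j) y) : ContDiffAt ℝ ∞ (fun z ↦ (F z).det) y := by
  simp only [Matrix.det_apply]
  refine ContDiffAt.sum fun σ _ ↦ ?_
  simp only [Units.smul_def, zsmul_eq_mul]
  exact contDiffAt_const.mul (contDiffAt_prod fun i _ ↦ h _ _)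

theorem contDiffAt_matrix_inv {n : Type*} [Fintype n] [DecidableEq n]
    {F : Coord D → Matrix n n ℝ} {y : Coord D}
    (h : ∀ i j, ContDiffAt ℝ ∞ (fun z ↦ F z i j) y) (hu : IsUnit (F y).det) (i j : n) :
    ContDiffAt ℝ ∞ (fun z ↦ (F z)⁻¹ i j) y := by
  simp only [Matrix.inv_def, Ring.inverse_eq_inv', Matrix.smul_apply, smul_eq_mul]
  refine ((contDiffAt_det h).inv hu.ne_zero).mul ?_
  simp only [Matrix.adjugate_apply]
  refine contDiffAt_det fun k l ↦ ?_
  simp only [Matrix.updateRow_apply]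
  split_ifs
  · exact contDiffAt_const
  · exact h _ _

theorem MSmooth.inv {F : Coord D → Matrix (Fin D) (Fin D) ℝ} {y : Coord D} (hF : MSmooth F y)
    (hu : IsUnit (F y).det) : MSmooth (fun z ↦ (F z)⁻¹) y :=
  contDiffAt_matrix_inv hF hu

/-! ### Connections in matrix form -/

/-- The matrix `A_a` of the connection coefficients `(A_a)^d_c = K^d_ac`. -/
def connMat (K : Coord D → Fin D → Fin D → Fin D → ℝ) (a : Fin D) (y : Coord D) :
    Matrix (Fin D) (Fin D) ℝ :=
  Matrix.of fun d c ↦ K y d a c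

/-- The curvature `R_abc^d` as a matrix with row index `d` and column index `c`. -/
def curvMat (K : Coord D → Fin D → Fin D → Fin D → ℝ) (a b : Fin D) (y : Coord D) :
    Matrix (Fin D) (Fin D) ℝ :=
  Matrix.of fun d c ↦ curvature K y a b c d

theorem curvMat_eq (K : Coord D → Fin D → Fin D → Fin D → ℝ) (a b : Fin D) (y : Coord D) :
    curvMat K a b y = mpd b (connMat K a) y - mpd a (connMat K b) y
      + connMat K b y * connMat K a y - connMat K a y * connMat K b y := by
  ext d c
  simp only [curvMat, curvature, mpd, connMat, Matrix.of_apply, Matrix.sub_apply,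
    Matrix.add_apply, Matrix.mul_apply, Finset.sum_sub_distrib]
  rw [Finset.sum_congr rfl fun e _ ↦ mul_comm (K y e a c) (K y d b e),
    Finset.sum_congr rfl fun e _ ↦ mul_comm (K y e b c) (K y d a e)]
  ring

theorem curvature_swap (K : Coord D → Fin D → Fin D → Fin D → ℝ) (y : Coord D)
    (a b c d : Fin D) : curvature K y b a c d = -curvature K y a b c d := by
  simp only [curvature, Finset.sum_sub_distrib]
  ring

/-- The second Bianchi identity, for the covariant derivative that acts on the two matrix indices
of the curvature only. -/
theorem curvMat_bianchi {K : Coord D → Fin D → Fin D → Fin D → ℝ} {y : Coord D}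
    (hK : ∀ a, MSmooth (connMat K a) y) (e a b : Fin D) :
    (mpd e (curvMat K a b) y + connMat K e y * curvMat K a b y
        - curvMat K a b y * connMat K e y)
      + (mpd a (curvMat K b e) y + connMat K a y * curvMat K b e y
        - curvMat K b e y * connMat K a y)
      + (mpd b (curvMat K e a) y + connMat K b y * curvMat K e a y
        - curvMat K e a y * connMat K b y) = 0 := by
  have key : ∀ e a b, mpd e (curvMat K a b) y =
      mpd e (mpd b (connMat K a)) y - mpd e (mpd a (connMat K b)) y
      + (mpd e (connMat K b) y * connMat K a y + connMat K b y * mpd e (connMat K a) y)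
      - (mpd e (connMat K a) y * connMat K b y + connMat K a y * mpd e (connMat K b) y) := by
    intro e a b
    have h : curvMat K a b = fun z ↦ mpd b (connMat K a) z - mpd a (connMat K b) z
      + connMat K b z * connMat K a z - connMat K a z * connMat K b z :=
      funext fun z ↦ curvMat_eq K a b z
    rw [h, mpd_sub ((((hK a).mpd b).sub ((hK b).mpd a)).add ((hK b).mul (hK a)))
      ((hK a).mul (hK b)), mpd_add (((hK a).mpd b).sub ((hK b).mpd a)) ((hK b).mul (hK a)),
      mpd_sub ((hK a).mpd b) ((hK b).mpd a), mpd_mul (hK b) (hK a), mpd_mul (hK a) (hK b)]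
  rw [key, key, key, curvMat_eq, curvMat_eq, curvMat_eq, mpd_comm (hK b) e a,
    mpd_comm (hK a) e b, mpd_comm (hK e) a b]
  noncomm_ring

/-! ### The Levi-Civita connection of a metric in a coordinate domain -/

/-- `G` is the matrix of components of a smooth pseudo-Riemannian metric on the open set `S`. -/
structure IsMetricOn (G : Coord D → Matrix (Fin D) (Fin D) ℝ) (S : Set (Coord D)) : Prop where
  isOpen : IsOpen S
  smooth : ∀ y ∈ S, MSmooth G y
  symm : ∀ y ∈ S, (G y)ᵀ = G y
  det : ∀ y ∈ S, IsUnit (G y).det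

/-- The lowered Christoffel symbols `Γ_eac`, as a matrix in the indices `e`, `c`. -/
def lowMat (G : Coord D → Matrix (Fin D) (Fin D) ℝ) (a : Fin D) (y : Coord D) :
    Matrix (Fin D) (Fin D) ℝ :=
  Matrix.of fun e c ↦ (1 / 2) *
    (pd a (fun z ↦ G z c e) y + pd c (fun z ↦ G z a e) y - pd e (fun z ↦ G z a c) y)

theorem connMat_christoffel (G : Coord D → Matrix (Fin D) (Fin D) ℝ) (a : Fin D) (y : Coord D) :
    connMat (christoffel G) a y = (G y)⁻¹ * lowMat G a y := by
  ext d c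
  simp only [connMat, christoffel, lowMat, Matrix.of_apply, Matrix.mul_apply, Finset.mul_sum]
  exact Finset.sum_congr rfl fun e _ ↦ by ring

namespace IsMetricOn

variable {G : Coord D → Matrix (Fin D) (Fin D) ℝ} {S : Set (Coord D)} {y : Coord D}

theorem mem_nhds (hG : IsMetricOn G S) (hy : y ∈ S) : S ∈ 𝓝 y := hG.isOpen.mem_nhds hy

theorem apply_comm (hG : IsMetricOn G S) (hy : y ∈ S) (a b : Fin D) : G y a b = G y b a :=
  congrFun (congrFun (hG.symm y hy) b) a

theorem smooth_inv (hG : IsMetricOn G S) (hy : y ∈ S) : MSmooth (fun z ↦ (G z)⁻¹) y :=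
  (hG.smooth y hy).inv (hG.det y hy)

theorem inv_mul (hG : IsMetricOn G S) (hy : y ∈ S) : (G y)⁻¹ * G y = 1 :=
  Matrix.nonsing_inv_mul _ (hG.det y hy)

theorem mul_inv (hG : IsMetricOn G S) (hy : y ∈ S) : G y * (G y)⁻¹ = 1 :=
  Matrix.mul_nonsing_inv _ (hG.det y hy)

theorem inv_symm (hG : IsMetricOn G S) (hy : y ∈ S) : ((G y)⁻¹)ᵀ = (G y)⁻¹ := by
  rw [Matrix.transpose_nonsing_inv, hG.symm y hy]

theorem inv_apply_comm (hG : IsMetricOn G S) (hy : y ∈ S) (a b : Fin D) :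
    (G y)⁻¹ a b = (G y)⁻¹ b a :=
  congrFun (congrFun (hG.inv_symm hy) b) a

theorem pd_apply_comm (hG : IsMetricOn G S) (hy : y ∈ S) (c a b : Fin D) :
    pd c (fun z ↦ G z a b) y = pd c (fun z ↦ G z b a) y :=
  pd_congr (eventually_of_mem (hG.mem_nhds hy) fun _ hz ↦ hG.apply_comm hz a b) c

theorem smooth_lowMat (hG : IsMetricOn G S) (hy : y ∈ S) (a : Fin D) :
    MSmooth (lowMat G a) y := by
  intro e c
  exact contDiffAt_const.mul (((contDiffAt_pd (hG.smooth y hy c e) a).add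
    (contDiffAt_pd (hG.smooth y hy a e) c)).sub (contDiffAt_pd (hG.smooth y hy a c) e))

theorem smooth_connMat (hG : IsMetricOn G S) (hy : y ∈ S) (a : Fin D) :
    MSmooth (connMat (christoffel G) a) y := by
  have h : connMat (christoffel G) a = fun z ↦ (G z)⁻¹ * lowMat G a z :=
    funext fun z ↦ connMat_christoffel G a z
  rw [h]
  exact (hG.smooth_inv hy).mul (hG.smooth_lowMat hy a)

theorem smooth_christoffel (hG : IsMetricOn G S) (hy : y ∈ S) (c a b : Fin D) :
    ContDiffAt ℝ ∞ (fun z ↦ christoffel G z c a b) y :=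
  hG.smooth_connMat hy a c b

theorem mul_connMat (hG : IsMetricOn G S) (hy : y ∈ S) (a : Fin D) :
    G y * connMat (christoffel G) a y = lowMat G a y := by
  rw [connMat_christoffel, ← Matrix.mul_assoc, hG.mul_inv hy, Matrix.one_mul]

theorem connMat_transpose_mul (hG : IsMetricOn G S) (hy : y ∈ S) (a : Fin D) :
    (connMat (christoffel G) a y)ᵀ * G y = (lowMat G a y)ᵀ := by
  rw [← hG.mul_connMat hy, Matrix.transpose_mul, hG.symm y hy]

theorem christoffel_comm (hG : IsMetricOn G S) (hy : y ∈ S) (c a b : Fin D) :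
    christoffel G y c a b = christoffel G y c b a := by
  simp only [christoffel]
  refine congrArg _ (Finset.sum_congr rfl fun d _ ↦ ?_)
  rw [hG.pd_apply_comm hy d a b]
  ring

theorem lowMat_transpose_add (hG : IsMetricOn G S) (hy : y ∈ S) (a : Fin D) :
    (lowMat G a y)ᵀ + lowMat G a y = mpd a G y := by
  ext e c
  simp only [lowMat, mpd, Matrix.add_apply, Matrix.transpose_apply, Matrix.of_apply]
  rw [hG.pd_apply_comm hy a c e]
  ring

/-- The Levi-Civita connection is compatible with the metric. -/
theorem mpd_eq (hG : IsMetricOn G S) (hy : y ∈ S) (a : Fin D) :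
    mpd a G y = (connMat (christoffel G) a y)ᵀ * G y + G y * connMat (christoffel G) a y := by
  rw [hG.mul_connMat hy, hG.connMat_transpose_mul hy, hG.lowMat_transpose_add hy]

theorem mpd_inv (hG : IsMetricOn G S) (hy : y ∈ S) (a : Fin D) :
    mpd a (fun z ↦ (G z)⁻¹) y = -(connMat (christoffel G) a y * (G y)⁻¹)
      - (G y)⁻¹ * (connMat (christoffel G) a y)ᵀ := by
  have h1 : mpd a (fun z ↦ (G z)⁻¹ * G z) y = 0 := by
    have h : (fun z ↦ (G z)⁻¹ * G z) =ᶠ[𝓝 y] fun _ ↦ 1 :=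
      eventually_of_mem (hG.mem_nhds hy) fun z hz ↦ hG.inv_mul hz
    rw [mpd_congr h]
    ext i j
    simp [mpd]
  rw [mpd_mul (hG.smooth_inv hy) (hG.smooth y hy), hG.mpd_eq hy] at h1
  calc mpd a (fun z ↦ (G z)⁻¹) y = mpd a (fun z ↦ (G z)⁻¹) y * (G y * (G y)⁻¹) := by
        rw [hG.mul_inv hy, Matrix.mul_one]
    _ = (mpd a (fun z ↦ (G z)⁻¹) y * G y) * (G y)⁻¹ := by rw [Matrix.mul_assoc]
    _ = _ := by
        rw [eq_neg_of_add_eq_zero_left h1]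
        have e1 : (G y)⁻¹ * (G y * connMat (christoffel G) a y) = connMat (christoffel G) a y := by
          rw [← Matrix.mul_assoc, hG.inv_mul hy, Matrix.one_mul]
        rw [Matrix.mul_add, e1, Matrix.neg_mul, Matrix.add_mul, ← Matrix.mul_assoc,
          Matrix.mul_assoc _ (G y), hG.mul_inv hy, Matrix.mul_one]
        abel

/-- A torsion-free connection that is compatible with the metric is the Levi-Civita connection. -/
theorem christoffel_unique (hG : IsMetricOn G S) (hy : y ∈ S)
    {A : Fin D → Matrix (Fin D) (Fin D) ℝ} (hsymm : ∀ a d c, A a d c = A c d a)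
    (hA : ∀ a, mpd a G y = (A a)ᵀ * G y + G y * A a) (a : Fin D) :
    connMat (christoffel G) a y = A a := by
  have hB : ∀ a e c, pd a (fun z ↦ G z e c) y = (G y * A a) c e + (G y * A a) e c := by
    intro a e c
    have h1 : (A a)ᵀ * G y = (G y * A a)ᵀ := by rw [Matrix.transpose_mul, hG.symm y hy]
    have h2 := congrFun (congrFun (hA a) e) c
    rw [h1] at h2
    exact h2
  have hs : ∀ a e c, (G y * A a) e c = (G y * A c) e a := by
    intro a e c
    simp only [Matrix.mul_apply]
    exact Finset.sum_congr rfl fun k _ ↦ by rw [hsymm]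
  have hL : lowMat G a y = G y * A a := by
    ext e c
    simp only [lowMat, Matrix.of_apply, hB]
    rw [hs c e a, hs c a e, hs e c a]
    ring
  rw [connMat_christoffel, hL, ← Matrix.mul_assoc, hG.inv_mul hy, Matrix.one_mul]

/-! ### Symmetries of the curvature -/

theorem smooth_curvMat (hG : IsMetricOn G S) (hy : y ∈ S) (a b : Fin D) :
    MSmooth (curvMat (christoffel G) a b) y := by
  have h : curvMat (christoffel G) a b = _ := funext fun z ↦ curvMat_eq (christoffel G) a b z
  rw [h]
  have hA := hG.smooth_connMat hy
  exact ((((hA a).mpd b).sub ((hA b).mpd a)).add ((hA b).mul (hA a))).sub ((hA a).mul (hA b))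

theorem smooth_ricci (hG : IsMetricOn G S) (hy : y ∈ S) :
    MSmooth (fun z ↦ Matrix.of (ricci (christoffel G) z)) y := by
  intro a c
  simp only [Matrix.of_apply, ricci]
  exact ContDiffAt.sum fun b _ ↦ hG.smooth_curvMat hy a b b c

theorem smooth_scalarCurv (hG : IsMetricOn G S) (hy : y ∈ S) :
    ContDiffAt ℝ ∞ (scalarCurv G (christoffel G)) y :=
  ContDiffAt.sum fun a _ ↦ ContDiffAt.sum fun c _ ↦
    (hG.smooth_inv hy a c).mul (hG.smooth_ricci hy a c)

theorem smooth_schouten (hG : IsMetricOn G S) (hy : y ∈ S) :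
    MSmooth (fun z ↦ Matrix.of (schouten G z)) y :=
  fun a c ↦ ((hG.smooth_ricci hy a c).div_const _).sub
    (((hG.smooth y hy a c).mul (hG.smooth_scalarCurv hy)).div_const _)

theorem mul_curvMat (hG : IsMetricOn G S) (hy : y ∈ S) (a b : Fin D) :
    G y * curvMat (christoffel G) a b y = mpd b (lowMat G a) y - mpd a (lowMat G b) y
      - (connMat (christoffel G) b y)ᵀ * G y * connMat (christoffel G) a y
      + (connMat (christoffel G) a y)ᵀ * G y * connMat (christoffel G) b y := by
  have key : ∀ a b, mpd b (lowMat G a) y = mpd b G y * connMat (christoffel G) a y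
      + G y * mpd b (connMat (christoffel G) a) y := by
    intro a b
    rw [← mpd_mul (hG.smooth y hy) (hG.smooth_connMat hy a)]
    exact mpd_congr (eventually_of_mem (hG.mem_nhds hy) fun z hz ↦ (hG.mul_connMat hz a).symm) b
  rw [curvMat_eq, key, key, hG.mpd_eq hy, hG.mpd_eq hy]
  noncomm_ring

/-- The lowered curvature is antisymmetric in its last two indices. -/
theorem mul_curvMat_transpose (hG : IsMetricOn G S) (hy : y ∈ S) (a b : Fin D) :
    (G y * curvMat (christoffel G) a b y)ᵀ = -(G y * curvMat (christoffel G) a b y) := by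
  have key : ∀ a b, (mpd b (lowMat G a) y)ᵀ = mpd b (mpd a G) y - mpd b (lowMat G a) y := by
    intro a b
    have h := mpd_congr (F := fun z ↦ (lowMat G a z)ᵀ + lowMat G a z) (H := mpd a G)
      (eventually_of_mem (hG.mem_nhds hy) fun z hz ↦ hG.lowMat_transpose_add hz a) b
    rw [mpd_add (hG.smooth_lowMat hy a).transpose (hG.smooth_lowMat hy a), mpd_transpose] at h
    exact eq_sub_of_add_eq h
  rw [hG.mul_curvMat hy, Matrix.transpose_add, Matrix.transpose_sub, Matrix.transpose_sub, key,
    key, mpd_comm (hG.smooth y hy) b a]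
  simp only [Matrix.transpose_mul, Matrix.transpose_transpose, hG.symm y hy, Matrix.mul_assoc]
  abel

end IsMetricOn

/-- The Riemann tensor `R_abcd` with all indices lowered. -/
def rLow (G : Coord D → Matrix (Fin D) (Fin D) ℝ) (y : Coord D) (a b c d : Fin D) : ℝ :=
  (G y * curvMat (christoffel G) a b y) d c

namespace IsMetricOn

variable {G : Coord D → Matrix (Fin D) (Fin D) ℝ} {S : Set (Coord D)} {y : Coord D}

theorem curvature_cyclic (hG : IsMetricOn G S) (hy : y ∈ S) (a b c d : Fin D) :
    curvature (christoffel G) y a b c d + curvature (christoffel G) y b c a d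
      + curvature (christoffel G) y c a b d = 0 := by
  have hs : ∀ e a b c, pd e (fun z ↦ christoffel G z a b c) y
      = pd e (fun z ↦ christoffel G z a c b) y := fun e a b c ↦
    pd_congr (eventually_of_mem (hG.mem_nhds hy) fun z hz ↦ hG.christoffel_comm hz a b c) e
  simp only [curvature, Finset.sum_sub_distrib]
  rw [hs b d a c, hs a d b c, hs c d b a, Finset.sum_congr rfl fun e _ ↦
    congrArg (· * _) (hG.christoffel_comm hy e a c), Finset.sum_congr rfl fun e _ ↦
    congrArg (· * _) (hG.christoffel_comm hy e b c), Finset.sum_congr rfl fun e _ ↦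
    congrArg (· * _) (hG.christoffel_comm hy e b a)]
  ring

theorem rLow_swap_left (y : Coord D) (a b c d : Fin D) : rLow G y b a c d = -rLow G y a b c d := by
  simp only [rLow, Matrix.mul_apply, ← Finset.sum_neg_distrib, curvMat, Matrix.of_apply]
  exact Finset.sum_congr rfl fun e _ ↦ by rw [curvature_swap]; ring

theorem rLow_swap_right (hG : IsMetricOn G S) (hy : y ∈ S) (a b c d : Fin D) :
    rLow G y a b d c = -rLow G y a b c d :=
  congrFun (congrFun (hG.mul_curvMat_transpose hy a b) d) c

theorem rLow_cyclic (hG : IsMetricOn G S) (hy : y ∈ S) (a b c d : Fin D) :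
    rLow G y a b c d + rLow G y b c a d + rLow G y c a b d = 0 := by
  simp only [rLow, Matrix.mul_apply, ← Finset.sum_add_distrib, curvMat, Matrix.of_apply,
    ← mul_add, hG.curvature_cyclic hy, mul_zero, Finset.sum_const_zero]

theorem rLow_pair (hG : IsMetricOn G S) (hy : y ∈ S) (a b c d : Fin D) :
    rLow G y a b c d = rLow G y c d a b := by
  have c1 := hG.rLow_cyclic hy a b c d
  have c2 := hG.rLow_cyclic hy b c d a
  have c3 := hG.rLow_cyclic hy c d a b
  have c4 := hG.rLow_cyclic hy d a b c
  have s1 := hG.rLow_swap_right hy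
  have s2 := rLow_swap_left (G := G) y
  linarith [s1 b c a d, s1 c d a b, s2 b d c a, s1 b d a c, s1 d a b c, s2 c a d b, s1 c a b d,
    s1 a b c d]

theorem curvature_eq_sum (hG : IsMetricOn G S) (hy : y ∈ S) (a b c d : Fin D) :
    curvature (christoffel G) y a b c d = ∑ f, (G y)⁻¹ d f * rLow G y a b c f := by
  have h : curvMat (christoffel G) a b y = (G y)⁻¹ * (G y * curvMat (christoffel G) a b y) := by
    rw [← Matrix.mul_assoc, hG.inv_mul hy, Matrix.one_mul]
  exact congrFun (congrFun h d) c

theorem ricci_eq_sum (hG : IsMetricOn G S) (hy : y ∈ S) (a c : Fin D) :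
    ricci (christoffel G) y a c = ∑ b, ∑ d, (G y)⁻¹ b d * rLow G y a b c d :=
  Finset.sum_congr rfl fun b _ ↦ hG.curvature_eq_sum hy a b c b

theorem ricci_comm (hG : IsMetricOn G S) (hy : y ∈ S) (a c : Fin D) :
    ricci (christoffel G) y a c = ricci (christoffel G) y c a := by
  rw [hG.ricci_eq_sum hy, hG.ricci_eq_sum hy, Finset.sum_comm]
  refine Finset.sum_congr rfl fun b _ ↦ Finset.sum_congr rfl fun d _ ↦ ?_
  rw [hG.inv_apply_comm hy, hG.rLow_pair hy]

theorem schouten_comm (hG : IsMetricOn G S) (hy : y ∈ S) (a b : Fin D) :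
    schouten G y a b = schouten G y b a := by
  rw [schouten, schouten, hG.ricci_comm hy, hG.apply_comm hy]

end IsMetricOn

/-! ### The contracted Bianchi identity and Schur's lemma -/

/-- The covariant derivative `∇_c T_ab` of a tensor field with two lower indices, as a matrix in
the indices `a`, `b`. -/
def covMat (K : Coord D → Fin D → Fin D → Fin D → ℝ) (c : Fin D)
    (T : Coord D → Matrix (Fin D) (Fin D) ℝ) (y : Coord D) : Matrix (Fin D) (Fin D) ℝ :=
  mpd c T y - (connMat K c y)ᵀ * T y - T y * connMat K c y

theorem covDeriv₂_eq_covMat (K : Coord D → Fin D → Fin D → Fin D → ℝ)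
    (T : Coord D → Fin D → Fin D → ℝ) (y : Coord D) (c a b : Fin D) :
    covDeriv₂ K T y c a b = covMat K c (fun z ↦ Matrix.of (T z)) y a b := by
  simp only [covDeriv₂, covMat, mpd, connMat, Matrix.sub_apply, Matrix.mul_apply, Matrix.of_apply,
    Matrix.transpose_apply, Finset.sum_add_distrib]
  rw [Finset.sum_congr rfl fun d _ ↦ mul_comm (K y d c b) (T y a d)]
  ring

/-- The Ricci tensor of the metric `G`, as a matrix. -/
def ricMat (G : Coord D → Matrix (Fin D) (Fin D) ℝ) (y : Coord D) : Matrix (Fin D) (Fin D) ℝ :=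
  Matrix.of (ricci (christoffel G) y)

namespace IsMetricOn

variable {G : Coord D → Matrix (Fin D) (Fin D) ℝ} {S : Set (Coord D)} {y : Coord D}

theorem connMat_comm (hG : IsMetricOn G S) (hy : y ∈ S) (a d c : Fin D) :
    connMat (christoffel G) a y d c = connMat (christoffel G) c y d a :=
  hG.christoffel_comm hy d a c

theorem covMat_smul_self (hG : IsMetricOn G S) (hy : y ∈ S) {f : Coord D → ℝ}
    (hf : ContDiffAt ℝ ∞ f y) (a : Fin D) :
    covMat (christoffel G) a (fun z ↦ f z • G z) y = pd a f y • G y := by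
  rw [covMat, mpd_smul hf (hG.smooth y hy), hG.mpd_eq hy]
  simp only [smul_add, Matrix.mul_smul, Matrix.smul_mul]
  abel

/-- Raising the second index of a tensor field commutes with covariant differentiation. -/
theorem mpd_mul_inv (hG : IsMetricOn G S) (hy : y ∈ S)
    {T : Coord D → Matrix (Fin D) (Fin D) ℝ} (hT : MSmooth T y) (a : Fin D) :
    mpd a (fun z ↦ T z * (G z)⁻¹) y - (connMat (christoffel G) a y)ᵀ * (T y * (G y)⁻¹)
      + (T y * (G y)⁻¹) * (connMat (christoffel G) a y)ᵀ
      = covMat (christoffel G) a T y * (G y)⁻¹ := by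
  rw [mpd_mul hT (hG.smooth_inv hy), hG.mpd_inv hy, covMat]
  noncomm_ring

theorem trace_covMat_mul_inv (hG : IsMetricOn G S) (hy : y ∈ S)
    {T : Coord D → Matrix (Fin D) (Fin D) ℝ} (hT : MSmooth T y) (a : Fin D) :
    (covMat (christoffel G) a T y * (G y)⁻¹).trace
      = pd a (fun z ↦ (T z * (G z)⁻¹).trace) y := by
  rw [← hG.mpd_mul_inv hy hT, Matrix.trace_add, Matrix.trace_sub,
    Matrix.trace_mul_comm (T y * (G y)⁻¹)]
  simp only [sub_add_cancel, Matrix.trace, Matrix.diag_apply]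
  exact (pd_sum (f := fun i z ↦ (T z * (G z)⁻¹) i i) _
    (fun i _ ↦ (hT.mul (hG.smooth_inv hy)).diff i i) a).symm

theorem scalarCurv_eq_trace (hG : IsMetricOn G S) (hy : y ∈ S) :
    scalarCurv G (christoffel G) y = (ricMat G y * (G y)⁻¹).trace := by
  simp only [scalarCurv, ricMat, Matrix.trace, Matrix.diag_apply, Matrix.mul_apply,
    Matrix.of_apply]
  refine Finset.sum_congr rfl fun a _ ↦ Finset.sum_congr rfl fun c _ ↦ ?_
  rw [hG.inv_apply_comm hy, mul_comm]

theorem smooth_ricMat (hG : IsMetricOn G S) (hy : y ∈ S) : MSmooth (ricMat G) y :=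
  hG.smooth_ricci hy

theorem curvMat_mul_inv_transpose (hG : IsMetricOn G S) (hy : y ∈ S) (a b : Fin D) :
    (curvMat (christoffel G) a b y * (G y)⁻¹)ᵀ = -(curvMat (christoffel G) a b y * (G y)⁻¹) := by
  have h : curvMat (christoffel G) a b y = (G y)⁻¹ * (G y * curvMat (christoffel G) a b y) := by
    rw [← Matrix.mul_assoc, hG.inv_mul hy, Matrix.one_mul]
  rw [h, Matrix.transpose_mul, Matrix.transpose_mul, hG.mul_curvMat_transpose hy, hG.inv_symm hy]
  noncomm_ring

/-- The contracted second Bianchi identity `∂_e R = 2 ∇^a R_ea`. -/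
theorem contracted_bianchi (hG : IsMetricOn G S) (hy : y ∈ S) (e : Fin D) :
    pd e (scalarCurv G (christoffel G)) y
      = 2 * ∑ a, (covMat (christoffel G) a (ricMat G) y * (G y)⁻¹) e a := by
  set A := fun a ↦ connMat (christoffel G) a y with hA
  -- the curvature tensor `R_ab^cd` with two raised indices
  set R := fun a b z ↦ curvMat (christoffel G) a b z * (G z)⁻¹ with hR
  set N := fun z ↦ ricMat G z * (G z)⁻¹ with hN
  set T := fun e a b ↦ mpd e (R a b) y + A e * R a b y + R a b y * (A e)ᵀ with hT
  have hsm : ∀ a b, MSmooth (R a b) y := fun a b ↦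
    (hG.smooth_curvMat hy a b).mul (hG.smooth_inv hy)
  have hTeq : ∀ e a b, T e a b = (mpd e (curvMat (christoffel G) a b) y
      + A e * curvMat (christoffel G) a b y - curvMat (christoffel G) a b y * A e) * (G y)⁻¹ := by
    intro e a b
    simp only [hT, hR]
    rw [mpd_mul (hG.smooth_curvMat hy a b) (hG.smooth_inv hy), hG.mpd_inv hy]
    noncomm_ring
  have hAc : ∀ a d c, A a d c = A c d a := hG.connMat_comm hy
  have hcyc : ∀ a b, T e a b + T a b e + T b e a = 0 := by
    intro a b
    rw [hTeq, hTeq, hTeq, ← Matrix.add_mul, ← Matrix.add_mul,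
      curvMat_bianchi (hG.smooth_connMat hy) e a b, Matrix.zero_mul]
  have hRswap : ∀ a b z, R b a z = -R a b z := by
    intro a b z
    have : curvMat (christoffel G) b a z = -curvMat (christoffel G) a b z := by
      ext d c
      exact curvature_swap _ _ _ _ _ _
    simp only [hR, this, Matrix.neg_mul]
  have hRt : ∀ a b, ∀ z ∈ S, ∀ c d, R a b z d c = -R a b z c d := fun a b z hz c d ↦
    congrFun (congrFun (hG.curvMat_mul_inv_transpose hz a b) c) d
  have hNR : ∀ e a z, ∑ b, R e b z b a = N z e a := by
    intro e a z
    simp only [hR, hN, Matrix.mul_apply, curvMat, ricMat, Matrix.of_apply, ricci, Finset.sum_mul]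
    exact Finset.sum_comm
  have hNR' : ∀ e a z, ∑ b, R b e z b a = -N z e a := by
    intro e a z
    rw [← hNR, ← Finset.sum_neg_distrib]
    exact Finset.sum_congr rfl fun b _ ↦ by rw [hRswap e b]; rfl
  have hsc : ∀ z ∈ S, scalarCurv G (christoffel G) z = ∑ a, ∑ b, R a b z b a := by
    intro z hz
    rw [hG.scalarCurv_eq_trace hz]
    exact Finset.sum_congr rfl fun a _ ↦ (hNR a a z).symm
  have happ : ∀ e a b d c, T e a b d c = pd e (fun z ↦ R a b z d c) y
      + ∑ f, A e d f * R a b y f c + ∑ f, R a b y d f * A e c f := fun e a b d c ↦ rfl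
  -- the two kinds of contraction of the cyclic identity
  have h1 : ∑ a, ∑ b, T e a b b a = pd e (scalarCurv G (christoffel G)) y
      + 2 * ∑ a, ((A a)ᵀ * N y) e a := by
    have p1 : ∑ a, ∑ b, pd e (fun z ↦ R a b z b a) y
        = pd e (scalarCurv G (christoffel G)) y := by
      rw [pd_congr (eventually_of_mem (hG.mem_nhds hy) hsc), pd_sum
        (f := fun a z ↦ ∑ b, R a b z b a) _ fun a _ ↦
          DifferentiableAt.fun_sum fun b _ ↦ (hsm a b).diff b a]
      exact Finset.sum_congr rfl fun a _ ↦ (pd_sum (f := fun b z ↦ R a b z b a) _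
        (fun b _ ↦ (hsm a b).diff b a) e).symm
    have p2 : ∑ a, ∑ b, ∑ f, A e b f * R a b y f a = ∑ a, ((A a)ᵀ * N y) e a := by
      calc ∑ a, ∑ b, ∑ f, A e b f * R a b y f a
          = ∑ a, ∑ f, ∑ b, A e b f * R a b y f a :=
            Finset.sum_congr rfl fun a _ ↦ Finset.sum_comm
        _ = ∑ f, ∑ a, ∑ b, A e b f * R a b y f a := Finset.sum_comm
        _ = ∑ f, ∑ b, ∑ a, A e b f * R a b y f a :=
            Finset.sum_congr rfl fun f _ ↦ Finset.sum_comm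
        _ = _ := by
            refine Finset.sum_congr rfl fun f _ ↦ ?_
            rw [Matrix.mul_apply]
            refine Finset.sum_congr rfl fun b _ ↦ ?_
            rw [← Finset.mul_sum, Matrix.transpose_apply, hAc e b f]
            refine congrArg _ ?_
            rw [Finset.sum_congr rfl fun a _ ↦ hRt a b y hy a f, Finset.sum_neg_distrib, hNR',
              neg_neg]
    have p3 : ∑ a, ∑ b, ∑ f, R a b y b f * A e a f = ∑ a, ((A a)ᵀ * N y) e a := by
      calc ∑ a, ∑ b, ∑ f, R a b y b f * A e a f
          = ∑ a, ∑ f, ∑ b, R a b y b f * A e a f :=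
            Finset.sum_congr rfl fun a _ ↦ Finset.sum_comm
        _ = ∑ f, ∑ a, ∑ b, R a b y b f * A e a f := Finset.sum_comm
        _ = _ := by
            refine Finset.sum_congr rfl fun f _ ↦ ?_
            rw [Matrix.mul_apply]
            refine Finset.sum_congr rfl fun a _ ↦ ?_
            rw [← Finset.sum_mul, Matrix.transpose_apply, hAc e a f, hNR, mul_comm]
    simp only [happ, Finset.sum_add_distrib]
    rw [p1, p2, p3]
    ring
  have h2 : ∑ a, ∑ b, T a b e b a
      = -∑ a, (mpd a N y e a + (N y * (A a)ᵀ) e a) := by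
    have p1 : ∀ a, ∑ b, pd a (fun z ↦ R b e z b a) y = -mpd a N y e a := by
      intro a
      rw [← pd_sum (f := fun b z ↦ R b e z b a) _ fun b _ ↦ (hsm b e).diff b a]
      simp only [hNR', pd_neg]
      rfl
    have p2 : ∑ a, ∑ b, ∑ f, A a b f * R b e y f a = 0 := by
      rw [Finset.sum_comm]
      refine Finset.sum_eq_zero fun b _ ↦ ?_
      have hs : ∑ a, ∑ f, A a b f * R b e y f a = -∑ a, ∑ f, A a b f * R b e y f a := by
        conv_lhs => rw [Finset.sum_comm]
        simp only [← Finset.sum_neg_distrib]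
        refine Finset.sum_congr rfl fun a _ ↦ Finset.sum_congr rfl fun f _ ↦ ?_
        rw [hAc f b a, hRt b e y hy f a]
        ring
      linarith
    have p3 : ∀ a, ∑ b, ∑ f, R b e y b f * A a a f = -(N y * (A a)ᵀ) e a := by
      intro a
      rw [Finset.sum_comm, Matrix.mul_apply, ← Finset.sum_neg_distrib]
      refine Finset.sum_congr rfl fun f _ ↦ ?_
      rw [← Finset.sum_mul, hNR', Matrix.transpose_apply, neg_mul]
    simp only [happ, Finset.sum_add_distrib]
    rw [p2]
    simp only [p1, p3, Finset.sum_neg_distrib]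
    ring
  have h3 : ∑ a, ∑ b, T b e a b a = ∑ a, ∑ b, T a b e b a := by
    rw [Finset.sum_comm]
    refine Finset.sum_congr rfl fun a _ ↦ Finset.sum_congr rfl fun b _ ↦ ?_
    have ht : T a b e = -T a e b := by
      have : R b e = fun z ↦ -R e b z := funext fun z ↦ hRswap e b z
      have hm : mpd a (R b e) y = -mpd a (R e b) y := by
        rw [this]
        ext i j
        exact pd_neg _ _ _
      simp only [hT]
      rw [hm, hRswap e b]
      noncomm_ring
    have ht' : (T a e b)ᵀ = -T a e b := by
      have hm : (mpd a (R e b) y)ᵀ = -mpd a (R e b) y := by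
        ext i j
        exact (pd_congr (eventually_of_mem (hG.mem_nhds hy)
          fun z hz ↦ hRt e b z hz i j) a).trans (pd_neg _ _ _)
      have hr : (R e b y)ᵀ = -R e b y := hG.curvMat_mul_inv_transpose hy e b
      simp only [hT, Matrix.transpose_add, Matrix.transpose_mul, Matrix.transpose_transpose, hm, hr]
      noncomm_ring
    rw [ht]
    exact congrFun (congrFun ht' b) a
  have h4 : ∑ a, ∑ b, T e a b b a + ∑ a, ∑ b, T a b e b a + ∑ a, ∑ b, T b e a b a = 0 := by
    simp only [← Finset.sum_add_distrib]
    exact Finset.sum_eq_zero fun a _ ↦ Finset.sum_eq_zero fun b _ ↦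
      congrFun (congrFun (hcyc a b) b) a
  have h5 : ∀ a, covMat (christoffel G) a (ricMat G) y * (G y)⁻¹
      = mpd a N y - (A a)ᵀ * N y + N y * (A a)ᵀ := fun a ↦
    (hG.mpd_mul_inv hy (hG.smooth_ricMat hy) a).symm
  simp only [h5, Matrix.add_apply, Matrix.sub_apply, Finset.sum_add_distrib,
    Finset.sum_sub_distrib]
  rw [h3, h1, h2, Finset.sum_add_distrib] at h4
  linarith

/-- Schur's lemma: if the Ricci tensor is proportional to the metric and the dimension is at
least three, then the factor is locally constant. -/
theorem schur (hD : 3 ≤ D) (hG : IsMetricOn G S) {ρ : Coord D → ℝ}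
    (hρ : ∀ z ∈ S, ContDiffAt ℝ ∞ ρ z) (h : ∀ z ∈ S, ricMat G z = ρ z • G z) (hy : y ∈ S)
    (e : Fin D) : pd e ρ y = 0 := by
  have hb := hG.contracted_bianchi hy e
  have h1 : ∀ a, covMat (christoffel G) a (ricMat G) y * (G y)⁻¹ = pd a ρ y • 1 := by
    intro a
    have hc : covMat (christoffel G) a (ricMat G) y
        = covMat (christoffel G) a (fun z ↦ ρ z • G z) y := by
      rw [covMat, covMat, mpd_congr (eventually_of_mem (hG.mem_nhds hy) h), h y hy]
    rw [hc, hG.covMat_smul_self hy (hρ y hy), Matrix.smul_mul, hG.mul_inv hy]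
  have h2 : pd e (scalarCurv G (christoffel G)) y = D * pd e ρ y := by
    rw [← pd_const_mul (differentiableAt_of_contDiffAt_top (hρ y hy))]
    refine pd_congr (eventually_of_mem (hG.mem_nhds hy) fun z hz ↦ ?_) e
    simp only [hG.scalarCurv_eq_trace hz, h z hz, Matrix.smul_mul, hG.mul_inv hz,
      Matrix.trace_smul, Matrix.trace_one, Fintype.card_fin, smul_eq_mul]
    ring
  simp only [h1, Matrix.smul_apply, Matrix.one_apply, smul_eq_mul, mul_ite, mul_one, mul_zero,
    Finset.sum_ite_eq, Finset.mem_univ, if_true, h2] at hb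
  have : (3 : ℝ) ≤ D := by exact_mod_cast hD
  have h3 : ((D : ℝ) - 2) * pd e ρ y = 0 := by linarith
  rcases mul_eq_zero.1 h3 with h | h
  · linarith
  · exact h

end IsMetricOn

/-! ### The Weyl tensor and the trace of the Cotton tensor -/

theorem kron_eq_one_apply (a b : Fin D) : kron a b = (1 : Matrix (Fin D) (Fin D) ℝ) a b := by
  simp [kron, Matrix.one_apply]

theorem sum_kron_mul (a : Fin D) (f : Fin D → ℝ) : ∑ b, kron a b * f b = f a := by
  simp [kron]

theorem sum_kron_mul' (a : Fin D) (f : Fin D → ℝ) : ∑ b, kron b a * f b = f a := by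
  simp [kron]

/-- The Weyl tensor `C_abcd` with all indices lowered. -/
def wLow (G : Coord D → Matrix (Fin D) (Fin D) ℝ) (y : Coord D) (a b c d : Fin D) : ℝ :=
  ∑ f, weyl G y a b c f * G y f d

namespace IsMetricOn

variable {G : Coord D → Matrix (Fin D) (Fin D) ℝ} {S : Set (Coord D)} {y : Coord D}

theorem sum_inv_mul (hG : IsMetricOn G S) (hy : y ∈ S) (a b : Fin D) :
    ∑ c, (G y)⁻¹ a c * G y c b = kron a b := by
  rw [kron_eq_one_apply, ← hG.inv_mul hy, Matrix.mul_apply]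

theorem sum_mul_inv (hG : IsMetricOn G S) (hy : y ∈ S) (a b : Fin D) :
    ∑ c, G y a c * (G y)⁻¹ c b = kron a b := by
  rw [kron_eq_one_apply, ← hG.mul_inv hy, Matrix.mul_apply]

theorem sum_curvature_mul (hG : IsMetricOn G S) (hy : y ∈ S) (a b c d : Fin D) :
    ∑ f, curvature (christoffel G) y a b c f * G y f d = rLow G y a b c d := by
  simp only [rLow, Matrix.mul_apply, curvMat, Matrix.of_apply]
  exact Finset.sum_congr rfl fun f _ ↦ by rw [hG.apply_comm hy f d, mul_comm]

/-- Lowering an index that was raised. -/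
theorem sum_raise_mul (hG : IsMetricOn G S) (hy : y ∈ S) (v : Fin D → ℝ) (d : Fin D) :
    ∑ f, (∑ e, (G y)⁻¹ f e * v e) * G y f d = v d := by
  simp only [Finset.sum_mul]
  rw [Finset.sum_comm, ← sum_kron_mul' d v]
  refine Finset.sum_congr rfl fun e _ ↦ ?_
  rw [← hG.sum_inv_mul hy e d, Finset.sum_mul]
  exact Finset.sum_congr rfl fun f _ ↦ by rw [hG.inv_apply_comm hy]; ring

theorem wLow_eq (hG : IsMetricOn G S) (hy : y ∈ S) (a b c d : Fin D) :
    wLow G y a b c d = rLow G y a b c d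
      - (schouten G y b d * G y a c - schouten G y a d * G y b c)
      - (G y b d * schouten G y a c - G y a d * schouten G y b c) := by
  have key : ∀ (u v : Fin D → ℝ) (p q r s : ℝ),
      ∑ f, (curvature (christoffel G) y a b c f - (u f * p - v f * q)
        - (kron b f * r - kron a f * s)) * G y f d
      = ∑ f, curvature (christoffel G) y a b c f * G y f d
        - ((∑ f, u f * G y f d) * p - (∑ f, v f * G y f d) * q)
        - ((∑ f, kron b f * G y f d) * r - (∑ f, kron a f * G y f d) * s) := by
    intro u v p q r s
    simp only [Finset.sum_mul, ← Finset.sum_sub_distrib]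
    exact Finset.sum_congr rfl fun f _ ↦ by ring
  rw [wLow]
  simp only [weyl]
  rw [key, hG.sum_curvature_mul hy, hG.sum_raise_mul hy, hG.sum_raise_mul hy, sum_kron_mul,
    sum_kron_mul]

theorem wLow_pair (hG : IsMetricOn G S) (hy : y ∈ S) (a b c d : Fin D) :
    wLow G y a b c d = wLow G y c d a b := by
  rw [hG.wLow_eq hy, hG.wLow_eq hy, hG.rLow_pair hy, hG.apply_comm hy a c, hG.apply_comm hy b d,
    hG.apply_comm hy a d, hG.apply_comm hy b c, hG.schouten_comm hy a c, hG.schouten_comm hy b d,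
    hG.schouten_comm hy a d, hG.schouten_comm hy b c]
  ring

theorem weyl_eq_sum (hG : IsMetricOn G S) (hy : y ∈ S) (a b c d : Fin D) :
    weyl G y a b c d = ∑ q, wLow G y a b c q * (G y)⁻¹ q d := by
  simp only [wLow, Finset.sum_mul]
  rw [Finset.sum_comm, ← sum_kron_mul' d (weyl G y a b c)]
  refine Finset.sum_congr rfl fun f _ ↦ ?_
  rw [← hG.sum_mul_inv hy, Finset.sum_mul]
  exact Finset.sum_congr rfl fun q _ ↦ by ring

/-- By pair symmetry, raising the third index of `C_bep^d` gives `C^rd_be`. -/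
theorem sum_inv_mul_weyl (hG : IsMetricOn G S) (hy : y ∈ S) (b e r d : Fin D) :
    ∑ p, (G y)⁻¹ p r * weyl G y b e p d = weylUp G y r d b e := by
  simp only [weylUp]
  refine Finset.sum_congr rfl fun p _ ↦ ?_
  rw [hG.weyl_eq_sum hy, Finset.mul_sum]
  refine Finset.sum_congr rfl fun q _ ↦ ?_
  rw [hG.wLow_pair hy, wLow, Finset.sum_mul, Finset.mul_sum]
  refine Finset.sum_congr rfl fun f _ ↦ ?_
  rw [hG.inv_apply_comm hy p r, hG.inv_apply_comm hy q d]
  ring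

theorem ricci_eq_schouten (hD : 3 ≤ D) (hG : IsMetricOn G S) (hy : y ∈ S) (a b : Fin D) :
    ricci (christoffel G) y a b = ((D : ℝ) - 2) * schouten G y a b
      + G y a b * ∑ e, ∑ p, (G y)⁻¹ e p * schouten G y e p := by
  have h3 : (3 : ℝ) ≤ D := by exact_mod_cast hD
  have h2 : (D : ℝ) - 2 ≠ 0 := by linarith
  have h1 : (D : ℝ) - 1 ≠ 0 := by linarith
  have htr : ∑ e, ∑ p, (G y)⁻¹ e p * G y e p = (D : ℝ) := by
    have : ∀ e, ∑ p, (G y)⁻¹ e p * G y e p = 1 := by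
      intro e
      rw [Finset.sum_congr rfl fun p _ ↦ by rw [hG.apply_comm hy e p], hG.sum_inv_mul hy]
      simp [kron]
    simp [this]
  have hs : ∑ e, ∑ p, (G y)⁻¹ e p * schouten G y e p
      = scalarCurv G (christoffel G) y / ((D : ℝ) - 2) - D *
        (scalarCurv G (christoffel G) y / (2 * ((D : ℝ) - 1) * ((D : ℝ) - 2))) := by
    rw [show ∀ x, (D : ℝ) * x = (∑ e, ∑ p, (G y)⁻¹ e p * G y e p) * x from fun x ↦ by rw [htr],
      scalarCurv]
    simp only [Finset.sum_div, Finset.sum_mul, ← Finset.sum_sub_distrib]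
    refine Finset.sum_congr rfl fun e _ ↦ Finset.sum_congr rfl fun p _ ↦ ?_
    simp only [← Finset.sum_div, schouten, scalarCurv]
    ring
  rw [hs, schouten]
  field_simp
  ring

theorem sum_inv_mul_rLow (hG : IsMetricOn G S) (hy : y ∈ S) (b f : Fin D) :
    ∑ e, ∑ p, (G y)⁻¹ e p * rLow G y b e p f = -ricci (christoffel G) y b f := by
  rw [hG.ricci_eq_sum hy, ← Finset.sum_neg_distrib]
  refine Finset.sum_congr rfl fun e _ ↦ ?_
  rw [← Finset.sum_neg_distrib]
  exact Finset.sum_congr rfl fun p _ ↦ by rw [hG.rLow_swap_right hy]; ring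

/-- The Weyl tensor is trace-free. -/
theorem sum_inv_mul_wLow (hD : 3 ≤ D) (hG : IsMetricOn G S) (hy : y ∈ S) (b f : Fin D) :
    ∑ e, ∑ p, (G y)⁻¹ e p * wLow G y b e p f = 0 := by
  have e1 : ∑ e, ∑ p, (G y)⁻¹ e p * (schouten G y e f * G y b p) = schouten G y b f := by
    rw [← sum_kron_mul' b (fun e ↦ schouten G y e f)]
    refine Finset.sum_congr rfl fun e _ ↦ ?_
    rw [← hG.sum_inv_mul hy, Finset.sum_mul]
    exact Finset.sum_congr rfl fun p _ ↦ by rw [hG.apply_comm hy b p]; ring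
  have e2 : ∑ e, ∑ p, (G y)⁻¹ e p * (schouten G y b f * G y e p) = D * schouten G y b f := by
    have : ∀ e, ∑ p, (G y)⁻¹ e p * (schouten G y b f * G y e p) = schouten G y b f := by
      intro e
      calc _ = (∑ p, (G y)⁻¹ e p * G y p e) * schouten G y b f := by
            rw [Finset.sum_mul]
            exact Finset.sum_congr rfl fun p _ ↦ by rw [hG.apply_comm hy e p]; ring
        _ = _ := by rw [hG.sum_inv_mul hy]; simp [kron]
    simp [this]
  have e3 : ∑ e, ∑ p, (G y)⁻¹ e p * (G y e f * schouten G y b p) = schouten G y b f := by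
    rw [Finset.sum_comm, ← sum_kron_mul' f (fun p ↦ schouten G y b p)]
    refine Finset.sum_congr rfl fun p _ ↦ ?_
    rw [← hG.sum_inv_mul hy, Finset.sum_mul]
    exact Finset.sum_congr rfl fun e _ ↦ by rw [hG.inv_apply_comm hy e p]; ring
  have e4 : ∑ e, ∑ p, (G y)⁻¹ e p * (G y b f * schouten G y e p)
      = G y b f * ∑ e, ∑ p, (G y)⁻¹ e p * schouten G y e p := by
    simp only [Finset.mul_sum]
    exact Finset.sum_congr rfl fun e _ ↦ Finset.sum_congr rfl fun p _ ↦ by ring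
  simp only [hG.wLow_eq hy, mul_sub, Finset.sum_sub_distrib]
  rw [hG.sum_inv_mul_rLow hy, hG.ricci_eq_schouten hD hy, e1, e2, e3, e4]
  ring

theorem sum_inv_mul_weyl_trace (hD : 3 ≤ D) (hG : IsMetricOn G S) (hy : y ∈ S) (b d : Fin D) :
    ∑ e, ∑ p, (G y)⁻¹ e p * weyl G y b e p d = 0 := by
  simp only [hG.weyl_eq_sum hy, Finset.mul_sum]
  calc ∑ e, ∑ p, ∑ q, (G y)⁻¹ e p * (wLow G y b e p q * (G y)⁻¹ q d)
      = ∑ e, ∑ q, ∑ p, (G y)⁻¹ e p * (wLow G y b e p q * (G y)⁻¹ q d) :=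
        Finset.sum_congr rfl fun e _ ↦ Finset.sum_comm
    _ = ∑ q, ∑ e, ∑ p, (G y)⁻¹ e p * (wLow G y b e p q * (G y)⁻¹ q d) := Finset.sum_comm
    _ = ∑ q, (∑ e, ∑ p, (G y)⁻¹ e p * wLow G y b e p q) * (G y)⁻¹ q d := by
        simp only [Finset.sum_mul]
        exact Finset.sum_congr rfl fun q _ ↦ Finset.sum_congr rfl fun e _ ↦
          Finset.sum_congr rfl fun p _ ↦ by ring
    _ = 0 := by simp only [hG.sum_inv_mul_wLow hD hy, zero_mul, Finset.sum_const_zero]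

/-- The contracted Bianchi identity says that the Cotton tensor is trace-free. -/
theorem sum_inv_mul_cotton (hD : 3 ≤ D) (hG : IsMetricOn G S) (hy : y ∈ S) (b : Fin D) :
    ∑ e, ∑ p, (G y)⁻¹ e p * cotton G y b e p = 0 := by
  have h3 : (3 : ℝ) ≤ D := by exact_mod_cast hD
  have h2 : (D : ℝ) - 2 ≠ 0 := by linarith
  have h1 : (D : ℝ) - 1 ≠ 0 := by linarith
  set c : ℝ := 1 / (2 * ((D : ℝ) - 1) * ((D : ℝ) - 2)) with hc
  set R := scalarCurv G (christoffel G) with hR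
  have hsR := hG.smooth_scalarCurv hy
  have hL : (fun z ↦ Matrix.of (schouten G z))
      = fun z ↦ (1 / ((D : ℝ) - 2)) • ricMat G z - (c * R z) • G z := by
    funext z
    ext i j
    simp only [schouten, ricMat, hc, Matrix.of_apply, Matrix.sub_apply, Matrix.smul_apply,
      smul_eq_mul]
    ring
  have hcov : ∀ a, covMat (christoffel G) a (fun z ↦ Matrix.of (schouten G z)) y * (G y)⁻¹
      = (1 / ((D : ℝ) - 2)) • (covMat (christoffel G) a (ricMat G) y * (G y)⁻¹)
        - (c * pd a R y) • 1 := by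
    intro a
    have s1 : MSmooth (fun z ↦ (1 / ((D : ℝ) - 2)) • ricMat G z) y :=
      MSmooth.smul contDiffAt_const (hG.smooth_ricMat hy)
    have s2 : ContDiffAt ℝ ∞ (fun z ↦ c * R z) y := contDiffAt_const.mul hsR
    have hlin : covMat (christoffel G) a (fun z ↦ Matrix.of (schouten G z)) y
        = (1 / ((D : ℝ) - 2)) • covMat (christoffel G) a (ricMat G) y
          - covMat (christoffel G) a (fun z ↦ (c * R z) • G z) y := by
      rw [hL]
      simp only [covMat]
      rw [mpd_sub s1 (MSmooth.smul s2 (hG.smooth y hy)),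
        mpd_smul contDiffAt_const (hG.smooth_ricMat hy), pd_const]
      simp only [zero_smul, zero_add, Matrix.mul_sub, Matrix.sub_mul, smul_sub, Matrix.mul_smul,
        Matrix.smul_mul]
      abel
    rw [hlin, hG.covMat_smul_self hy s2, pd_const_mul (differentiableAt_of_contDiffAt_top hsR),
      Matrix.sub_mul, Matrix.smul_mul, Matrix.smul_mul, hG.mul_inv hy]
  have t1 : ∑ e, ∑ p, (G y)⁻¹ e p * covDeriv₂ (christoffel G) (schouten G) y b e p
      = (covMat (christoffel G) b (fun z ↦ Matrix.of (schouten G z)) y * (G y)⁻¹).trace := by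
    refine Finset.sum_congr rfl fun e _ ↦ ?_
    rw [Matrix.diag_apply, Matrix.mul_apply]
    exact Finset.sum_congr rfl fun p _ ↦ by
      rw [covDeriv₂_eq_covMat, hG.inv_apply_comm hy e p, mul_comm]
  have t2 : ∑ e, ∑ p, (G y)⁻¹ e p * covDeriv₂ (christoffel G) (schouten G) y e b p
      = ∑ e, (covMat (christoffel G) e (fun z ↦ Matrix.of (schouten G z)) y * (G y)⁻¹) b e := by
    refine Finset.sum_congr rfl fun e _ ↦ ?_
    rw [Matrix.mul_apply]
    exact Finset.sum_congr rfl fun p _ ↦ by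
      rw [covDeriv₂_eq_covMat, hG.inv_apply_comm hy e p, mul_comm]
  have htr : (covMat (christoffel G) b (ricMat G) y * (G y)⁻¹).trace = pd b R y := by
    rw [hG.trace_covMat_mul_inv hy (hG.smooth_ricMat hy)]
    exact (pd_congr (eventually_of_mem (hG.mem_nhds hy) fun z hz ↦ hG.scalarCurv_eq_trace hz)
      b).symm
  have hb := hG.contracted_bianchi hy b
  have hsplit : ∑ e, ∑ p, (G y)⁻¹ e p * cotton G y b e p
      = (1 / 2) * (∑ e, ∑ p, (G y)⁻¹ e p * covDeriv₂ (christoffel G) (schouten G) y b e p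
        - ∑ e, ∑ p, (G y)⁻¹ e p * covDeriv₂ (christoffel G) (schouten G) y e b p) := by
    simp only [cotton, ← Finset.sum_sub_distrib, Finset.mul_sum]
    exact Finset.sum_congr rfl fun e _ ↦ Finset.sum_congr rfl fun p _ ↦ by ring
  rw [hsplit, t1, t2]
  simp only [hcov, Matrix.trace_sub, Matrix.trace_smul, Matrix.trace_one, htr, Fintype.card_fin,
    Matrix.sub_apply, Matrix.smul_apply, smul_eq_mul, Finset.sum_sub_distrib, ← Finset.mul_sum,
    Matrix.one_apply, mul_ite, mul_one, mul_zero, Finset.sum_ite_eq, Finset.mem_univ, if_true]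
  have hb' : ∑ a, (covMat (christoffel G) a (ricMat G) y * (G y)⁻¹) b a = pd b R y / 2 := by
    linarith
  rw [hb', hc]
  field_simp
  ring

end IsMetricOn

/-! ### The Ricci tensor of a conformally changed connection -/

/-- The connection with coefficients `Γ^c_ab + g^cd g_ab Υ_d - δ_b^c Υ_a - δ_a^c Υ_b`. -/
def weylConn (G : Coord D → Matrix (Fin D) (Fin D) ℝ) (Υ : Coord D → Fin D → ℝ) (y : Coord D)
    (c a b : Fin D) : ℝ :=
  christoffel G y c a b + (∑ d, (G y)⁻¹ c d * Υ y d) * G y a b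
    - kron c b * Υ y a - kron c a * Υ y b

theorem cConn_eq_weylConn (G : Coord D → Matrix (Fin D) (Fin D) ℝ) :
    cConn G = weylConn G (lam G) := by
  funext y c a b
  simp only [cConn, weylConn]

theorem ricci_congr {K K' : Coord D → Fin D → Fin D → Fin D → ℝ} {y : Coord D}
    (h : K =ᶠ[𝓝 y] K') (a c : Fin D) : ricci K y a c = ricci K' y a c := by
  have hp : ∀ e d a c, pd e (fun z ↦ K z d a c) y = pd e (fun z ↦ K' z d a c) y :=
    fun e d a c ↦ pd_congr (h.mono fun z hz ↦ by simp only [hz]) e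
  simp only [ricci, curvature, hp, h.self_of_nhds]

/-- The difference tensor `v^e g_ac - δ_c^e Υ_a - δ_a^e Υ_c` of a conformal change. -/
def diffTensor (g : Matrix (Fin D) (Fin D) ℝ) (v Υ : Fin D → ℝ) (e a c : Fin D) : ℝ :=
  v e * g a c - kron e c * Υ a - kron e a * Υ c

section DiffTensor

variable {g : Matrix (Fin D) (Fin D) ℝ} {v Υ : Fin D → ℝ}

theorem sum_diffTensor_mul (w : Fin D → ℝ) (a c : Fin D) :
    ∑ e, diffTensor g v Υ e a c * w e = (∑ e, v e * w e) * g a c - Υ a * w c - Υ c * w a := by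
  rw [← sum_kron_mul' c w, ← sum_kron_mul' a w]
  simp only [diffTensor, Finset.sum_mul, Finset.mul_sum, ← Finset.sum_sub_distrib]
  exact Finset.sum_congr rfl fun e _ ↦ by ring

theorem diffTensor_comm (hg : ∀ a b, g a b = g b a) (e a c : Fin D) :
    diffTensor g v Υ e a c = diffTensor g v Υ e c a := by
  simp only [diffTensor, hg a c]
  ring

theorem sum_mul_diffTensor (hv : ∀ a, ∑ e, v e * g e a = Υ a) (hg : ∀ a b, g a b = g b a)
    (b a : Fin D) :
    ∑ e, v e * diffTensor g v Υ b a e = -(kron b a * ∑ e, v e * Υ e) := by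
  have h1 : ∑ e, v e * diffTensor g v Υ b a e
      = v b * (∑ e, v e * g e a) - (∑ e, kron b e * v e) * Υ a
        - kron b a * ∑ e, v e * Υ e := by
    simp only [diffTensor, Finset.sum_mul, Finset.mul_sum, ← Finset.sum_sub_distrib]
    exact Finset.sum_congr rfl fun e _ ↦ by rw [hg a e]; ring
  rw [h1, hv, sum_kron_mul]
  ring

theorem sum_diffTensor_trace (hv : ∀ a, ∑ e, v e * g e a = Υ a) (c : Fin D) :
    ∑ b, diffTensor g v Υ b b c = -((D : ℝ) * Υ c) := by
  have h1 : ∑ b, diffTensor g v Υ b b c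
      = ∑ b, v b * g b c - ∑ b, kron b c * Υ b - ∑ b : Fin D, kron b b * Υ c := by
    simp only [diffTensor, Finset.sum_sub_distrib]
  rw [h1, hv, sum_kron_mul']
  simp [kron]

theorem sum_sum_mul_diffTensor (L : Fin D → Fin D → Fin D → ℝ) (a c : Fin D) :
    ∑ b, ∑ e, L e b c * diffTensor g v Υ b a e
      = ∑ b, v b * ∑ e, L e b c * g a e - Υ a * ∑ b, L b b c - ∑ e, L e a c * Υ e := by
  have h1 : ∀ b, ∑ e, L e b c * diffTensor g v Υ b a e
      = v b * (∑ e, L e b c * g a e) - Υ a * L b b c - kron b a * ∑ e, L e b c * Υ e := by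
    intro b
    rw [← sum_kron_mul b (fun e ↦ L e b c)]
    simp only [diffTensor, Finset.mul_sum, ← Finset.sum_sub_distrib]
    exact Finset.sum_congr rfl fun e _ ↦ by ring
  simp only [h1, Finset.sum_sub_distrib, ← Finset.mul_sum]
  rw [sum_kron_mul' a (fun b ↦ ∑ e, L e b c * Υ e)]

theorem sum_sum_diffTensor_mul (L : Fin D → Fin D → Fin D → ℝ) (hg : ∀ a b, g a b = g b a)
    (a c : Fin D) :
    ∑ b, ∑ e, diffTensor g v Υ e b c * L b a e
      = ∑ b, v b * ∑ e, L e a b * g c e - Υ c * ∑ b, L b a b - ∑ e, L e a c * Υ e := by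
  rw [Finset.sum_comm, ← sum_sum_mul_diffTensor (fun e b c ↦ L e c b)]
  · exact Finset.sum_congr rfl fun b _ ↦ Finset.sum_congr rfl fun e _ ↦ by
      rw [diffTensor_comm hg]; ring

theorem sum_sum_diffTensor_mul_diffTensor (hv : ∀ a, ∑ e, v e * g e a = Υ a)
    (hg : ∀ a b, g a b = g b a) (a c : Fin D) :
    ∑ b, ∑ e, diffTensor g v Υ e b c * diffTensor g v Υ b a e
      = ((D : ℝ) + 2) * Υ a * Υ c - 2 * (∑ e, v e * Υ e) * g a c := by
  simp only [sum_diffTensor_mul, sum_mul_diffTensor hv hg, Finset.sum_sub_distrib,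
    ← Finset.mul_sum]
  have h1 : ∑ b, diffTensor g v Υ b a b = -((D : ℝ) * Υ a) := by
    rw [← sum_diffTensor_trace hv]
    exact Finset.sum_congr rfl fun b _ ↦ diffTensor_comm hg _ _ _
  have h2 : ∑ b, Υ b * diffTensor g v Υ b a c
      = (∑ e, v e * Υ e) * g a c - Υ a * Υ c - Υ c * Υ a := by
    rw [← sum_diffTensor_mul Υ]
    exact Finset.sum_congr rfl fun b _ ↦ mul_comm _ _
  have h3 : ∑ b, -(kron b a * ∑ e, v e * Υ e) * g b c = -(∑ e, v e * Υ e) * g a c := by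
    rw [← sum_kron_mul' a (fun b ↦ -(∑ e, v e * Υ e) * g b c)]
    exact Finset.sum_congr rfl fun b _ ↦ by ring
  rw [h1, h2, h3]
  ring

/-- The part of the Ricci tensor that is quadratic in the connection coefficients. -/
theorem sum_quadratic_add_diffTensor (hv : ∀ a, ∑ e, v e * g e a = Υ a)
    (hg : ∀ a b, g a b = g b a) {L : Fin D → Fin D → Fin D → ℝ}
    (hL : ∀ e a b, L e a b = L e b a) (a c : Fin D) :
    ∑ b, ∑ e, ((L e a c + diffTensor g v Υ e a c) * (L b b e + diffTensor g v Υ b b e)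
        - (L e b c + diffTensor g v Υ e b c) * (L b a e + diffTensor g v Υ b a e))
      = ∑ b, ∑ e, (L e a c * L b b e - L e b c * L b a e)
        - ((D : ℝ) - 2) * ∑ e, L e a c * Υ e + ((D : ℝ) - 2) * Υ a * Υ c
        - ∑ b, v b * (∑ e, L e b c * g a e + ∑ e, L e a b * g c e)
        + (∑ e, v e * ∑ b, L b b e - ((D : ℝ) - 2) * ∑ e, v e * Υ e) * g a c := by
  have hsplit : ∑ b, ∑ e, ((L e a c + diffTensor g v Υ e a c) * (L b b e + diffTensor g v Υ b b e)
        - (L e b c + diffTensor g v Υ e b c) * (L b a e + diffTensor g v Υ b a e))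
      = ∑ b, ∑ e, (L e a c * L b b e - L e b c * L b a e)
        + ∑ b, ∑ e, L e a c * diffTensor g v Υ b b e
        + ∑ b, ∑ e, diffTensor g v Υ e a c * (L b b e + diffTensor g v Υ b b e)
        - ∑ b, ∑ e, L e b c * diffTensor g v Υ b a e
        - ∑ b, ∑ e, diffTensor g v Υ e b c * L b a e
        - ∑ b, ∑ e, diffTensor g v Υ e b c * diffTensor g v Υ b a e := by
    simp only [← Finset.sum_add_distrib, ← Finset.sum_sub_distrib]
    exact Finset.sum_congr rfl fun b _ ↦ Finset.sum_congr rfl fun e _ ↦ by ring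
  have h1 : ∑ b, ∑ e, L e a c * diffTensor g v Υ b b e = -((D : ℝ) * ∑ e, L e a c * Υ e) := by
    rw [Finset.sum_comm, Finset.mul_sum, ← Finset.sum_neg_distrib]
    refine Finset.sum_congr rfl fun e _ ↦ ?_
    rw [← Finset.mul_sum, sum_diffTensor_trace hv]
    ring
  have h2 : ∑ b, ∑ e, diffTensor g v Υ e a c * (L b b e + diffTensor g v Υ b b e)
      = (∑ e, v e * ∑ b, L b b e - D * ∑ e, v e * Υ e) * g a c
        - Υ a * (∑ b, L b b c - D * Υ c) - Υ c * (∑ b, L b b a - D * Υ a) := by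
    rw [Finset.sum_comm]
    simp only [← Finset.mul_sum, Finset.sum_add_distrib, sum_diffTensor_trace hv]
    rw [sum_diffTensor_mul (fun e ↦ ∑ b, L b b e + -((D : ℝ) * Υ e))]
    have h3 : ∑ e, v e * (∑ b, L b b e + -((D : ℝ) * Υ e))
        = ∑ e, v e * ∑ b, L b b e - D * ∑ e, v e * Υ e := by
      rw [Finset.mul_sum, ← Finset.sum_sub_distrib]
      exact Finset.sum_congr rfl fun e _ ↦ by ring
    rw [h3]
    ring
  have h4 : ∑ b, L b a b = ∑ b, L b b a := Finset.sum_congr rfl fun b _ ↦ hL b a b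
  rw [hsplit, h1, h2, sum_sum_mul_diffTensor, sum_sum_diffTensor_mul L hg,
    sum_sum_diffTensor_mul_diffTensor hv hg, h4]
  simp only [mul_add, Finset.sum_add_distrib]
  ring

end DiffTensor

namespace IsMetricOn

variable {G : Coord D → Matrix (Fin D) (Fin D) ℝ} {S : Set (Coord D)} {y : Coord D}

theorem pd_apply (hG : IsMetricOn G S) (hy : y ∈ S) (b a c : Fin D) :
    pd b (fun z ↦ G z a c) y = ∑ e, christoffel G y e b c * G y a e
      + ∑ e, christoffel G y e a b * G y c e := by
  have h := congrFun (congrFun (hG.mpd_eq hy b) a) c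
  simp only [mpd, connMat, Matrix.of_apply, Matrix.add_apply, Matrix.mul_apply,
    Matrix.transpose_apply] at h
  rw [h, add_comm]
  congr 1
  · exact Finset.sum_congr rfl fun e _ ↦ mul_comm _ _
  · exact Finset.sum_congr rfl fun e _ ↦ by
      rw [hG.christoffel_comm hy, hG.apply_comm hy e c]

theorem sum_raise_mul_apply (hG : IsMetricOn G S) (hy : y ∈ S) (Υ : Fin D → ℝ) (a : Fin D) :
    ∑ e, (∑ d, (G y)⁻¹ e d * Υ d) * G y e a = Υ a :=
  hG.sum_raise_mul hy Υ a

/-- The Ricci tensor of the connection `weylConn G Υ`, modulo multiples of the metric. -/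
theorem ricci_weylConn (hG : IsMetricOn G S) {Υ : Coord D → Fin D → ℝ}
    (hΥ : ∀ y ∈ S, ∀ a, ContDiffAt ℝ ∞ (fun z ↦ Υ z a) y) (hy : y ∈ S) :
    ∃ τ : ℝ, ∀ a c, ricci (weylConn G Υ) y a c = ricci (christoffel G) y a c
      + ((D : ℝ) - 1) * pd a (fun z ↦ Υ z c) y - pd c (fun z ↦ Υ z a) y
      - ((D : ℝ) - 2) * ∑ e, christoffel G y e a c * Υ y e
      + ((D : ℝ) - 2) * Υ y a * Υ y c + τ * G y a c := by
  set v : Coord D → Fin D → ℝ := fun z e ↦ ∑ d, (G z)⁻¹ e d * Υ z d with hv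
  have hK : ∀ z, weylConn G Υ z = fun e a c ↦ christoffel G z e a c
      + diffTensor (G z) (v z) (Υ z) e a c := by
    intro z
    funext e a c
    simp only [weylConn, diffTensor, hv]
    ring
  have dv : ∀ e, DifferentiableAt ℝ (fun z ↦ v z e) y := fun e ↦
    differentiableAt_of_contDiffAt_top (ContDiffAt.sum fun d _ ↦
      (hG.smooth_inv hy e d).mul (hΥ y hy d))
  have dΥ : ∀ e, DifferentiableAt ℝ (fun z ↦ Υ z e) y := fun e ↦
    differentiableAt_of_contDiffAt_top (hΥ y hy e)
  have dG := (hG.smooth y hy).diff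
  have dΓ : ∀ e a c, DifferentiableAt ℝ (fun z ↦ christoffel G z e a c) y := fun e a c ↦
    differentiableAt_of_contDiffAt_top (hG.smooth_christoffel hy e a c)
  have dvG : ∀ e a c, DifferentiableAt ℝ (fun z ↦ v z e * G z a c) y := fun e a c ↦
    (dv e).mul (dG a c)
  have dkΥ : ∀ e a c : Fin D, DifferentiableAt ℝ (fun z ↦ kron e c * Υ z a) y := fun e a c ↦
    (differentiableAt_const _).mul (dΥ a)
  have ds : ∀ e a c,
      DifferentiableAt ℝ (fun z ↦ diffTensor (G z) (v z) (Υ z) e a c) y := fun e a c ↦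
    ((dvG e a c).sub (dkΥ e a c)).sub (dkΥ e c a)
  have hpd : ∀ b e a c, pd b (fun z ↦ diffTensor (G z) (v z) (Υ z) e a c) y
      = pd b (fun z ↦ v z e) y * G y a c + v y e * pd b (fun z ↦ G z a c) y
        - kron e c * pd b (fun z ↦ Υ z a) y - kron e a * pd b (fun z ↦ Υ z c) y := by
    intro b e a c
    simp only [diffTensor]
    rw [pd_sub ((dvG e a c).fun_sub (dkΥ e a c)) (dkΥ e c a), pd_sub (dvG e a c) (dkΥ e a c),
      pd_mul (dv e) (dG a c), pd_const_mul (dΥ a), pd_const_mul (dΥ c)]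
  refine ⟨∑ b, pd b (fun z ↦ v z b) y + (∑ e, v y e * ∑ b, christoffel G y b b e
    - ((D : ℝ) - 2) * ∑ e, v y e * Υ y e), fun a c ↦ ?_⟩
  have hq := sum_quadratic_add_diffTensor (g := G y) (v := v y) (Υ := Υ y)
    (hG.sum_raise_mul_apply hy _) (hG.apply_comm hy) (hG.christoffel_comm hy) a c
  have hdiv : ∑ b, pd b (fun z ↦ diffTensor (G z) (v z) (Υ z) b a c) y
      = (∑ b, pd b (fun z ↦ v z b) y) * G y a c + ∑ b, v y b * pd b (fun z ↦ G z a c) y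
        - pd c (fun z ↦ Υ z a) y - pd a (fun z ↦ Υ z c) y := by
    simp only [hpd, Finset.sum_sub_distrib, Finset.sum_add_distrib, Finset.sum_mul]
    rw [sum_kron_mul' c (fun b ↦ pd b (fun z ↦ Υ z a) y),
      sum_kron_mul' a (fun b ↦ pd b (fun z ↦ Υ z c) y)]
  have htr : ∑ b, pd a (fun z ↦ diffTensor (G z) (v z) (Υ z) b b c) y
      = -((D : ℝ) * pd a (fun z ↦ Υ z c) y) := by
    rw [← pd_sum (f := fun b z ↦ diffTensor (G z) (v z) (Υ z) b b c) _ fun b _ ↦ ds b b c,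
      pd_congr (eventually_of_mem (hG.mem_nhds hy) fun z hz ↦
        sum_diffTensor_trace (hG.sum_raise_mul_apply hz (Υ z)) c), pd_neg, pd_const_mul (dΥ c)]
  have hexp : ricci (weylConn G Υ) y a c
      = ∑ b, pd b (fun z ↦ christoffel G z b a c) y - ∑ b, pd a (fun z ↦ christoffel G z b b c) y
        + ∑ b, pd b (fun z ↦ diffTensor (G z) (v z) (Υ z) b a c) y
        - ∑ b, pd a (fun z ↦ diffTensor (G z) (v z) (Υ z) b b c) y
        + ∑ b, ∑ e, ((christoffel G y e a c + diffTensor (G y) (v y) (Υ y) e a c)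
          * (christoffel G y b b e + diffTensor (G y) (v y) (Υ y) b b e)
        - (christoffel G y e b c + diffTensor (G y) (v y) (Υ y) e b c)
          * (christoffel G y b a e + diffTensor (G y) (v y) (Υ y) b a e)) := by
    simp only [ricci, curvature, hK, ← Finset.sum_add_distrib, ← Finset.sum_sub_distrib]
    refine Finset.sum_congr rfl fun b _ ↦ ?_
    rw [pd_add (dΓ b a c) (ds b a c), pd_add (dΓ b b c) (ds b b c)]
    ring
  have hΓ : ricci (christoffel G) y a c
      = ∑ b, pd b (fun z ↦ christoffel G z b a c) y - ∑ b, pd a (fun z ↦ christoffel G z b b c) y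
        + ∑ b, ∑ e, (christoffel G y e a c * christoffel G y b b e
          - christoffel G y e b c * christoffel G y b a e) := by
    simp only [ricci, curvature, ← Finset.sum_add_distrib, ← Finset.sum_sub_distrib]
  rw [hexp, hq, hdiv, htr, hΓ]
  simp only [← hG.pd_apply hy]
  ring

end IsMetricOn

/-! ### The Cotton tensor of a metric that is conformal to an Einstein metric -/

/-- The covariant derivative `∇_a Υ_b` of a covector field. -/
def covDeriv₁ (K : Coord D → Fin D → Fin D → Fin D → ℝ) (Υ : Coord D → Fin D → ℝ) (y : Coord D)
    (a b : Fin D) : ℝ :=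
  pd a (fun z ↦ Υ z b) y - ∑ c, K y c a b * Υ y c

namespace IsMetricOn

variable {G : Coord D → Matrix (Fin D) (Fin D) ℝ} {S : Set (Coord D)} {y : Coord D}

theorem smooth_covDeriv₁ (hG : IsMetricOn G S) {Υ : Coord D → Fin D → ℝ}
    (hΥ : ∀ y ∈ S, ∀ a, ContDiffAt ℝ ∞ (fun z ↦ Υ z a) y) (hy : y ∈ S) (a b : Fin D) :
    ContDiffAt ℝ ∞ (fun z ↦ covDeriv₁ (christoffel G) Υ z a b) y :=
  (contDiffAt_pd (hΥ y hy b) a).sub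
    (ContDiffAt.sum fun c _ ↦ (hG.smooth_christoffel hy c a b).mul (hΥ y hy c))

/-- The Ricci identity `∇_a ∇_b Υ_c - ∇_b ∇_a Υ_c = R_abc^d Υ_d`. -/
theorem ricci_identity (hG : IsMetricOn G S) {Υ : Coord D → Fin D → ℝ}
    (hΥ : ∀ y ∈ S, ∀ a, ContDiffAt ℝ ∞ (fun z ↦ Υ z a) y) (hy : y ∈ S) (a b c : Fin D) :
    covDeriv₂ (christoffel G) (covDeriv₁ (christoffel G) Υ) y a b c
      - covDeriv₂ (christoffel G) (covDeriv₁ (christoffel G) Υ) y b a c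
      = ∑ d, curvature (christoffel G) y a b c d * Υ y d := by
  set Γ := christoffel G with hΓdef
  have dΓ : ∀ d a c, DifferentiableAt ℝ (fun z ↦ Γ z d a c) y := fun d a c ↦
    differentiableAt_of_contDiffAt_top (hG.smooth_christoffel hy d a c)
  have dΥ : ∀ d, DifferentiableAt ℝ (fun z ↦ Υ z d) y := fun d ↦
    differentiableAt_of_contDiffAt_top (hΥ y hy d)
  have hp : ∀ a b c, pd a (fun z ↦ covDeriv₁ Γ Υ z b c) y = pd a (pd b (fun z ↦ Υ z c)) y
      - ∑ d, (pd a (fun z ↦ Γ z d b c) y * Υ y d + Γ y d b c * pd a (fun z ↦ Υ z d) y) := by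
    intro a b c
    simp only [covDeriv₁]
    rw [pd_sub (differentiableAt_of_contDiffAt_top (contDiffAt_pd (hΥ y hy c) b))
      (DifferentiableAt.fun_sum fun d _ ↦ (dΓ d b c).fun_mul (dΥ d)),
      pd_sum (f := fun d z ↦ Γ z d b c * Υ z d) _ fun d _ ↦ (dΓ d b c).mul (dΥ d)]
    exact congrArg _ (Finset.sum_congr rfl fun d _ ↦ pd_mul (dΓ d b c) (dΥ d) a)
  have hsw : ∀ a b, ∑ d, Γ y d a c * ∑ e, Γ y e b d * Υ y e
      = ∑ d, (∑ e, Γ y e a c * Γ y d b e) * Υ y d := by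
    intro a b
    simp only [Finset.mul_sum, Finset.sum_mul]
    rw [Finset.sum_comm]
    exact Finset.sum_congr rfl fun d _ ↦ Finset.sum_congr rfl fun e _ ↦ by ring
  have hR : ∑ d, curvature Γ y a b c d * Υ y d
      = ∑ d, pd b (fun z ↦ Γ z d a c) y * Υ y d - ∑ d, pd a (fun z ↦ Γ z d b c) y * Υ y d
        + ∑ d, Γ y d a c * ∑ e, Γ y e b d * Υ y e
        - ∑ d, Γ y d b c * ∑ e, Γ y e a d * Υ y e := by
    rw [hsw a b, hsw b a]
    simp only [curvature, ← Finset.sum_add_distrib, ← Finset.sum_sub_distrib]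
    refine Finset.sum_congr rfl fun d _ ↦ ?_
    rw [Finset.sum_sub_distrib]
    ring
  have hc : ∀ a b, covDeriv₂ Γ (covDeriv₁ Γ Υ) y a b c = pd a (pd b (fun z ↦ Υ z c)) y
      - ∑ d, pd a (fun z ↦ Γ z d b c) y * Υ y d
      - ∑ d, Γ y d b c * pd a (fun z ↦ Υ z d) y
      - ∑ d, Γ y d a b * covDeriv₁ Γ Υ y d c
      - ∑ d, Γ y d a c * pd b (fun z ↦ Υ z d) y
      + ∑ d, Γ y d a c * ∑ e, Γ y e b d * Υ y e := by
    intro a b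
    have h1 : ∑ d, Γ y d a c * covDeriv₁ Γ Υ y b d = ∑ d, Γ y d a c * pd b (fun z ↦ Υ z d) y
        - ∑ d, Γ y d a c * ∑ e, Γ y e b d * Υ y e := by
      rw [← Finset.sum_sub_distrib]
      exact Finset.sum_congr rfl fun d _ ↦ by rw [covDeriv₁]; ring
    rw [covDeriv₂, hp, Finset.sum_add_distrib, Finset.sum_add_distrib, h1]
    ring
  have hs : ∑ d, Γ y d b a * covDeriv₁ Γ Υ y d c = ∑ d, Γ y d a b * covDeriv₁ Γ Υ y d c :=
    Finset.sum_congr rfl fun d _ ↦ by rw [hΓdef, hG.christoffel_comm hy]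
  rw [hc, hc, hR, hs, pd_comm (hΥ y hy c) b a]
  ring

/-- If the Schouten tensor is `-∇_a Υ_b - Υ_a Υ_b` up to a multiple of the metric, then the
Cotton tensor is `-C_bep^d Υ_d / 2`. The multiple of the metric drops out because the Cotton and
Weyl tensors are both trace-free. -/
theorem cotton_eq (hD : 3 ≤ D) (hG : IsMetricOn G S) {Υ : Coord D → Fin D → ℝ}
    (hΥ : ∀ y ∈ S, ∀ a, ContDiffAt ℝ ∞ (fun z ↦ Υ z a) y) {σ : Coord D → ℝ}
    (hσ : ∀ y ∈ S, ContDiffAt ℝ ∞ σ y)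
    (h : ∀ y ∈ S, ∀ a b, schouten G y a b
      = σ y * G y a b - covDeriv₁ (christoffel G) Υ y a b - Υ y a * Υ y b)
    (hy : y ∈ S) (b e p : Fin D) :
    cotton G y b e p = -(1 / 2) * ∑ d, weyl G y b e p d * Υ y d := by
  set N := covDeriv₁ (christoffel G) Υ with hN
  have sN : MSmooth (fun z ↦ Matrix.of (N z)) y := hG.smooth_covDeriv₁ hΥ hy
  have sΥ : MSmooth (fun z ↦ Matrix.of fun a b ↦ Υ z a * Υ z b) y := fun a b ↦
    (hΥ y hy a).mul (hΥ y hy b)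
  have dΥ : ∀ d, DifferentiableAt ℝ (fun z ↦ Υ z d) y := fun d ↦
    differentiableAt_of_contDiffAt_top (hΥ y hy d)
  have hsq : ∀ a b c, covMat (christoffel G) a (fun z ↦ Matrix.of fun a b ↦ Υ z a * Υ z b) y b c
      = N y a b * Υ y c + Υ y b * N y a c := by
    intro a b c
    rw [← covDeriv₂_eq_covMat (christoffel G) (fun z a b ↦ Υ z a * Υ z b)]
    simp only [covDeriv₂, hN, covDeriv₁]
    rw [pd_mul (dΥ b) (dΥ c)]
    simp only [sub_mul, mul_sub, Finset.sum_mul, Finset.mul_sum, Finset.sum_add_distrib]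
    rw [Finset.sum_congr rfl fun d _ ↦ mul_assoc (christoffel G y d a b) (Υ y d) (Υ y c),
      Finset.sum_congr rfl fun d _ ↦ mul_left_comm (Υ y b) (christoffel G y d a c) (Υ y d)]
    ring
  have hL : ∀ a b c, covDeriv₂ (christoffel G) (schouten G) y a b c
      = pd a σ y * G y b c - covDeriv₂ (christoffel G) N y a b c
        - (N y a b * Υ y c + Υ y b * N y a c) := by
    intro a b c
    have he : (fun z ↦ Matrix.of (schouten G z)) =ᶠ[𝓝 y] fun z ↦ σ z • G z - Matrix.of (N z)
        - Matrix.of fun a b ↦ Υ z a * Υ z b :=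
      eventually_of_mem (hG.mem_nhds hy) fun z hz ↦ by
        ext i j
        exact h z hz i j
    have hlin : covMat (christoffel G) a (fun z ↦ Matrix.of (schouten G z)) y
        = covMat (christoffel G) a (fun z ↦ σ z • G z) y
          - covMat (christoffel G) a (fun z ↦ Matrix.of (N z)) y
          - covMat (christoffel G) a (fun z ↦ Matrix.of fun a b ↦ Υ z a * Υ z b) y := by
      have he0 : Matrix.of (schouten G y) = σ y • G y - Matrix.of (N y)
          - Matrix.of fun a b ↦ Υ y a * Υ y b := he.self_of_nhds
      simp only [covMat]
      rw [mpd_congr he, he0, mpd_sub ((MSmooth.smul (hσ y hy) (hG.smooth y hy)).sub sN)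
        sΥ, mpd_sub (MSmooth.smul (hσ y hy) (hG.smooth y hy)) sN]
      noncomm_ring
    rw [covDeriv₂_eq_covMat, hlin, hG.covMat_smul_self hy (hσ y hy), Matrix.sub_apply,
      Matrix.sub_apply, hsq, covDeriv₂_eq_covMat]
    rfl
  have hNs : ∀ a b, N y a b = σ y * G y a b - schouten G y a b - Υ y a * Υ y b := by
    intro a b
    rw [h y hy a b]
    ring
  have hNc : ∀ a b, N y a b = N y b a := by
    intro a b
    rw [hNs, hNs, hG.apply_comm hy, hG.schouten_comm hy]
    ring
  set w : Fin D → Fin D → ℝ := fun a d ↦ ∑ e, (G y)⁻¹ d e * schouten G y a e with hw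
  have hC : ∀ b e p, ∑ d, weyl G y b e p d * Υ y d
      = ∑ d, curvature (christoffel G) y b e p d * Υ y d
        - ((∑ d, w e d * Υ y d) * G y b p - (∑ d, w b d * Υ y d) * G y e p)
        - (Υ y e * schouten G y b p - Υ y b * schouten G y e p) := by
    intro b e p
    rw [← sum_kron_mul e (Υ y), ← sum_kron_mul b (Υ y)]
    simp only [weyl, Finset.sum_mul (s := Finset.univ) (f := fun d ↦ _ * Υ y d),
      ← Finset.sum_sub_distrib]
    exact Finset.sum_congr rfl fun d _ ↦ by simp only [hw]; ring
  -- the Cotton tensor modulo the metric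
  have hmod : ∃ θ : Fin D → ℝ, ∀ b e p, cotton G y b e p
      = -(1 / 2) * ∑ d, weyl G y b e p d * Υ y d + θ b * G y e p - θ e * G y b p := by
    refine ⟨fun b ↦ (1 / 2) * (pd b σ y + σ y * Υ y b + ∑ d, w b d * Υ y d), fun b e p ↦ ?_⟩
    have hr := hG.ricci_identity hΥ hy b e p
    rw [← hN] at hr
    rw [cotton, hL, hL, hC, ← hr, hNc e b, hNs b p, hNs e p]
    ring
  obtain ⟨θ, hθ⟩ := hmod
  have h3 : (3 : ℝ) ≤ D := by exact_mod_cast hD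
  have hθ0 : ∀ b, θ b = 0 := by
    intro b
    have h0 := hG.sum_inv_mul_cotton hD hy b
    have hW : ∑ e, ∑ p, (G y)⁻¹ e p * ∑ d, weyl G y b e p d * Υ y d = 0 := by
      simp only [Finset.mul_sum]
      calc ∑ e, ∑ p, ∑ d, (G y)⁻¹ e p * (weyl G y b e p d * Υ y d)
          = ∑ e, ∑ d, ∑ p, (G y)⁻¹ e p * (weyl G y b e p d * Υ y d) :=
            Finset.sum_congr rfl fun e _ ↦ Finset.sum_comm
        _ = ∑ d, ∑ e, ∑ p, (G y)⁻¹ e p * (weyl G y b e p d * Υ y d) := Finset.sum_comm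
        _ = ∑ d, (∑ e, ∑ p, (G y)⁻¹ e p * weyl G y b e p d) * Υ y d := by
            simp only [Finset.sum_mul]
            exact Finset.sum_congr rfl fun q _ ↦ Finset.sum_congr rfl fun e _ ↦
              Finset.sum_congr rfl fun p _ ↦ by ring
        _ = 0 := by simp only [hG.sum_inv_mul_weyl_trace hD hy, zero_mul, Finset.sum_const_zero]
    have hG1 : ∀ e, ∑ p, (G y)⁻¹ e p * G y e p = 1 := by
      intro e
      rw [Finset.sum_congr rfl fun p _ ↦ by rw [hG.apply_comm hy e p], hG.sum_inv_mul hy]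
      simp [kron]
    have hG2 : ∀ e, ∑ p, (G y)⁻¹ e p * G y b p = kron e b := by
      intro e
      rw [Finset.sum_congr rfl fun p _ ↦ by rw [hG.apply_comm hy b p], hG.sum_inv_mul hy]
    have hsum : ∑ e, ∑ p, (G y)⁻¹ e p * cotton G y b e p
        = -(1 / 2) * ∑ e, ∑ p, (G y)⁻¹ e p * ∑ d, weyl G y b e p d * Υ y d
          + θ b * ∑ e, ∑ p, (G y)⁻¹ e p * G y e p
          - ∑ e, (∑ p, (G y)⁻¹ e p * G y b p) * θ e := by
      rw [Finset.mul_sum, Finset.mul_sum, ← Finset.sum_add_distrib, ← Finset.sum_sub_distrib]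
      refine Finset.sum_congr rfl fun e _ ↦ ?_
      rw [Finset.mul_sum, Finset.mul_sum, Finset.sum_mul, ← Finset.sum_add_distrib,
        ← Finset.sum_sub_distrib]
      exact Finset.sum_congr rfl fun p _ ↦ by rw [hθ]; ring
    rw [hsum, hW] at h0
    simp only [hG1, hG2, Finset.sum_const, Finset.card_univ, Fintype.card_fin, nsmul_eq_mul,
      mul_one, mul_zero, zero_add, sum_kron_mul'] at h0
    have : θ b * ((D : ℝ) - 1) = 0 := by linarith
    rcases mul_eq_zero.1 this with h | h
    · exact h
    · linarith
  rw [hθ, hθ0, hθ0]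
  ring

/-- The inverse of the Weyl endomorphism recovers `Υ` from the Cotton tensor. -/
theorem lam_eq_of_cotton (hD : 3 ≤ D) (hG : IsMetricOn G S) (hy : y ∈ S)
    (hC : IsUnit (weylEnd G y)) {Υ : Fin D → ℝ}
    (h : ∀ b e p, cotton G y b e p = -(1 / 2) * ∑ d, weyl G y b e p d * Υ d) (q : Fin D) :
    lam G y q = Υ q := by
  have h1 : ∀ b e, ∑ p, cotton G y b e p * ∑ r, (G y)⁻¹ p r * weylInv G y b e r q
      = ∑ r, ∑ d, (-(1 / 2) * Υ d) * (weylUp G y r d b e * weylInv G y b e r q) := by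
    intro b e
    simp only [Finset.mul_sum]
    rw [Finset.sum_comm]
    refine Finset.sum_congr rfl fun r _ ↦ ?_
    simp only [h, ← hG.sum_inv_mul_weyl hy, Finset.mul_sum, Finset.sum_mul]
    rw [Finset.sum_comm]
    exact Finset.sum_congr rfl fun d _ ↦ Finset.sum_congr rfl fun p _ ↦ by ring
  have h2 : ∑ b, ∑ e, ∑ p, cotton G y b e p * ∑ r, (G y)⁻¹ p r * weylInv G y b e r q
      = ∑ d, (-(1 / 2) * Υ d) * ∑ r, ∑ b, ∑ e, weylUp G y r d b e * weylInv G y b e r q := by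
    simp only [h1]
    simp only [Finset.mul_sum]
    calc ∑ b, ∑ e, ∑ r, ∑ d, (-(1 / 2) * Υ d) * (weylUp G y r d b e * weylInv G y b e r q)
        = ∑ b, ∑ r, ∑ e, ∑ d, (-(1 / 2) * Υ d) * (weylUp G y r d b e * weylInv G y b e r q) :=
          Finset.sum_congr rfl fun b _ ↦ Finset.sum_comm
      _ = ∑ r, ∑ b, ∑ e, ∑ d, (-(1 / 2) * Υ d) * (weylUp G y r d b e * weylInv G y b e r q) :=
          Finset.sum_comm
      _ = ∑ r, ∑ b, ∑ d, ∑ e, (-(1 / 2) * Υ d) * (weylUp G y r d b e * weylInv G y b e r q) :=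
          Finset.sum_congr rfl fun r _ ↦ Finset.sum_congr rfl fun b _ ↦ Finset.sum_comm
      _ = ∑ r, ∑ d, ∑ b, ∑ e, (-(1 / 2) * Υ d) * (weylUp G y r d b e * weylInv G y b e r q) :=
          Finset.sum_congr rfl fun r _ ↦ Finset.sum_comm
      _ = _ := Finset.sum_comm
  have h3 : ∀ d, ∑ r : Fin D, (1 / 2 : ℝ) * (kron r r * kron d q - kron r q * kron d r)
      = (1 / 2) * ((D : ℝ) - 1) * kron d q := by
    intro d
    rw [← Finset.mul_sum, Finset.sum_sub_distrib, sum_kron_mul' q (fun r ↦ kron d r)]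
    simp only [kron, if_true, one_mul, Finset.sum_const, Finset.card_univ, Fintype.card_fin,
      nsmul_eq_mul]
    ring
  have hD1 : (1 : ℝ) - D ≠ 0 := by
    have : (3 : ℝ) ≤ D := by exact_mod_cast hD
    linarith
  rw [lam, h2]
  simp only [weylUp_mul_weylInv G y hC, h3]
  have h4 : ∑ d, -(1 / 2) * Υ d * (1 / 2 * ((D : ℝ) - 1) * kron d q)
      = (1 - (D : ℝ)) / 4 * Υ q := by
    rw [← sum_kron_mul' q Υ, Finset.mul_sum]
    exact Finset.sum_congr rfl fun d _ ↦ by ring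
  rw [h4]
  field_simp

end IsMetricOn

/-! ### Conformal changes of the metric -/

/-- The conformally related metric `e^(-2f) g`. -/
def confMetric (G : Coord D → Matrix (Fin D) (Fin D) ℝ) (f : Coord D → ℝ) (y : Coord D) :
    Matrix (Fin D) (Fin D) ℝ :=
  Real.exp (-2 * f y) • G y

theorem contDiffAt_exp_mul {f : Coord D → ℝ} {y : Coord D} (hf : ContDiffAt ℝ ∞ f y) (c : ℝ) :
    ContDiffAt ℝ ∞ (fun z ↦ Real.exp (c * f z)) y :=
  Real.contDiff_exp.contDiffAt.comp y (contDiffAt_const.mul hf)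

theorem pd_exp_mul {f : Coord D → ℝ} {y : Coord D} (hf : DifferentiableAt ℝ f y) (c : ℝ)
    (a : Fin D) : pd a (fun z ↦ Real.exp (c * f z)) y = c * pd a f y * Real.exp (c * f y) := by
  have h : DifferentiableAt ℝ (fun z ↦ c * f z) y := hf.const_mul c
  rw [pd, fderiv_exp h, ← pd_const_mul hf c a, pd]
  simp [mul_comm]

namespace IsMetricOn

variable {G : Coord D → Matrix (Fin D) (Fin D) ℝ} {S : Set (Coord D)} {y : Coord D}

theorem confMetric (hG : IsMetricOn G S) {f : Coord D → ℝ}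
    (hf : ∀ y ∈ S, ContDiffAt ℝ ∞ f y) : IsMetricOn (confMetric G f) S where
  isOpen := hG.isOpen
  smooth y hy := MSmooth.smul (contDiffAt_exp_mul (hf y hy) _) (hG.smooth y hy)
  symm y hy := by
    rw [ConfEinstein.confMetric, Matrix.transpose_smul, hG.symm y hy]
  det y hy := by
    rw [ConfEinstein.confMetric, Matrix.det_smul]
    exact (((Real.exp_pos _).ne').isUnit.pow _).mul (hG.det y hy)

/-- The Levi-Civita connection of `e^(-2f) g`. -/
theorem christoffel_confMetric (hG : IsMetricOn G S) {f : Coord D → ℝ}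
    (hf : ∀ y ∈ S, ContDiffAt ℝ ∞ f y) (hy : y ∈ S) :
    christoffel (ConfEinstein.confMetric G f) y = weylConn G (fun z a ↦ pd a f z) y := by
  set Υ : Coord D → Fin D → ℝ := fun z a ↦ pd a f z with hΥ
  set v : Fin D → ℝ := fun e ↦ ∑ d, (G y)⁻¹ e d * Υ y d with hv
  have hK : ∀ e a c, weylConn G Υ y e a c
      = christoffel G y e a c + diffTensor (G y) v (Υ y) e a c := by
    intro e a c
    simp only [weylConn, diffTensor, hv]
    ring
  have hlow : ∀ d a c, ∑ e, diffTensor (G y) v (Υ y) e a c * G y e d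
      = Υ y d * G y a c - Υ y a * G y c d - Υ y c * G y a d := by
    intro d a c
    rw [sum_diffTensor_mul (fun e ↦ G y e d), hG.sum_raise_mul_apply hy]
  have key := (hG.confMetric hf).christoffel_unique hy
    (A := fun a ↦ connMat (weylConn G Υ) a y) (fun a d c ↦ by
      simp only [connMat, Matrix.of_apply, hK]
      rw [hG.christoffel_comm hy, diffTensor_comm (hG.apply_comm hy)]) (fun a ↦ by
      have h1 : mpd a (ConfEinstein.confMetric G f) y = (-2 * Υ y a * Real.exp (-2 * f y)) • G y
          + Real.exp (-2 * f y) • mpd a G y := by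
        rw [← pd_exp_mul (differentiableAt_of_contDiffAt_top (hf y hy)) (-2) a]
        exact mpd_smul (contDiffAt_exp_mul (hf y hy) _) (hG.smooth y hy) a
      rw [h1, hG.mpd_eq hy]
      ext i j
      have e1 : ∑ k, weylConn G Υ y k a i * G y k j = ∑ k, christoffel G y k a i * G y k j
          + (Υ y j * G y a i - Υ y a * G y i j - Υ y i * G y a j) := by
        rw [← hlow, ← Finset.sum_add_distrib]
        exact Finset.sum_congr rfl fun k _ ↦ by rw [hK]; ring
      have e2 : ∑ k, G y i k * weylConn G Υ y k a j = ∑ k, G y i k * christoffel G y k a j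
          + (Υ y i * G y a j - Υ y a * G y j i - Υ y j * G y a i) := by
        rw [← hlow, ← Finset.sum_add_distrib]
        exact Finset.sum_congr rfl fun k _ ↦ by rw [hK, hG.apply_comm hy i k]; ring
      simp only [ConfEinstein.confMetric, Matrix.mul_smul, Matrix.smul_mul, Matrix.add_apply,
        Matrix.smul_apply, smul_eq_mul, Matrix.mul_apply, Matrix.transpose_apply, connMat,
        Matrix.of_apply]
      rw [e1, e2, hG.apply_comm hy j i]
      ring)
  funext e a c
  exact congrFun (congrFun (key a) e) c

/-- If `e^(-2f) g` has pure-trace Ricci tensor, then the covector `Λ` of `g` is `df`. -/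
theorem lam_eq_pd (hD : 3 ≤ D) (hG : IsMetricOn G S) (hC : ∀ y ∈ S, IsUnit (weylEnd G y))
    {f : Coord D → ℝ} (hf : ∀ y ∈ S, ContDiffAt ℝ ∞ f y) {ρ : Coord D → ℝ}
    (hE : ∀ y ∈ S, ∀ a b, ricci (christoffel (ConfEinstein.confMetric G f)) y a b = ρ y * G y a b)
    (hy : y ∈ S) (q : Fin D) : lam G y q = pd q f y := by
  set Υ : Coord D → Fin D → ℝ := fun z a ↦ pd a f z with hΥ
  have sΥ : ∀ y ∈ S, ∀ a, ContDiffAt ℝ ∞ (fun z ↦ Υ z a) y := fun y hy a ↦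
    contDiffAt_pd (hf y hy) a
  have h3 : (3 : ℝ) ≤ D := by exact_mod_cast hD
  have h2 : (D : ℝ) - 2 ≠ 0 := by linarith
  have hDne : (D : ℝ) ≠ 0 := by linarith
  -- the tensor `L_ab + ∇_a Υ_b + Υ_a Υ_b` is pure trace
  set P : Coord D → Fin D → Fin D → ℝ := fun z a b ↦ schouten G z a b
    + covDeriv₁ (christoffel G) Υ z a b + Υ z a * Υ z b with hP
  have hPτ : ∀ z ∈ S, ∃ t, ∀ a b, P z a b = t * G z a b := by
    intro z hz
    obtain ⟨τ, hτ⟩ := hG.ricci_weylConn sΥ hz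
    refine ⟨(ρ z - τ - ∑ e, ∑ p, (G z)⁻¹ e p * schouten G z e p) / ((D : ℝ) - 2),
      fun a b ↦ ?_⟩
    have h1 := hτ a b
    have hcongr : christoffel (ConfEinstein.confMetric G f) =ᶠ[𝓝 z] weylConn G Υ :=
      eventually_of_mem (hG.mem_nhds hz) fun w hw ↦ hG.christoffel_confMetric hf hw
    rw [← ricci_congr hcongr, hE z hz, hG.ricci_eq_schouten hD hz] at h1
    have hcl : pd b (fun z ↦ Υ z a) z = pd a (fun z ↦ Υ z b) z := pd_comm (hf z hz) b a
    rw [hcl] at h1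
    rw [div_mul_eq_mul_div, eq_div_iff h2]
    simp only [hP, covDeriv₁]
    linarith
  -- the factor is the normalized trace, hence smooth
  set σ : Coord D → ℝ := fun z ↦ (1 / (D : ℝ)) * ∑ a, ∑ b, (G z)⁻¹ a b * P z a b with hσ
  have hPσ : ∀ z ∈ S, ∀ a b, P z a b = σ z * G z a b := by
    intro z hz a b
    obtain ⟨t, ht⟩ := hPτ z hz
    have hG1 : ∀ e, ∑ p, (G z)⁻¹ e p * (t * G z e p) = t := by
      intro e
      calc _ = (∑ p, (G z)⁻¹ e p * G z p e) * t := by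
            rw [Finset.sum_mul]
            exact Finset.sum_congr rfl fun p _ ↦ by rw [hG.apply_comm hz e p]; ring
        _ = t := by rw [hG.sum_inv_mul hz]; simp [kron]
    have : σ z = t := by
      simp only [hσ, ht, hG1, Finset.sum_const, Finset.card_univ, Fintype.card_fin, nsmul_eq_mul]
      field_simp
    rw [this, ht]
  have sσ : ∀ z ∈ S, ContDiffAt ℝ ∞ σ z := fun z hz ↦
    contDiffAt_const.mul (ContDiffAt.sum fun a _ ↦ ContDiffAt.sum fun b _ ↦
      (hG.smooth_inv hz a b).mul (((hG.smooth_schouten hz a b).add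
        (hG.smooth_covDeriv₁ sΥ hz a b)).add ((sΥ z hz a).mul (sΥ z hz b))))
  refine hG.lam_eq_of_cotton hD hy (hC y hy) (Υ := Υ y) (fun b e p ↦ ?_) q
  refine hG.cotton_eq hD sΥ sσ (fun z hz a b ↦ ?_) hy b e p
  rw [← hPσ z hz]
  simp only [hP]
  ring

/-- If `e^(-2f) g` has pure-trace Ricci tensor, then so has the `𝒞`-connection of `g`. -/
theorem ricci_cConn_of_confMetric (hD : 3 ≤ D) (hG : IsMetricOn G S)
    (hC : ∀ y ∈ S, IsUnit (weylEnd G y)) {f : Coord D → ℝ} (hf : ∀ y ∈ S, ContDiffAt ℝ ∞ f y)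
    {ρ : Coord D → ℝ}
    (hE : ∀ y ∈ S, ∀ a b, ricci (christoffel (ConfEinstein.confMetric G f)) y a b = ρ y * G y a b)
    (hy : y ∈ S) (a b : Fin D) : ricci (cConn G) y a b = ρ y * G y a b := by
  rw [← hE y hy]
  refine ricci_congr (eventually_of_mem (hG.mem_nhds hy) fun z hz ↦ ?_) a b
  rw [hG.christoffel_confMetric hf hz, cConn_eq_weylConn]
  funext c a b
  simp only [weylConn, hG.lam_eq_pd hD hC hf hE hz]

end IsMetricOn

/-! ### Smoothness of the covector `Λ` -/

theorem ringInverse_map_algEquiv {A B : Type*} [Ring A] [Ring B] [Algebra ℝ A] [Algebra ℝ B]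
    (e : A ≃ₐ[ℝ] B) (x : A) : e (Ring.inverse x) = Ring.inverse (e x) := by
  by_cases hx : IsUnit x
  · obtain ⟨u, rfl⟩ := hx
    have h : e u = ((Units.map (e : A →* B) u : Bˣ) : B) := rfl
    rw [h, Ring.inverse_unit, Ring.inverse_unit, ← map_inv]
    rfl
  · have hx' : ¬IsUnit (e x) := fun h ↦ hx (by simpa using h.map e.symm)
    rw [Ring.inverse_non_unit _ hx, Ring.inverse_non_unit _ hx', map_zero]

/-- The inverse of a smooth family of endomorphisms of a finite-dimensional space is smooth. The
family is presented as a linear combination of fixed endomorphisms, and smoothness is tested on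
matrix coefficients, so that no norm on the space is needed. -/
theorem contDiffAt_ringInverse_end {N : Type*} [AddCommGroup N] [Module ℝ N]
    [FiniteDimensional ℝ N] {ι : Type*} (s : Finset ι) (c : ι → Coord D → ℝ)
    (E : ι → Module.End ℝ N) {y : Coord D} (hc : ∀ i ∈ s, ContDiffAt ℝ ∞ (c i) y)
    (hu : IsUnit (∑ i ∈ s, c i y • E i)) (φ : N →ₗ[ℝ] ℝ) (w : N) :
    ContDiffAt ℝ ∞ (fun z ↦ φ (Ring.inverse (∑ i ∈ s, c i z • E i) w)) y := by
  set b := Module.finBasis ℝ N with hb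
  set e := LinearMap.toMatrixAlgEquiv b with he
  have hM : ∀ z, e (Ring.inverse (∑ i ∈ s, c i z • E i)) = (∑ i ∈ s, c i z • e (E i))⁻¹ := by
    intro z
    rw [ringInverse_map_algEquiv, Matrix.nonsing_inv_eq_ringInverse, map_sum]
    simp only [map_smul]
  have hφ : ∀ z, φ (Ring.inverse (∑ i ∈ s, c i z • E i) w)
      = ∑ k, (∑ l, (∑ i ∈ s, c i z • e (E i))⁻¹ k l * b.repr w l) * φ (b k) := by
    intro z
    rw [← hM]
    conv_lhs => rw [← b.sum_repr (Ring.inverse (∑ i ∈ s, c i z • E i) w), map_sum]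
    refine Finset.sum_congr rfl fun k _ ↦ ?_
    rw [map_smul, smul_eq_mul, ← LinearMap.toMatrix_mulVec_repr b b]
    rfl
  simp only [hφ]
  refine ContDiffAt.sum fun k _ ↦ ContDiffAt.mul (ContDiffAt.sum fun l _ ↦
    ContDiffAt.mul ?_ contDiffAt_const) contDiffAt_const
  refine contDiffAt_matrix_inv (F := fun z ↦ ∑ i ∈ s, c i z • e (E i)) (fun k l ↦ ?_) ?_ k l
  · simp only [Matrix.sum_apply, Matrix.smul_apply, smul_eq_mul]
    exact ContDiffAt.sum fun i hi ↦ (hc i hi).mul contDiffAt_const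
  · have := (hu.map e)
    rw [map_sum] at this
    simp only [map_smul] at this
    exact (Matrix.isUnit_iff_isUnit_det _).1 this

/-- The endomorphism `ψ ↦ ψ^be δ^[a δ^c]` of the space of bivectors. -/
def unitEnd (a c b e : Fin D) : Module.End ℝ (bivector D) where
  toFun ψ := ψ.1 b e • unitBivector a c
  map_add' ψ χ := by simp [add_smul]
  map_smul' t ψ := by simp [mul_smul]

/-- The component `ψ^be`, as a linear functional on bivectors. -/
def bivectorEntry (b e : Fin D) : bivector D →ₗ[ℝ] ℝ where
  toFun ψ := ψ.1 b e
  map_add' _ _ := rfl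
  map_smul' _ _ := rfl

theorem weylEnd_eq_sum (G : Coord D → Matrix (Fin D) (Fin D) ℝ) (y : Coord D) :
    weylEnd G y = ∑ i : Fin D × Fin D × Fin D × Fin D,
      weylUp G y i.1 i.2.1 i.2.2.1 i.2.2.2 • unitEnd i.1 i.2.1 i.2.2.1 i.2.2.2 := by
  ext ψ k l
  have hanti : (weylEnd G y ψ).1 k l
      = (1 / 2) * ((weylEnd G y ψ).1 k l - (weylEnd G y ψ).1 l k) := by
    rw [(weylEnd G y ψ).2 k l]
    ring
  rw [hanti]
  have happ : ∀ k l, (weylEnd G y ψ).1 k l = ∑ b, ∑ e, weylUp G y k l b e * ψ.1 b e :=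
    fun k l ↦ rfl
  have hu : ∀ a c b e, (unitEnd a c b e ψ).1 k l
      = ψ.1 b e * ((1 / 2) * (kron k a * kron l c - kron k c * kron l a)) := fun _ _ _ _ ↦ rfl
  have hs : ∀ X : Fin D → Fin D → ℝ, ∑ a, ∑ c, X a c * ((1 / 2) * (kron k a * kron l c
      - kron k c * kron l a)) = (1 / 2) * (X k l - X l k) := by
    intro X
    have e1 : ∑ a, ∑ c, kron k a * (kron l c * X a c) = X k l := by
      simp only [← Finset.mul_sum]
      rw [sum_kron_mul k (fun a ↦ ∑ c, kron l c * X a c), sum_kron_mul]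
    have e2 : ∑ a, ∑ c, kron l a * (kron k c * X a c) = X l k := by
      simp only [← Finset.mul_sum]
      rw [sum_kron_mul l (fun a ↦ ∑ c, kron k c * X a c), sum_kron_mul]
    rw [← e1, ← e2, ← Finset.sum_sub_distrib, Finset.mul_sum]
    refine Finset.sum_congr rfl fun a _ ↦ ?_
    rw [← Finset.sum_sub_distrib, Finset.mul_sum]
    exact Finset.sum_congr rfl fun c _ ↦ by ring
  rw [happ, happ, ← hs (fun a c ↦ ∑ b, ∑ e, weylUp G y a c b e * ψ.1 b e)]
  simp only [Fintype.sum_prod_type, LinearMap.sum_apply, LinearMap.smul_apply,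
    Submodule.coe_sum, Submodule.coe_smul, Matrix.sum_apply, Matrix.smul_apply, smul_eq_mul, hu,
    Finset.sum_mul]
  exact Finset.sum_congr rfl fun a _ ↦ Finset.sum_congr rfl fun c _ ↦
    Finset.sum_congr rfl fun b _ ↦ Finset.sum_congr rfl fun e _ ↦ by ring

namespace IsMetricOn

variable {G : Coord D → Matrix (Fin D) (Fin D) ℝ} {S : Set (Coord D)} {y : Coord D}

theorem smooth_weyl (hG : IsMetricOn G S) (hy : y ∈ S) (a b c d : Fin D) :
    ContDiffAt ℝ ∞ (fun z ↦ weyl G z a b c d) y := by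
  have hw : ∀ a, ContDiffAt ℝ ∞ (fun z ↦ ∑ e, (G z)⁻¹ d e * schouten G z a e) y := fun a ↦
    ContDiffAt.sum fun e _ ↦ (hG.smooth_inv hy d e).mul (hG.smooth_schouten hy a e)
  exact ((hG.smooth_curvMat hy a b d c).sub (((hw b).mul (hG.smooth y hy a c)).sub
    ((hw a).mul (hG.smooth y hy b c)))).sub ((contDiffAt_const.mul
      (hG.smooth_schouten hy a c)).sub (contDiffAt_const.mul (hG.smooth_schouten hy b c)))

theorem smooth_weylUp (hG : IsMetricOn G S) (hy : y ∈ S) (a c b e : Fin D) :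
    ContDiffAt ℝ ∞ (fun z ↦ weylUp G z a c b e) y :=
  ContDiffAt.sum fun p _ ↦ ContDiffAt.sum fun q _ ↦ ContDiffAt.sum fun f _ ↦
    (((hG.smooth_inv hy a p).mul (hG.smooth_inv hy c q)).mul (hG.smooth_weyl hy p q b f)).mul
      (hG.smooth y hy f e)

theorem smooth_weylInv (hG : IsMetricOn G S) (hy : y ∈ S) (hC : IsUnit (weylEnd G y))
    (b e l h : Fin D) : ContDiffAt ℝ ∞ (fun z ↦ weylInv G z b e l h) y := by
  have h0 : (fun z ↦ weylInv G z b e l h) = fun z ↦ bivectorEntry b e (Ring.inverse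
      (∑ i : Fin D × Fin D × Fin D × Fin D, weylUp G z i.1 i.2.1 i.2.2.1 i.2.2.2 •
        unitEnd i.1 i.2.1 i.2.2.1 i.2.2.2) (unitBivector l h)) := by
    funext z
    rw [← weylEnd_eq_sum]
    rfl
  rw [weylEnd_eq_sum] at hC
  rw [h0]
  have key := contDiffAt_ringInverse_end (N := bivector D) (y := y)
    (Finset.univ : Finset (Fin D × Fin D × Fin D × Fin D))
    (fun i z ↦ weylUp G z i.1 i.2.1 i.2.2.1 i.2.2.2)
    (fun i ↦ unitEnd i.1 i.2.1 i.2.2.1 i.2.2.2)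
    (fun i _ ↦ hG.smooth_weylUp hy _ _ _ _)
  exact key hC (bivectorEntry b e) (unitBivector l h)

theorem smooth_covDeriv_schouten (hG : IsMetricOn G S) (hy : y ∈ S) (c a b : Fin D) :
    ContDiffAt ℝ ∞ (fun z ↦ covDeriv₂ (christoffel G) (schouten G) z c a b) y :=
  (contDiffAt_pd (hG.smooth_schouten hy a b) c).sub (ContDiffAt.sum fun d _ ↦
    ((hG.smooth_christoffel hy d c a).mul (hG.smooth_schouten hy d b)).add
      ((hG.smooth_christoffel hy d c b).mul (hG.smooth_schouten hy a d)))

theorem smooth_lam (hG : IsMetricOn G S) (hy : y ∈ S) (hC : IsUnit (weylEnd G y)) (q : Fin D) :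
    ContDiffAt ℝ ∞ (fun z ↦ lam G z q) y :=
  contDiffAt_const.mul (ContDiffAt.sum fun b _ ↦ ContDiffAt.sum fun e _ ↦
    ContDiffAt.sum fun p _ ↦ (contDiffAt_const.mul ((hG.smooth_covDeriv_schouten hy b e p).sub
      (hG.smooth_covDeriv_schouten hy e b p))).mul (ContDiffAt.sum fun r _ ↦
        (hG.smooth_inv hy p r).mul (hG.smooth_weylInv hy hC b e r q)))

/-- The antisymmetric part of the Ricci tensor of the `𝒞`-connection is a nonzero multiple of the
exterior derivative of `Λ`. -/
theorem lam_closed (hD : 3 ≤ D) (hG : IsMetricOn G S) (hC : ∀ y ∈ S, IsUnit (weylEnd G y))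
    (hy : y ∈ S) {a b : Fin D} (h : ricci (cConn G) y a b = ricci (cConn G) y b a) :
    pd a (fun z ↦ lam G z b) y = pd b (fun z ↦ lam G z a) y := by
  obtain ⟨τ, hτ⟩ := hG.ricci_weylConn (Υ := lam G) (fun z hz c ↦ hG.smooth_lam hz (hC z hz) c) hy
  have hs : ∑ e, christoffel G y e b a * lam G y e = ∑ e, christoffel G y e a b * lam G y e :=
    Finset.sum_congr rfl fun e _ ↦ by rw [hG.christoffel_comm hy]
  rw [cConn_eq_weylConn, hτ, hτ, hG.ricci_comm hy b a, hG.apply_comm hy b a, hs] at h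
  have h3 : (3 : ℝ) ≤ D := by exact_mod_cast hD
  have : (D : ℝ) * (pd a (fun z ↦ lam G z b) y - pd b (fun z ↦ lam G z a) y) = 0 := by linarith
  rcases mul_eq_zero.1 this with h | h <;> linarith

end IsMetricOn

/-! ### Coordinate changes -/

/-- The Jacobian matrix `∂_a φ^i` (row index `i`, column index `a`). -/
def jac (φ : Coord D → Coord D) (y : Coord D) : Matrix (Fin D) (Fin D) ℝ :=
  Matrix.of fun i a ↦ pd a (fun z ↦ φ z i) y

theorem contDiffAt_coord {φ : Coord D → Coord D} {y : Coord D} (hφ : ContDiffAt ℝ ∞ φ y)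
    (i : Fin D) : ContDiffAt ℝ ∞ (fun z ↦ φ z i) y :=
  (contDiffAt_piLp _).1 hφ i

theorem jac_eq_fderiv {φ : Coord D → Coord D} {y : Coord D} (hφ : DifferentiableAt ℝ φ y)
    (i a : Fin D) : jac φ y i a = fderiv ℝ φ y (EuclideanSpace.single a 1) i := by
  have h : HasFDerivAt (fun z ↦ φ z i)
      ((PiLp.proj 2 (fun _ : Fin D ↦ ℝ) i : Coord D →L[ℝ] ℝ).comp (fderiv ℝ φ y)) y :=
    (PiLp.proj 2 (fun _ : Fin D ↦ ℝ) i : Coord D →L[ℝ] ℝ).hasFDerivAt.comp y hφ.hasFDerivAt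
  rw [jac, Matrix.of_apply, pd, h.fderiv]
  rfl

theorem sum_smul_single (v : Coord D) : ∑ i, v i • EuclideanSpace.single i (1 : ℝ) = v := by
  ext j
  simp [Pi.single_apply]

/-- The chain rule for partial derivatives. -/
theorem pd_comp {φ : Coord D → Coord D} {F : Coord D → ℝ} {y : Coord D}
    (hφ : DifferentiableAt ℝ φ y) (hF : DifferentiableAt ℝ F (φ y)) (a : Fin D) :
    pd a (fun z ↦ F (φ z)) y = ∑ i, jac φ y i a * pd i F (φ y) := by
  have h : fderiv ℝ (fun z ↦ F (φ z)) y = (fderiv ℝ F (φ y)).comp (fderiv ℝ φ y) :=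
    fderiv_comp y hF hφ
  rw [pd, h, ContinuousLinearMap.comp_apply,
    ← sum_smul_single (fderiv ℝ φ y (EuclideanSpace.single a 1)), map_sum]
  refine Finset.sum_congr rfl fun i _ ↦ ?_
  rw [map_smul, smul_eq_mul, jac_eq_fderiv hφ, pd]

theorem smooth_jac {φ : Coord D → Coord D} {y : Coord D} (hφ : ContDiffAt ℝ ∞ φ y) :
    MSmooth (jac φ) y :=
  fun i a ↦ contDiffAt_pd (contDiffAt_coord hφ i) a

theorem mpd_jac_comm {φ : Coord D → Coord D} {y : Coord D} (hφ : ContDiffAt ℝ ∞ φ y)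
    (a b i : Fin D) : mpd a (jac φ) y i b = mpd b (jac φ) y i a :=
  pd_comm (contDiffAt_coord hφ i) a b

theorem MSmooth.comp {φ : Coord D → Coord D} {y : Coord D} (hφ : ContDiffAt ℝ ∞ φ y)
    {F : Coord D → Matrix (Fin D) (Fin D) ℝ} (hF : MSmooth F (φ y)) :
    MSmooth (fun z ↦ F (φ z)) y :=
  fun i j ↦ (hF i j).comp y hφ

theorem mpd_comp {φ : Coord D → Coord D} {y : Coord D} (hφ : ContDiffAt ℝ ∞ φ y)
    {F : Coord D → Matrix (Fin D) (Fin D) ℝ} (hF : MSmooth F (φ y)) (a : Fin D) :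
    mpd a (fun z ↦ F (φ z)) y = ∑ i, jac φ y i a • mpd i F (φ y) := by
  ext k l
  simp only [mpd, Matrix.of_apply, Matrix.sum_apply, Matrix.smul_apply, smul_eq_mul]
  exact pd_comp (hφ.differentiableAt (by simp)) (hF.diff k l) a

/-- The pullback `Σ_i (∂_a φ^i) A_i ∘ φ` of the connection matrices. -/
def pullConn (G : Coord D → Matrix (Fin D) (Fin D) ℝ) (φ : Coord D → Coord D) (a : Fin D)
    (y : Coord D) : Matrix (Fin D) (Fin D) ℝ :=
  ∑ i, jac φ y i a • connMat (christoffel G) i (φ y)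

/-- `φ` is a smooth coordinate change from `T` to `S` with invertible Jacobian, and `G'` is the
metric `G` in the new coordinates. -/
structure IsCoordChange (G : Coord D → Matrix (Fin D) (Fin D) ℝ) (S : Set (Coord D))
    (G' : Coord D → Matrix (Fin D) (Fin D) ℝ) (T : Set (Coord D)) (φ : Coord D → Coord D) :
    Prop where
  metric : IsMetricOn G S
  metric' : IsMetricOn G' T
  mapsTo : ∀ y ∈ T, φ y ∈ S
  smooth : ∀ y ∈ T, ContDiffAt ℝ ∞ φ y
  det : ∀ y ∈ T, IsUnit (jac φ y).det
  eq : ∀ y ∈ T, G' y = (jac φ y)ᵀ * G (φ y) * jac φ y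

namespace IsCoordChange

variable {G G' : Coord D → Matrix (Fin D) (Fin D) ℝ} {S T : Set (Coord D)}
  {φ : Coord D → Coord D} {y : Coord D}

theorem smooth_conn (h : IsCoordChange G S G' T φ) (hy : y ∈ T) (i : Fin D) :
    MSmooth (fun z ↦ connMat (christoffel G) i (φ z)) y :=
  MSmooth.comp (h.smooth y hy) (h.metric.smooth_connMat (h.mapsTo y hy) i)

theorem smooth_pullConn (h : IsCoordChange G S G' T φ) (hy : y ∈ T) (a : Fin D) :
    MSmooth (pullConn G φ a) y :=
  MSmooth.sum fun i _ ↦ MSmooth.smul (smooth_jac (h.smooth y hy) i a) (h.smooth_conn hy i)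

/-- The transformation law of the Christoffel symbols, in the form of a gauge transformation. -/
theorem jac_mul_connMat (h : IsCoordChange G S G' T φ) (hy : y ∈ T) (a : Fin D) :
    jac φ y * connMat (christoffel G') a y = pullConn G φ a y * jac φ y + mpd a (jac φ) y := by
  have hG := h.metric
  have hφ := h.smooth y hy
  have hS := h.mapsTo y hy
  have hJ := smooth_jac hφ
  set J := jac φ y with hJdef
  have hinv : J * J⁻¹ = 1 := Matrix.mul_nonsing_inv _ (h.det y hy)
  set X : Fin D → Matrix (Fin D) (Fin D) ℝ :=
    fun a ↦ pullConn G φ a y * J + mpd a (jac φ) y with hX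
  have hJX : ∀ a, J * (J⁻¹ * X a) = X a := fun a ↦ by
    rw [← Matrix.mul_assoc, hinv, Matrix.one_mul]
  have hXs : ∀ a k c, X a k c = X c k a := by
    intro a k c
    simp only [hX, Matrix.add_apply]
    rw [mpd_jac_comm hφ a c k]
    congr 1
    simp only [pullConn, Matrix.mul_apply, Matrix.sum_apply, Matrix.smul_apply, smul_eq_mul,
      Finset.sum_mul]
    rw [Finset.sum_comm]
    refine Finset.sum_congr rfl fun i _ ↦ Finset.sum_congr rfl fun j _ ↦ ?_
    rw [hG.connMat_comm hS i k j]
    ring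
  have hGbar : ∀ a, mpd a (fun z ↦ G (φ z)) y = (pullConn G φ a y)ᵀ * G (φ y)
      + G (φ y) * pullConn G φ a y := by
    intro a
    rw [mpd_comp hφ (hG.smooth _ hS)]
    simp only [hG.mpd_eq hS, pullConn, Matrix.transpose_sum, Matrix.transpose_smul,
      Finset.sum_mul, Finset.mul_sum, smul_add, Finset.sum_add_distrib, Matrix.smul_mul,
      Matrix.mul_smul]
  have key := h.metric'.christoffel_unique hy (A := fun a ↦ J⁻¹ * X a) (fun a d c ↦ by
      simp only [Matrix.mul_apply]
      exact Finset.sum_congr rfl fun k _ ↦ by rw [hXs]) (fun a ↦ by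
      have hG' : mpd a G' y = mpd a (fun z ↦ (jac φ z)ᵀ * G (φ z) * jac φ z) y :=
        mpd_congr (eventually_of_mem (h.metric'.mem_nhds hy) h.eq) a
      have e1 : (J⁻¹ * X a)ᵀ * (Jᵀ * G (φ y) * J) = (X a)ᵀ * G (φ y) * J := by
        rw [← hJX a, Matrix.transpose_mul J, hJX]
        simp only [Matrix.mul_assoc]
      have e2 : Jᵀ * G (φ y) * J * (J⁻¹ * X a) = Jᵀ * G (φ y) * X a := by
        rw [Matrix.mul_assoc, hJX]
      rw [hG', mpd_mul (hJ.transpose.mul (MSmooth.comp hφ (hG.smooth _ hS))) hJ,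
        mpd_mul hJ.transpose (MSmooth.comp hφ (hG.smooth _ hS)), mpd_transpose, hGbar,
        h.eq y hy, e1, e2]
      simp only [hX, Matrix.transpose_add, Matrix.transpose_mul, ← hJdef]
      noncomm_ring)
  rw [key a, hJX]

/-- The derivative of the pulled-back connection matrices. The first sum, which contains second
derivatives of the coordinate change, is symmetric in `a` and `b`, so that it drops out of the
curvature. -/
theorem mpd_pullConn (h : IsCoordChange G S G' T φ) (hy : y ∈ T) (a b : Fin D) :
    mpd b (pullConn G φ a) y = ∑ i, mpd b (jac φ) y i a • connMat (christoffel G) i (φ y)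
      + ∑ i, ∑ j, (jac φ y i a * jac φ y j b) • mpd j (connMat (christoffel G) i) (φ y) := by
  have hφ := h.smooth y hy
  have hJ := smooth_jac hφ
  have h1 : mpd b (pullConn G φ a) y
      = ∑ i, mpd b (fun z ↦ jac φ z i a • connMat (christoffel G) i (φ z)) y :=
    mpd_sum (F := fun i z ↦ jac φ z i a • connMat (christoffel G) i (φ z))
      (fun i _ ↦ MSmooth.smul (hJ i a) (h.smooth_conn hy i)) b
  rw [h1, ← Finset.sum_add_distrib]
  refine Finset.sum_congr rfl fun i _ ↦ ?_
  rw [mpd_smul (hJ i a) (h.smooth_conn hy i),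
    mpd_comp hφ (h.metric.smooth_connMat (h.mapsTo y hy) i), Finset.smul_sum]
  simp only [smul_smul]
  rfl

/-- The curvature is a tensor. -/
theorem jac_mul_curvMat (h : IsCoordChange G S G' T φ) (hy : y ∈ T) (a b : Fin D) :
    jac φ y * curvMat (christoffel G') a b y
      = (∑ i, ∑ j, (jac φ y i a * jac φ y j b) • curvMat (christoffel G) i j (φ y))
        * jac φ y := by
  have hφ := h.smooth y hy
  have hJ := smooth_jac hφ
  -- differentiate the transformation law of the connection
  have hd : ∀ a b, jac φ y * mpd b (connMat (christoffel G') a) y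
      = mpd b (pullConn G φ a) y * jac φ y + pullConn G φ a y * mpd b (jac φ) y
        + mpd b (mpd a (jac φ)) y - mpd b (jac φ) y * connMat (christoffel G') a y := by
    intro a b
    have h1 := mpd_congr (F := fun z ↦ jac φ z * connMat (christoffel G') a z)
      (H := fun z ↦ pullConn G φ a z * jac φ z + mpd a (jac φ) z)
      (eventually_of_mem (h.metric'.mem_nhds hy) fun z hz ↦ h.jac_mul_connMat hz a) b
    rw [mpd_mul hJ (h.metric'.smooth_connMat hy a),
      mpd_add ((h.smooth_pullConn hy a).mul hJ) (hJ.mpd a),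
      mpd_mul (h.smooth_pullConn hy a) hJ] at h1
    rw [← h1]
    abel
  have hbar : mpd b (pullConn G φ a) y - mpd a (pullConn G φ b) y
      + pullConn G φ b y * pullConn G φ a y - pullConn G φ a y * pullConn G φ b y
      = ∑ i, ∑ j, (jac φ y i a * jac φ y j b) • curvMat (christoffel G) i j (φ y) := by
    have hsw : ∀ X : Fin D → Fin D → Matrix (Fin D) (Fin D) ℝ,
        ∑ i, ∑ j, (jac φ y i b * jac φ y j a) • X i j
          = ∑ i, ∑ j, (jac φ y i a * jac φ y j b) • X j i := by
      intro X
      rw [Finset.sum_comm]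
      exact Finset.sum_congr rfl fun i _ ↦ Finset.sum_congr rfl fun j _ ↦ by rw [mul_comm]
    have hp : ∀ a b, pullConn G φ a y * pullConn G φ b y
        = ∑ i, ∑ j, (jac φ y i a * jac φ y j b) •
          (connMat (christoffel G) i (φ y) * connMat (christoffel G) j (φ y)) := by
      intro a b
      simp only [pullConn, Finset.sum_mul_sum, Matrix.smul_mul, Matrix.mul_smul, smul_smul]
      exact Finset.sum_congr rfl fun i _ ↦ Finset.sum_congr rfl fun j _ ↦ by rw [mul_comm]
    have hj : ∀ i, mpd a (jac φ) y i b = mpd b (jac φ) y i a := fun i ↦ mpd_jac_comm hφ a b i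
    rw [h.mpd_pullConn hy a b, h.mpd_pullConn hy b a, hp, hp,
      hsw fun i j ↦ mpd j (connMat (christoffel G) i) (φ y),
      hsw fun i j ↦ connMat (christoffel G) i (φ y) * connMat (christoffel G) j (φ y)]
    simp only [hj, curvMat_eq, smul_add, smul_sub, Finset.sum_add_distrib, Finset.sum_sub_distrib]
    abel
  have hc := h.jac_mul_connMat hy
  have hq : ∀ a b, jac φ y * (connMat (christoffel G') b y * connMat (christoffel G') a y)
      = pullConn G φ b y * (pullConn G φ a y * jac φ y + mpd a (jac φ) y)
        + mpd b (jac φ) y * connMat (christoffel G') a y := by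
    intro a b
    rw [← Matrix.mul_assoc, hc b, Matrix.add_mul, Matrix.mul_assoc, hc a]
  rw [← hbar, curvMat_eq, Matrix.mul_sub, Matrix.mul_add, Matrix.mul_sub, hd a b, hd b a, hq, hq,
    mpd_comm hJ b a]
  noncomm_ring

/-- The Ricci tensor of a metric is a tensor. -/
theorem ricci_eq (h : IsCoordChange G S G' T φ) (hy : y ∈ T) (a c : Fin D) :
    ricci (christoffel G') y a c
      = ∑ i, ∑ l, jac φ y i a * jac φ y l c * ricci (christoffel G) (φ y) i l := by
  have hinv : (jac φ y)⁻¹ * jac φ y = 1 := Matrix.nonsing_inv_mul _ (h.det y hy)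
  have hinv' : jac φ y * (jac φ y)⁻¹ = 1 := Matrix.mul_nonsing_inv _ (h.det y hy)
  have hR : ∀ b, curvMat (christoffel G') a b y = (jac φ y)⁻¹ *
      ((∑ i, ∑ j, (jac φ y i a * jac φ y j b) • curvMat (christoffel G) i j (φ y))
        * jac φ y) := by
    intro b
    rw [← h.jac_mul_curvMat hy, ← Matrix.mul_assoc, hinv, Matrix.one_mul]
  have hk : ∀ j k, ∑ b, jac φ y j b * (jac φ y)⁻¹ b k = kron j k := by
    intro j k
    rw [kron_eq_one_apply, ← hinv', Matrix.mul_apply]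
  calc ricci (christoffel G') y a c = ∑ b, (curvMat (christoffel G') a b y) b c := rfl
    _ = ∑ b, ∑ k, ∑ l, ∑ i, ∑ j, (jac φ y j b * (jac φ y)⁻¹ b k) *
        (jac φ y i a * jac φ y l c * curvature (christoffel G) (φ y) i j l k) := by
        refine Finset.sum_congr rfl fun b _ ↦ ?_
        rw [hR, Matrix.mul_apply]
        refine Finset.sum_congr rfl fun k _ ↦ ?_
        rw [Matrix.mul_apply, Finset.mul_sum]
        refine Finset.sum_congr rfl fun l _ ↦ ?_
        simp only [Matrix.sum_apply, Matrix.smul_apply, smul_eq_mul, Finset.sum_mul,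
          Finset.mul_sum, curvMat, Matrix.of_apply]
        exact Finset.sum_congr rfl fun i _ ↦ Finset.sum_congr rfl fun j _ ↦ by ring
    _ = ∑ k, ∑ l, ∑ i, ∑ j, ∑ b, (jac φ y j b * (jac φ y)⁻¹ b k) *
        (jac φ y i a * jac φ y l c * curvature (christoffel G) (φ y) i j l k) := by
        rw [Finset.sum_comm]
        refine Finset.sum_congr rfl fun k _ ↦ ?_
        rw [Finset.sum_comm]
        refine Finset.sum_congr rfl fun l _ ↦ ?_
        rw [Finset.sum_comm]
        exact Finset.sum_congr rfl fun i _ ↦ Finset.sum_comm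
    _ = ∑ k, ∑ l, ∑ i, jac φ y i a * jac φ y l c * curvature (christoffel G) (φ y) i k l k := by
        refine Finset.sum_congr rfl fun k _ ↦ Finset.sum_congr rfl fun l _ ↦
          Finset.sum_congr rfl fun i _ ↦ ?_
        simp only [← Finset.sum_mul, hk]
        exact sum_kron_mul' k
          (fun j ↦ jac φ y i a * jac φ y l c * curvature (christoffel G) (φ y) i j l k)
    _ = ∑ i, ∑ l, ∑ k, jac φ y i a * jac φ y l c *
          curvature (christoffel G) (φ y) i k l k := by
        rw [Finset.sum_comm]
        calc _ = ∑ l, ∑ i, ∑ k, jac φ y i a * jac φ y l c *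
              curvature (christoffel G) (φ y) i k l k :=
              Finset.sum_congr rfl fun l _ ↦ Finset.sum_comm
          _ = _ := Finset.sum_comm
    _ = _ := by simp only [ricci, Finset.mul_sum]

/-- The Einstein condition is invariant under coordinate changes. -/
theorem einstein (h : IsCoordChange G S G' T φ) {μ : ℝ}
    (hE : ∀ x ∈ S, ∀ a b, ricci (christoffel G) x a b = μ * G x a b) (hy : y ∈ T) (a b : Fin D) :
    ricci (christoffel G') y a b = μ * G' y a b := by
  rw [h.ricci_eq hy, h.eq y hy, Matrix.mul_apply, Finset.mul_sum, Finset.sum_comm]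
  refine Finset.sum_congr rfl fun l _ ↦ ?_
  rw [Matrix.mul_apply, Finset.sum_mul, Finset.mul_sum]
  refine Finset.sum_congr rfl fun i _ ↦ ?_
  rw [hE _ (h.mapsTo y hy), Matrix.transpose_apply]
  ring

end IsCoordChange

/-! ### The Poincaré lemma and the Einstein metric on a coordinate ball -/

/-- The Poincaré lemma for 1-forms on a convex open set, in components. -/
theorem exists_pd_eq {S : Set (Coord D)} (hS : IsOpen S) (hconv : Convex ℝ S)
    {θ : Coord D → Fin D → ℝ} (hθ : ∀ y ∈ S, ∀ a, ContDiffAt ℝ ∞ (fun z ↦ θ z a) y)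
    (hcl : ∀ y ∈ S, ∀ a b, pd a (fun z ↦ θ z b) y = pd b (fun z ↦ θ z a) y) :
    ∃ f : Coord D → ℝ, (∀ y ∈ S, ContDiffAt ℝ ∞ f y) ∧ ∀ y ∈ S, ∀ a, pd a f y = θ y a := by
  set P : Fin D → Coord D →L[ℝ] ℝ := fun a ↦ PiLp.proj 2 (fun _ : Fin D ↦ ℝ) a with hP
  set W : Coord D → Coord D →L[ℝ] ℝ := fun z ↦ ∑ a, θ z a • P a with hW
  have hWs : ∀ y ∈ S, ContDiffAt ℝ ∞ W y := fun y hy ↦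
    ContDiffAt.sum fun a _ ↦ (hθ y hy a).smul contDiffAt_const
  have hexp : ∀ (f : Coord D → ℝ) (y x : Coord D), fderiv ℝ f y x = ∑ b, x b * pd b f y := by
    intro f y x
    conv_lhs => rw [← sum_smul_single x, map_sum]
    exact Finset.sum_congr rfl fun b _ ↦ by rw [map_smul, smul_eq_mul, pd]
  have hWd : ∀ y ∈ S, ∀ x v, fderiv ℝ W y x v = ∑ a, ∑ b, x b * v a * pd b (fun z ↦ θ z a) y := by
    intro y hy x v
    have h1 : HasFDerivAt W (∑ a, (fderiv ℝ (fun z ↦ θ z a) y).smulRight (P a)) y :=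
      HasFDerivAt.fun_sum fun a _ ↦
        (differentiableAt_of_contDiffAt_top (hθ y hy a)).hasFDerivAt.smul_const (P a)
    rw [h1.fderiv]
    simp only [_root_.sum_apply, ContinuousLinearMap.smulRight_apply,
      _root_.smul_apply, smul_eq_mul, hexp, Finset.sum_mul, hP]
    exact Finset.sum_congr rfl fun a _ ↦ Finset.sum_congr rfl fun b _ ↦ by
      rw [PiLp.proj_apply]; ring
  have hWdiff : DifferentiableOn ℝ W S := fun y hy ↦
    ((hWs y hy).differentiableAt (by simp)).differentiableWithinAt
  obtain ⟨f, hf⟩ := hconv.exists_forall_hasFDerivAt_of_fderiv_symmetric hS hWdiff (by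
      intro y hy x v
      rw [hWd y hy, hWd y hy, Finset.sum_comm]
      exact Finset.sum_congr rfl fun a _ ↦ Finset.sum_congr rfl fun b _ ↦ by
        rw [hcl y hy a b]; ring)
  have hfs : ContDiffOn ℝ ∞ f S := by
    rw [contDiffOn_infty_iff_fderiv_of_isOpen hS]
    refine ⟨fun y hy ↦ (hf y hy).differentiableAt.differentiableWithinAt, ?_⟩
    exact ContDiffOn.congr (fun y hy ↦ (hWs y hy).contDiffWithinAt) fun y hy ↦ (hf y hy).fderiv
  refine ⟨f, fun y hy ↦ hfs.contDiffAt (hS.mem_nhds hy), fun y hy a ↦ ?_⟩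
  rw [pd, (hf y hy).fderiv]
  simp [hW, hP]

namespace IsMetricOn

variable {G : Coord D → Matrix (Fin D) (Fin D) ℝ} {S : Set (Coord D)}

theorem sum_inv_mul_self (hG : IsMetricOn G S) {y : Coord D} (hy : y ∈ S) :
    ∑ a, ∑ c, (G y)⁻¹ a c * G y a c = D := by
  have : ∀ e, ∑ p, (G y)⁻¹ e p * G y e p = 1 := by
    intro e
    rw [Finset.sum_congr rfl fun p _ ↦ by rw [hG.apply_comm hy e p], hG.sum_inv_mul hy]
    simp [kron]
  simp [this]

theorem scalarCurv_of_ricci (hG : IsMetricOn G S) {y : Coord D} (hy : y ∈ S)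
    {K : Coord D → Fin D → Fin D → Fin D → ℝ} {t : ℝ} (h : ∀ a b, ricci K y a b = t * G y a b) :
    scalarCurv G K y = D * t := by
  rw [← hG.sum_inv_mul_self hy, scalarCurv, Finset.sum_mul]
  refine Finset.sum_congr rfl fun a _ ↦ ?_
  rw [Finset.sum_mul]
  exact Finset.sum_congr rfl fun c _ ↦ by rw [h]; ring

/-- On a convex coordinate domain, if the Ricci tensor of the `𝒞`-connection is pure trace, then
the metric is conformal to an Einstein metric. -/
theorem exists_einstein_confMetric (hD : 3 ≤ D) (hG : IsMetricOn G S) (hconv : Convex ℝ S)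
    (hC : ∀ y ∈ S, IsUnit (weylEnd G y)) {t : Coord D → ℝ}
    (hR : ∀ y ∈ S, ∀ a b, ricci (cConn G) y a b = t y * G y a b) :
    ∃ f : Coord D → ℝ, (∀ y ∈ S, ContDiffAt ℝ ∞ f y) ∧ ∃ μ : ℝ, ∀ y ∈ S, ∀ a b,
      ricci (christoffel (ConfEinstein.confMetric G f)) y a b
        = μ * ConfEinstein.confMetric G f y a b := by
  obtain ⟨f, hf, hfl⟩ := exists_pd_eq hG.isOpen hconv (θ := lam G)
    (fun y hy a ↦ hG.smooth_lam hy (hC y hy) a) (fun y hy a b ↦ hG.lam_closed hD hC hy (by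
      rw [hR y hy, hR y hy, hG.apply_comm hy]))
  refine ⟨f, hf, ?_⟩
  have hG' := hG.confMetric hf
  set G' := ConfEinstein.confMetric G f with hG'def
  set ρ : Coord D → ℝ := fun z ↦ (1 / (D : ℝ)) * scalarCurv G' (christoffel G') z with hρ
  have hDne : (D : ℝ) ≠ 0 := by
    have : (3 : ℝ) ≤ D := by exact_mod_cast hD
    linarith
  have h1 : ∀ y ∈ S, ∀ a b, ricci (christoffel G') y a b = ρ y * G' y a b := by
    intro y hy
    have hK : christoffel G' =ᶠ[𝓝 y] cConn G := by
      refine eventually_of_mem (hG.mem_nhds hy) fun z hz ↦ ?_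
      rw [hG'def, hG.christoffel_confMetric hf hz, cConn_eq_weylConn]
      funext c a b
      simp only [weylConn, hfl z hz]
    have h2 : ∀ a b, ricci (christoffel G') y a b
        = (t y * Real.exp (2 * f y)) * G' y a b := by
      intro a b
      have he : Real.exp (2 * f y) * Real.exp (-2 * f y) = 1 := by
        rw [← Real.exp_add]
        simp
      rw [ricci_congr hK, hR y hy, hG'def, ConfEinstein.confMetric, Matrix.smul_apply,
        smul_eq_mul]
      linear_combination (-(t y * G y a b)) * he
    intro a b
    rw [h2, hρ]
    simp only
    rw [hG'.scalarCurv_of_ricci hy h2]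
    field_simp
  have hρs : ∀ y ∈ S, ContDiffAt ℝ ∞ ρ y := fun y hy ↦
    contDiffAt_const.mul (hG'.smooth_scalarCurv hy)
  have hρ0 : ∀ y ∈ S, fderiv ℝ ρ y = 0 := by
    intro y hy
    ext x
    have hs := hG'.schur hD hρs (fun z hz ↦ by
      ext a b
      exact h1 z hz a b) hy
    conv_lhs => rw [← sum_smul_single x, map_sum]
    refine Finset.sum_eq_zero fun b _ ↦ ?_
    rw [map_smul, ← pd, hs b, smul_zero]
  rcases S.eq_empty_or_nonempty with h | ⟨y₀, hy₀⟩
  · exact ⟨0, fun y hy ↦ by simp [h] at hy⟩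
  · refine ⟨ρ y₀, fun y hy a b ↦ ?_⟩
    rw [h1 y hy, hG.isOpen.is_const_of_fderiv_eq_zero hconv.isPreconnected
      (fun z hz ↦ (differentiableAt_of_contDiffAt_top (hρs z hz)).differentiableWithinAt)
      (fun z hz ↦ hρ0 z hz) hy hy₀]

end IsMetricOn

theorem christoffel_congr {G G' : Coord D → Matrix (Fin D) (Fin D) ℝ} {y : Coord D}
    (h : G =ᶠ[𝓝 y] G') : christoffel G =ᶠ[𝓝 y] christoffel G' := by
  filter_upwards [h.eventuallyEq_nhds] with z hz
  have hp : ∀ c a b, pd c (fun w ↦ G w a b) z = pd c (fun w ↦ G' w a b) z := fun c a b ↦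
    pd_congr (hz.mono fun w hw ↦ by simp only [hw]) c
  funext c a b
  simp only [christoffel, hp, hz.self_of_nhds]

/-! ### Components of a metric on a manifold -/

section Manifold

variable {M : Type*} [TopologicalSpace M] [ChartedSpace (Coord D) M]
  {g : BilinField D M} {e e₀ : OpenPartialHomeomorph M (Coord D)} {U : Set M} {y : Coord D}

theorem mdifferentiable_of_mem (he : e ∈ IsManifold.maximalAtlas (𝓡 D) ∞ M) :
    e.MDifferentiable (𝓡 D) (𝓡 D) :=
  ⟨(contMDiffOn_of_mem_maximalAtlas he).mdifferentiableOn (by simp),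
    (contMDiffOn_symm_of_mem_maximalAtlas he).mdifferentiableOn (by simp)⟩

/-- The coordinate vector fields are smooth. -/
theorem contMDiffAt_coordVec [IsManifold (𝓡 D) ∞ M]
    (he : e ∈ IsManifold.maximalAtlas (𝓡 D) ∞ M) (hy : y ∈ e.target) (a : Fin D) :
    ContMDiffAt (𝓡 D) ((𝓡 D).prod (𝓡 D)) ∞
      (fun z ↦ Bundle.TotalSpace.mk' (Coord D) (E := fun x : M ↦ TangentSpace (𝓡 D) x)
        (e.symm z) (coordVec e z a)) y := by
  have : IsManifold (𝓡 D) 1 M := IsManifold.of_le (n := ∞) (by simp)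
  have h1 := (contMDiffOn_symm_of_mem_maximalAtlas he).contMDiffOn_tangentMapWithin (m := ∞)
    (by simp) e.open_target.uniqueMDiffOn
  have h2 : ContMDiff (𝓡 D) ((𝓡 D).prod (𝓡 D)) ∞
      (fun z : Coord D ↦ Bundle.TotalSpace.mk' (Coord D)
        (E := fun x : Coord D ↦ TangentSpace (𝓡 D) x) z
        (EuclideanSpace.single a (1 : ℝ) : Coord D)) := by
    intro z
    exact contMDiffAt_vectorSpace_iff_contDiffAt.2 contDiffAt_const
  have h3 := (h1 ⟨y, (EuclideanSpace.single a (1 : ℝ) : Coord D)⟩ hy).comp y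
    (h2 y).contMDiffWithinAt (s := e.target) (fun z hz ↦ hz)
  refine (h3.congr_of_eventuallyEq_of_mem ?_ hy).contMDiffAt (e.open_target.mem_nhds hy)
  filter_upwards [self_mem_nhdsWithin] with z hz
  simp only [Function.comp, tangentMapWithin, coordVec]
  rw [mfderivWithin_of_isOpen e.open_target hz]

theorem contDiffAt_comp [IsManifold (𝓡 D) ∞ M] (hg : IsPseudoRiemannianOn g U)
    (he : e ∈ IsManifold.maximalAtlas (𝓡 D) ∞ M) (hy : y ∈ e.target) (hU : U ∈ 𝓝 (e.symm y))
    (a b : Fin D) : ContDiffAt ℝ ∞ (fun z ↦ comp g e z a b) y := by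
  have h1 : ContMDiffAt (𝓡 D) ((𝓡 D).prod 𝓘(ℝ)) ∞
      (fun z ↦ Bundle.TotalSpace.mk' ℝ (E := Bundle.Trivial M ℝ) (e.symm z)
        (g (e.symm z) (coordVec e z a) (coordVec e z b))) y := by
    apply ContMDiffAt.clm_bundle_apply₂ (F₁ := Coord D) (F₂ := Coord D)
    · exact (hg.smooth.contMDiffAt hU).comp y
        ((contMDiffOn_symm_of_mem_maximalAtlas he).contMDiffAt (e.open_target.mem_nhds hy))
    · exact contMDiffAt_coordVec he hy a
    · exact contMDiffAt_coordVec he hy b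
  rw [Bundle.contMDiffAt_totalSpace] at h1
  exact contMDiffAt_iff_contDiffAt.1 h1.2

theorem mfderiv_symm_apply (e : OpenPartialHomeomorph M (Coord D)) (y v : Coord D) :
    mfderiv (𝓡 D) (𝓡 D) e.symm y v = ∑ a, v a • coordVec e y a := by
  conv_lhs => rw [← sum_smul_single v]
  exact (map_sum (mfderiv (𝓡 D) (𝓡 D) e.symm y) _ _).trans
    (Finset.sum_congr rfl fun a _ ↦ map_smul (mfderiv (𝓡 D) (𝓡 D) e.symm y) _ _)

/-- The values of a bilinear form on linear combinations. -/
theorem bilin_sum_smul {ι κ E : Type*} [Fintype ι] [Fintype κ] [NormedAddCommGroup E]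
    [NormedSpace ℝ E] (B : E →L[ℝ] E →L[ℝ] ℝ) (p : ι → ℝ) (v : ι → E) (q : κ → ℝ) (w : κ → E) :
    B (∑ i, p i • v i) (∑ j, q j • w j) = ∑ j, (∑ i, p i * B (v i) (w j)) * q j := by
  rw [map_sum]
  refine Finset.sum_congr rfl fun j _ ↦ ?_
  rw [map_smul, smul_eq_mul, mul_comm, map_sum, _root_.sum_apply]
  refine congrArg (· * _) (Finset.sum_congr rfl fun i _ ↦ ?_)
  rw [map_smul, _root_.smul_apply, smul_eq_mul]

theorem isMetricOn_comp [IsManifold (𝓡 D) ∞ M] (hg : IsPseudoRiemannianOn g U)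
    (he : e ∈ IsManifold.maximalAtlas (𝓡 D) ∞ M) {T : Set (Coord D)} (hT : IsOpen T)
    (hTe : T ⊆ e.target) (hTU : ∀ y ∈ T, U ∈ 𝓝 (e.symm y)) : IsMetricOn (comp g e) T where
  isOpen := hT
  smooth y hy a b := contDiffAt_comp hg he (hTe hy) (hTU y hy) a b
  symm y hy := by
    ext a b
    exact hg.symm _ (mem_of_mem_nhds (hTU y hy)) _ _
  det y hy := by
    have hx := mem_of_mem_nhds (hTU y hy)
    have hbij := (mdifferentiable_of_mem he).symm.mfderiv_bijective (hTe hy)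
    rw [isUnit_iff_ne_zero]
    intro h0
    obtain ⟨c, hc, hc0⟩ := Matrix.exists_mulVec_eq_zero_iff.2 h0
    have hw : ∑ b, c b • coordVec e y b = 0 := by
      refine hg.nondegenerate _ hx _ fun u ↦ ?_
      obtain ⟨v, rfl⟩ : ∃ v : Coord D, mfderiv (𝓡 D) (𝓡 D) e.symm y v = u := hbij.2 u
      have h1 : g (e.symm y) (mfderiv (𝓡 D) (𝓡 D) e.symm y v) (∑ b, c b • coordVec e y b)
          = ∑ a, v a * ∑ b, comp g e y a b * c b := by
        rw [mfderiv_symm_apply]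
        refine (bilin_sum_smul (E := Coord D) (g (e.symm y)) _ _ _ _).trans ?_
        simp only [Finset.sum_mul, Finset.mul_sum]
        rw [Finset.sum_comm]
        refine Finset.sum_congr rfl fun a _ ↦ Finset.sum_congr rfl fun b _ ↦ ?_
        exact mul_assoc _ _ _
      have h2 : ∀ a, ∑ b, comp g e y a b * c b = 0 := fun a ↦ congrFun hc0 a
      rw [hg.symm _ hx]
      refine h1.trans ?_
      simp only [h2, mul_zero, Finset.sum_const_zero]
    have h3 : mfderiv (𝓡 D) (𝓡 D) e.symm y (WithLp.toLp 2 c) = 0 := by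
      rw [mfderiv_symm_apply]
      exact hw
    have h4 : (WithLp.toLp 2 c : Coord D) = 0 := hbij.1 (h3.trans (map_zero _).symm)
    exact hc (by
      funext a
      exact congrFun (congrArg WithLp.ofLp h4) a)

/-- The transition map from the chart `e` to the chart `e₀`. -/
def transition (e e₀ : OpenPartialHomeomorph M (Coord D)) (y : Coord D) : Coord D :=
  e₀ (e.symm y)

theorem contDiffAt_transition (he : e ∈ IsManifold.maximalAtlas (𝓡 D) ∞ M)
    (he₀ : e₀ ∈ IsManifold.maximalAtlas (𝓡 D) ∞ M) (hy : y ∈ e.target)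
    (hy₀ : e.symm y ∈ e₀.source) : ContDiffAt ℝ ∞ (transition e e₀) y := by
  have h1 := (contMDiffOn_of_mem_maximalAtlas he₀).contMDiffAt (e₀.open_source.mem_nhds hy₀)
  have h2 := (contMDiffOn_symm_of_mem_maximalAtlas he).contMDiffAt (e.open_target.mem_nhds hy)
  exact contMDiffAt_iff_contDiffAt.1 (h1.comp y h2)

theorem coordVec_transition (he : e ∈ IsManifold.maximalAtlas (𝓡 D) ∞ M)
    (he₀ : e₀ ∈ IsManifold.maximalAtlas (𝓡 D) ∞ M) (hy : y ∈ e.target)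
    (hy₀ : e.symm y ∈ e₀.source) (a : Fin D) :
    (coordVec e y a : Coord D)
      = ∑ i, jac (transition e e₀) y i a • (coordVec e₀ (transition e e₀ y) i : Coord D) := by
  have hφ := contDiffAt_transition he he₀ hy hy₀
  have hφd : DifferentiableAt ℝ (transition e e₀) y := hφ.differentiableAt (by simp)
  have hev : e.symm =ᶠ[𝓝 y] e₀.symm ∘ transition e e₀ := by
    have hc : ContinuousAt e.symm y := e.continuousAt_symm hy
    filter_upwards [hc.preimage_mem_nhds (e₀.open_source.mem_nhds hy₀)] with z hz
    exact (e₀.left_inv hz).symm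
  have hm : MDifferentiableAt (𝓡 D) (𝓡 D) e₀.symm (transition e e₀ y) :=
    (mdifferentiable_of_mem he₀).mdifferentiableAt_symm (e₀.map_source hy₀)
  have h1 : (mfderiv (𝓡 D) (𝓡 D) e.symm y : Coord D →L[ℝ] Coord D)
      = (mfderiv (𝓡 D) (𝓡 D) e₀.symm (transition e e₀ y)).comp
        (mfderiv (𝓡 D) (𝓡 D) (transition e e₀) y) :=
    hev.mfderiv_eq.trans (mfderiv_comp y hm hφd.mdifferentiableAt)
  have h2 : (coordVec e y a : Coord D) = mfderiv (𝓡 D) (𝓡 D) e₀.symm (transition e e₀ y)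
      (fderiv ℝ (transition e e₀) y (EuclideanSpace.single a 1)) := by
    have := congrArg (fun L : Coord D →L[ℝ] Coord D ↦ L (EuclideanSpace.single a 1)) h1
    rw [← mfderiv_eq_fderiv]
    exact this
  rw [h2]
  refine (mfderiv_symm_apply e₀ _ _).trans (Finset.sum_congr rfl fun i _ ↦ ?_)
  rw [jac_eq_fderiv hφd]

/-- The transformation law of the components of a metric. -/
theorem comp_transition (g : BilinField D M) (he : e ∈ IsManifold.maximalAtlas (𝓡 D) ∞ M)
    (he₀ : e₀ ∈ IsManifold.maximalAtlas (𝓡 D) ∞ M) (hy : y ∈ e.target)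
    (hy₀ : e.symm y ∈ e₀.source) :
    comp g e y = (jac (transition e e₀) y)ᵀ * comp g e₀ (transition e e₀ y)
      * jac (transition e e₀) y := by
  ext a b
  have hx : e₀.symm (transition e e₀ y) = e.symm y := e₀.left_inv hy₀
  have hg : ∀ i j, comp g e₀ (transition e e₀ y) i j =
      (g (e.symm y) : Coord D →L[ℝ] Coord D →L[ℝ] ℝ) (coordVec e₀ (transition e e₀ y) i)
        (coordVec e₀ (transition e e₀ y) j) := by
    have : ∀ (x x' : M) (v w : Coord D), x = x' →
        (g x : Coord D →L[ℝ] Coord D →L[ℝ] ℝ) v w = (g x' : Coord D →L[ℝ] Coord D →L[ℝ] ℝ) v w := by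
      rintro x _ v w rfl
      rfl
    exact fun i j ↦ this _ _ _ _ hx
  have h1 : comp g e y a b = (g (e.symm y) : Coord D →L[ℝ] Coord D →L[ℝ] ℝ)
      (coordVec e y a : Coord D) (coordVec e y b : Coord D) := rfl
  rw [h1, coordVec_transition he he₀ hy hy₀ a, coordVec_transition he he₀ hy hy₀ b]
  refine (bilin_sum_smul (E := Coord D) (g (e.symm y)) _ _ _ _).trans ?_
  simp only [Matrix.mul_apply, Matrix.transpose_apply, hg]
  rfl

theorem isUnit_det_jac_transition [IsManifold (𝓡 D) ∞ M]
    (he : e ∈ IsManifold.maximalAtlas (𝓡 D) ∞ M)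
    (he₀ : e₀ ∈ IsManifold.maximalAtlas (𝓡 D) ∞ M) (hg : IsPseudoRiemannianOn g U)
    (hy : y ∈ e.target) (hy₀ : e.symm y ∈ e₀.source) (hU : U ∈ 𝓝 (e.symm y)) :
    IsUnit (jac (transition e e₀) y).det := by
  have hc : ContinuousAt e.symm y := e.continuousAt_symm hy
  have hT : e.target ∩ e.symm ⁻¹' interior U ∈ 𝓝 y :=
    inter_mem (e.open_target.mem_nhds hy) (hc.preimage_mem_nhds (interior_mem_nhds.2 hU))
  have hm := isMetricOn_comp hg he (e.isOpen_inter_preimage_symm isOpen_interior)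
    Set.inter_subset_left fun z hz ↦ mem_interior_iff_mem_nhds.1 hz.2
  have hd := hm.det y (mem_of_mem_nhds hT)
  rw [comp_transition g he he₀ hy hy₀, Matrix.det_mul] at hd
  exact isUnit_of_mul_isUnit_right hd

end Manifold

/-! ### Einstein metrics in the conformal class -/

section ConformalClass

variable {M : Type*} [TopologicalSpace M] [ChartedSpace (Coord D) M] {g : BilinField D M}

theorem CRicciCondition.ricci_comm (h : CRicciCondition g)
    {e : OpenPartialHomeomorph M (Coord D)} (he : e ∈ IsManifold.maximalAtlas (𝓡 D) ∞ M)
    {y : Coord D} (hy : y ∈ e.target) (a b : Fin D) :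
    ricci (cConn (comp g e)) y a b = ricci (cConn (comp g e)) y b a := by
  linarith [(h e he y hy a b).1]

theorem CRicciCondition.ricci_eq (h : CRicciCondition g)
    {e : OpenPartialHomeomorph M (Coord D)} (he : e ∈ IsManifold.maximalAtlas (𝓡 D) ∞ M)
    {y : Coord D} (hy : y ∈ e.target) (a b : Fin D) :
    ricci (cConn (comp g e)) y a b
      = 1 / (D : ℝ) * scalarCurv (comp g e) (cConn (comp g e)) y * comp g e y a b := by
  linarith [(h e he y hy a b).2, h.ricci_comm he hy a b]

variable [IsManifold (𝓡 D) ∞ M]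

theorem isMetricOn_comp_target (hg : IsPseudoRiemannianOn g Set.univ)
    {e : OpenPartialHomeomorph M (Coord D)} (he : e ∈ IsManifold.maximalAtlas (𝓡 D) ∞ M) :
    IsMetricOn (comp g e) e.target :=
  isMetricOn_comp hg he e.open_target subset_rfl fun _ _ ↦ univ_mem

/-- A metric conformal to an Einstein metric has a `𝒞`-connection with pure-trace Ricci tensor. -/
theorem exists_ricci_cConn_of_conformal (hD : 3 ≤ D) (hg : IsPseudoRiemannianOn g Set.univ)
    (hC : HasInvertibleWeyl g) {U : Set M} (hUo : IsOpen U) (hU : IsConformallyEinsteinOn g U)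
    {e : OpenPartialHomeomorph M (Coord D)} (he : e ∈ IsManifold.maximalAtlas (𝓡 D) ∞ M)
    {y : Coord D} (hy : y ∈ e.target) (hyU : e.symm y ∈ U) :
    ∃ t : ℝ, ∀ a b, ricci (cConn (comp g e)) y a b = t * comp g e y a b := by
  obtain ⟨g', Ω, hg', ⟨μ, hμ⟩, hΩ, hpos, hconf⟩ := hU
  set T := e.target ∩ e.symm ⁻¹' U with hT
  have hTo : IsOpen T := e.isOpen_inter_preimage_symm hUo
  have hG : IsMetricOn (comp g e) T :=
    isMetricOn_comp hg he hTo Set.inter_subset_left fun _ _ ↦ univ_mem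
  set f : Coord D → ℝ := fun z ↦ Real.log (Ω (e.symm z)) with hf
  have hfs : ∀ z ∈ T, ContDiffAt ℝ ∞ f z := by
    intro z hz
    have h1 : ContMDiffAt (𝓡 D) 𝓘(ℝ, ℝ) ∞ (fun z ↦ Ω (e.symm z)) z :=
      (hΩ.contMDiffAt (hUo.mem_nhds hz.2)).comp z
        ((contMDiffOn_symm_of_mem_maximalAtlas he).contMDiffAt (e.open_target.mem_nhds hz.1))
    exact (contMDiffAt_iff_contDiffAt.1 h1).log (hpos _ hz.2).ne'
  have hconf' : ∀ z ∈ T, comp g' e z = confMetric (comp g e) f z := by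
    intro z hz
    have hΩz := hpos _ hz.2
    have h1 : Real.exp (-2 * f z) = (Ω (e.symm z) ^ 2)⁻¹ := by
      rw [show -2 * f z = -(f z + f z) by ring, Real.exp_neg, Real.exp_add, hf]
      simp only [Real.exp_log hΩz, sq]
    ext a b
    have h2 : comp g e z a b = Ω (e.symm z) ^ 2 * comp g' e z a b := by
      simp only [comp, Matrix.of_apply]
      rw [hconf _ hz.2]
      rfl
    rw [confMetric, Matrix.smul_apply, smul_eq_mul, h1, h2, inv_mul_cancel_left₀ (by positivity)]
  have hE : ∀ z ∈ T, ∀ a b, ricci (christoffel (confMetric (comp g e) f)) z a b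
      = μ * Real.exp (-2 * f z) * comp g e z a b := by
    intro z hz a b
    have h1 := hμ e he z hz.1 hz.2 a b
    rw [ricci_congr (christoffel_congr (eventually_of_mem (hTo.mem_nhds hz) hconf')),
      hconf' z hz] at h1
    rw [h1, confMetric, Matrix.smul_apply, smul_eq_mul, mul_assoc]
  exact ⟨_, hG.ricci_cConn_of_confMetric hD (fun z hz ↦ hC e he z hz.1) hfs hE ⟨hy, hyU⟩⟩

theorem cRicciCondition_of_locally_conformal (hD : 3 ≤ D) (hg : IsPseudoRiemannianOn g Set.univ)
    (hC : HasInvertibleWeyl g)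
    (h : ∀ x : M, ∃ U : Set M, IsOpen U ∧ x ∈ U ∧ IsConformallyEinsteinOn g U) :
    CRicciCondition g := by
  intro e he y hy a b
  obtain ⟨U, hUo, hxU, hU⟩ := h (e.symm y)
  obtain ⟨t, ht⟩ := exists_ricci_cConn_of_conformal hD hg hC hUo hU he hy hxU
  have hG := isMetricOn_comp_target hg he
  have hDne : (D : ℝ) ≠ 0 := by
    have : D ≠ 0 := by omega
    exact_mod_cast this
  rw [hG.scalarCurv_of_ricci hy ht, ht, ht, hG.apply_comm hy b a]
  refine ⟨by ring, ?_⟩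
  field_simp
  ring

/-- The antisymmetric part of the Ricci tensor of the `𝒞`-connection is a multiple of `dΛ`. -/
theorem CRicciCondition.lamClosed (hD : 3 ≤ D) (hg : IsPseudoRiemannianOn g Set.univ)
    (hC : HasInvertibleWeyl g) (h : CRicciCondition g) : LamClosed g := fun e he _ hy a b ↦
  sub_eq_zero.2 ((isMetricOn_comp_target hg he).lam_closed hD (hC e he) hy (h.ricci_comm he hy a b))

theorem IsPseudoRiemannianOn.smul {U : Set M} (hg : IsPseudoRiemannianOn g U) {h : M → ℝ}
    (hh : ContMDiffOn (𝓡 D) 𝓘(ℝ, ℝ) ∞ h U) (hpos : ∀ x ∈ U, h x ≠ 0) :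
    IsPseudoRiemannianOn (fun x ↦ h x • g x) U where
  symm x hx v w := congrArg (h x * ·) (hg.symm x hx v w)
  nondegenerate x hx v hv := hg.nondegenerate x hx v fun w ↦
    (mul_eq_zero.1 (hv w)).resolve_left (hpos x hx)
  smooth := ContMDiffOn.smul_section hh hg.smooth

/-- The conformal factor is built in a ball of one chart and transported to all other charts. -/
theorem CRicciCondition.exists_isConformallyEinsteinOn (hD : 3 ≤ D)
    (hg : IsPseudoRiemannianOn g Set.univ) (hC : HasInvertibleWeyl g) (h : CRicciCondition g)
    (x : M) : ∃ U : Set M, IsOpen U ∧ x ∈ U ∧ IsConformallyEinsteinOn g U := by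
  set e₀ := chartAt (Coord D) x with he₀def
  have he₀ : e₀ ∈ IsManifold.maximalAtlas (𝓡 D) ∞ M := IsManifold.chart_mem_maximalAtlas x
  obtain ⟨r, hr, hB⟩ := Metric.isOpen_iff.1 e₀.open_target (e₀ x)
    (e₀.map_source (mem_chart_source _ x))
  set B := Metric.ball (e₀ x) r with hBdef
  have hG : IsMetricOn (comp g e₀) B :=
    isMetricOn_comp hg he₀ Metric.isOpen_ball hB fun _ _ ↦ univ_mem
  obtain ⟨f, hf, μ, hμ⟩ := hG.exists_einstein_confMetric hD (convex_ball _ _)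
    (fun y hy ↦ hC e₀ he₀ y (hB hy)) (fun y hy ↦ h.ricci_eq he₀ (hB hy))
  set U := e₀.source ∩ e₀ ⁻¹' B with hUdef
  have hUo : IsOpen U := e₀.isOpen_inter_preimage Metric.isOpen_ball
  have hfM : ContMDiffOn (𝓡 D) 𝓘(ℝ, ℝ) ∞ (fun p ↦ f (e₀ p)) U := by
    intro p hp
    exact ((contMDiffAt_iff_contDiffAt.2 (hf _ hp.2)).comp p
      ((contMDiffOn_of_mem_maximalAtlas he₀).contMDiffAt
        (e₀.open_source.mem_nhds hp.1))).contMDiffWithinAt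
  have hexp : ∀ c : ℝ, ContMDiffOn (𝓡 D) 𝓘(ℝ, ℝ) ∞ (fun p ↦ Real.exp (c * f (e₀ p))) U :=
    fun c ↦ (Real.contDiff_exp.comp (contDiff_const.mul contDiff_id)).contMDiff.comp_contMDiffOn hfM
  set g' : BilinField D M := fun p ↦ Real.exp (-2 * f (e₀ p)) • g p with hg'def
  have hgU : IsPseudoRiemannianOn g U :=
    ⟨fun p _ ↦ hg.symm p trivial, fun p _ ↦ hg.nondegenerate p trivial,
      hg.smooth.mono (Set.subset_univ _)⟩
  have hg' : IsPseudoRiemannianOn g' U := hgU.smul (hexp (-2)) fun _ _ ↦ (Real.exp_pos _).ne'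
  refine ⟨U, hUo, ⟨mem_chart_source _ x, Metric.mem_ball_self hr⟩, g',
    fun p ↦ Real.exp (1 * f (e₀ p)), hg', ⟨μ, fun e he y hy hyU a b ↦ ?_⟩, hexp 1,
    fun _ _ ↦ Real.exp_pos _, fun p _ ↦ ?_⟩
  · set T := e.target ∩ e.symm ⁻¹' U with hT
    have hTo : IsOpen T := e.isOpen_inter_preimage_symm hUo
    have hch : IsCoordChange (confMetric (comp g e₀) f) B (comp g' e) T (transition e e₀) :=
      { metric := hG.confMetric hf
        metric' := isMetricOn_comp hg' he hTo Set.inter_subset_left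
          fun z hz ↦ hUo.mem_nhds hz.2
        mapsTo := fun z hz ↦ hz.2.2
        smooth := fun z hz ↦ contDiffAt_transition he he₀ hz.1 hz.2.1
        det := fun z hz ↦ isUnit_det_jac_transition he he₀ hg hz.1 hz.2.1 univ_mem
        eq := fun z hz ↦ by
          have h1 : comp g' e z = Real.exp (-2 * f (transition e e₀ z)) • comp g e z := by
            ext a b
            rfl
          rw [h1, comp_transition g he he₀ hz.1 hz.2.1, confMetric, Matrix.mul_smul,
            Matrix.smul_mul] }
    exact hch.einstein hμ ⟨hy, hyU⟩ a b
  · have h1 : Real.exp (1 * f (e₀ p)) ^ 2 * Real.exp (-2 * f (e₀ p)) = 1 := by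
      rw [sq, ← Real.exp_add, ← Real.exp_add,
        show 1 * f (e₀ p) + 1 * f (e₀ p) + -2 * f (e₀ p) = 0 by ring, Real.exp_zero]
    rw [hg'def]
    simp only [smul_smul, h1, one_smul]

end ConformalClass

end ConfEinstein

end

theorem mainTheorem1 {D : ℕ} (hD : 3 ≤ D) {M : Type*} [TopologicalSpace M]
    [ChartedSpace (ConfEinstein.Coord D) M] [IsManifold (𝓡 D) ∞ M]
    (g : ConfEinstein.BilinField D M)
    (hg : ConfEinstein.IsPseudoRiemannianOn g Set.univ)
    (hC : ConfEinstein.HasInvertibleWeyl g) :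
    ((∀ x : M, ∃ U : Set M, IsOpen U ∧ x ∈ U ∧ ConfEinstein.IsConformallyEinsteinOn g U) ↔
        ConfEinstein.CRicciCondition g) ∧
      (ConfEinstein.IsConformallyEinsteinOn g Set.univ → ConfEinstein.CRicciCondition g) ∧
      (ConfEinstein.CRicciCondition g → ConfEinstein.LamClosed g) := by
  have hloc := ConfEinstein.cRicciCondition_of_locally_conformal hD hg hC
  exact ⟨⟨hloc, fun h ↦ h.exists_isConformallyEinsteinOn hD hg hC⟩,
    fun h ↦ hloc fun x ↦ ⟨Set.univ, isOpen_univ, trivial, h⟩, fun h ↦ h.lamClosed hD hg hC⟩
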